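/- **Setting.** Let $U,V$ be finite nonempty disjoint sets of nodes, $G=U\cup V$, let $W:U\times V\to\mathbb{Q}_{\ge 0}$ be edge weights on the complete bipartite graph, and let $B:G\to\{1,2,\dots\}$ satisfy $B(u)\le|V|$ for all $u\in U$ and $B(v)\le|U|$ for all $v\in V$. Each node $g$ has copies $g_1,\dots,g_{B(g)}$. Fix a rational $\varepsilon>0$ such that every weight is an integer multiple of $\varepsilon$. A *$B$-matching* is a set $M\subseteq U\times V$ in which every node $g$ has degree at most $B(g)$; the maximum $B$-matching value over a coalition $S_U\cup S_V$ ($S_U\subseteq U$, $S_V\subseteq V$) is the largest total weight of a $B$-matching contained in $S_U\times S_V$. A pair $(x,M)$ with $x\in\mathbb{Q}^G$ is a *nodes-core solution* if $\sum_{g\in S_U\cup S_V}x_g$ is at least the maximum $B$-matching value over $S_U\cup S_V$ for every coalition, $\sum_{g\in G}x_g$ equals the maximum $B$-matching value over $G$, and $M$ is a $B$-matching that attains this value. A *state* $(a,\mathcal M)$ consists of aspirations $a_{g,k}\in\mathbb{Q}$ for all copies and a set $\mathcal M$ of pairs $(u_i,v_j)$ of copies. $\mathcal M$ is a *$B$-copies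 matching* if each copy lies in at most one pair and, for all $u\in U$, $v\in V$, at most one pair of $\mathcal M$ joins a copy of $u$ with a copy of $v$. The *reduction* of $(a,\mathcal M)$ is $(x,M)$ with $x_g=\sum_k a_{g,k}$ and $M=\{(u,v):\exists i,j,\ (u_i,v_j)\in\mathcal M\}$. A state is *feasible* if $\mathcal M$ is a $B$-copies matching, all $a_{g,k}\ge0$, and $a_{u,i}+a_{v,j}=W(u,v)$ for all $(u_i,v_j)\in\mathcal M$. It is a *copies-core solution* if $\mathcal M$ is a $B$-copies matching, $a_{u,i}+a_{v,j}=W(u,v)$ for all $(u_i,v_j)\in\mathcal M$, $a_{u,i}+a_{v,j}\ge W(u,v)$ for all $(u,v)\notin M$ and all $i,j$, and $a_{g,k}=0$ for every copy $g_k$ that is unmatched (free). **$B$-Matching Proposals dynamics.** In each iteration a proposer $p$ is drawn uniformly from $G$ and then a receiver $r$ uniformly from the opposite class, independently of the past; let $\{p,r\}=\{u,v\}$ with $u\in U$, $v\in V$. If copies of $p$ and $r$ are already matched with each other, nothing happens. Otherwise each of $p$ and $r$ considers a copy of minimum aspiration among its free copies if it has any, and among all its copies otherwise; let $p_i,r_j$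 be these copies. If $a_{p,i}+a_{r,j}<W(u,v)$, then $p_i$ and $r_j$ dissolve their old matches (if any) and are matched with each other, and $a_{p,i}$ becomes $W(u,v)-a_{r,j}$. If not, and if $p$ has a free copy of positive aspiration, then one such copy of minimum aspiration lowers its aspiration by $\varepsilon$. Ties between minimizers may be broken in any (deterministic, random or history-dependent) way. **Theorem 2 (convergence of the $B$-Matching Proposals dynamics).** 1. Let the dynamics start from any feasible (possibly random) state whose aspirations are integer multiples of $\varepsilon$; for example, from the empty matching with arbitrary nonnegative aspirations on this grid. Then with probability one there are a feasible copies-core solution $s$, whose reduction is a nodes-core solution, and a time $N$ such that the state equals $s$ at all times $n\ge N$. 2. For every $K$ there are a time $T$ and a $\delta>0$ such that, from any feasible initial state whose aspirations are multiples of $\varepsilon$ and at most $K$, the state at time $T$ is a copies-core solution with probability at least $\delta$. 3. A feasible state whose aspirations are multiples of $\varepsilon$ is absorbing (no proposal can change it) if and only if it is a copies-core solution. -/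

import Mathlib

open MeasureTheory ProbabilityTheory

/-- A weighted `B`-matching problem on the complete bipartite graph with node classes `U`, `V`:
nonnegative rational edge weights and a positive integer `B`-value for each node `g : U ⊕ V`. -/
structure BProblem (U V : Type*) where
  W : U → V → ℚ
  W_nonneg : ∀ u v, 0 ≤ W u v
  B : U ⊕ V → ℕ
  B_pos : ∀ g, 0 < B g

/-- A proposal between `u` and `v`; the proposer is `u` if `byU = true`, and `v` otherwise. -/
@[ext] structure Proposal (U V : Type*) where
  u : U
  v : V
  byU : Bool

/-- The node that makes the proposal. -/
def Proposal.proposer {U V : Type*} (π : Proposal U V) : U ⊕ V :=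
  if π.byU then Sum.inl π.u else Sum.inr π.v

instance (U V : Type*) : MeasurableSpace (Proposal U V) := ⊤

/-- The law of one activation: a proposer uniform among all nodes, then a receiver uniform in the
opposite class. -/
noncomputable def proposalLaw (U V : Type*) [Fintype U] [Fintype V] [Nonempty U] [Nonempty V] :
    PMF (Proposal U V) :=
  (PMF.uniformOfFintype (U ⊕ V)).bind fun p =>
    match p with
    | Sum.inl u => (PMF.uniformOfFintype V).map fun v => ⟨u, v, true⟩
    | Sum.inr v => (PMF.uniformOfFintype U).map fun u => ⟨u, v, false⟩

namespace BProblem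

variable {U V : Type*} (P : BProblem U V)

/-- No node has more copies than there are nodes in the opposite class. -/
def CapacityBound [Fintype U] [Fintype V] : Prop :=
  (∀ u : U, P.B (Sum.inl u) ≤ Fintype.card V) ∧ ∀ v : V, P.B (Sum.inr v) ≤ Fintype.card U

/-! ### Nodes `B`-matchings and the nodes-core -/

/-- `M` is a `B`-matching: every node `g` has degree at most `B g` in `M`. -/
def IsBMatching [DecidableEq U] [DecidableEq V] (M : Finset (U × V)) : Prop :=
  (∀ u : U, (M.filter fun e => e.1 = u).card ≤ P.B (Sum.inl u)) ∧
    ∀ v : V, (M.filter fun e => e.2 = v).card ≤ P.B (Sum.inr v)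

/-- The total weight of a set of edges. -/
def weight (M : Finset (U × V)) : ℚ := ∑ e ∈ M, P.W e.1 e.2

open Classical in
/-- The finite set of `B`-matchings that use only edges between `SU` and `SV`. -/
noncomputable def matchingsOn [DecidableEq U] [DecidableEq V] (SU : Finset U) (SV : Finset V) : Finset (Finset (U × V)) :=
  (SU ×ˢ SV).powerset.filter fun M => P.IsBMatching M

theorem matchingsOn_nonempty [DecidableEq U] [DecidableEq V] (SU : Finset U) (SV : Finset V) :
    (P.matchingsOn SU SV).Nonempty := by
  classical
  refine ⟨∅, Finset.mem_filter.2 ⟨Finset.empty_mem_powerset _, ?_, ?_⟩⟩ <;> intro g <;> simp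

/-- The maximum `B`-matching value over the coalition `SU ∪ SV`. -/
noncomputable def maxValue [DecidableEq U] [DecidableEq V] (SU : Finset U) (SV : Finset V) : ℚ :=
  (P.matchingsOn SU SV).sup' (P.matchingsOn_nonempty SU SV) P.weight

/-- `x` is a core allocation of the `B`-matching problem. -/
def IsCoreAllocation [Fintype U] [Fintype V] [DecidableEq U] [DecidableEq V]
    (x : U ⊕ V → ℚ) : Prop :=
  (∀ (SU : Finset U) (SV : Finset V),
      P.maxValue SU SV ≤ ∑ u ∈ SU, x (Sum.inl u) + ∑ v ∈ SV, x (Sum.inr v)) ∧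
    ∑ g, x g = P.maxValue Finset.univ Finset.univ

/-- `(x, M)` is a nodes-core solution: `x` is a core allocation and `M` is a `B`-matching that
achieves the maximum `B`-matching value. -/
def IsNodesCore [Fintype U] [Fintype V] [DecidableEq U] [DecidableEq V]
    (y : (U ⊕ V → ℚ) × Finset (U × V)) : Prop :=
  P.IsCoreAllocation y.1 ∧ P.IsBMatching y.2 ∧
    P.weight y.2 = P.maxValue Finset.univ Finset.univ

/-! ### Copies, states, and the copies-core -/

/-- The copies `g_k` of all nodes. -/
abbrev Copy : Type _ := Σ g : U ⊕ V, Fin (P.B g)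

/-- The copies of the `U`-nodes. -/
abbrev UCopy : Type _ := Σ u : U, Fin (P.B (Sum.inl u))

/-- The copies of the `V`-nodes. -/
abbrev VCopy : Type _ := Σ v : V, Fin (P.B (Sum.inr v))

/-- A state: the aspirations (allocations) of all copies and a set of edges between copies. -/
@[ext] structure State where
  a : P.Copy → ℚ
  M : Finset (P.UCopy × P.VCopy)

instance : MeasurableSpace P.State := ⊤

variable {P}

namespace State

/-- The aspiration of the copy `u_i`. -/
def aU (s : P.State) (u : U) (i : Fin (P.B (Sum.inl u))) : ℚ := s.a ⟨Sum.inl u, i⟩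

/-- The aspiration of the copy `v_j`. -/
def aV (s : P.State) (v : V) (j : Fin (P.B (Sum.inr v))) : ℚ := s.a ⟨Sum.inr v, j⟩

/-- Some copy of `u` is matched with some copy of `v`. -/
def Linked (s : P.State) (u : U) (v : V) : Prop := ∃ i j, (⟨u, i⟩, ⟨v, j⟩) ∈ s.M

/-- The matching of `s` is a `B`-copies matching: each copy lies on at most one edge, and each pair
of nodes is joined by at most one edge. -/
def IsCopiesMatching (s : P.State) : Prop :=
  (∀ e ∈ s.M, ∀ f ∈ s.M, e.1 = f.1 → e = f) ∧
    (∀ e ∈ s.M, ∀ f ∈ s.M, e.2 = f.2 → e = f) ∧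
    ∀ e ∈ s.M, ∀ f ∈ s.M, e.1.1 = f.1.1 → e.2.1 = f.2.1 → e = f

/-- The copy `c` is free (unmatched) in `s`. -/
def IsFree (s : P.State) : P.Copy → Prop
  | ⟨Sum.inl u, i⟩ => ∀ w : P.VCopy, (⟨u, i⟩, w) ∉ s.M
  | ⟨Sum.inr v, j⟩ => ∀ w : P.UCopy, (w, ⟨v, j⟩) ∉ s.M

/-- The copy `c` is free and has a strictly positive aspiration. -/
def IsFreePos (s : P.State) (c : P.Copy) : Prop := s.IsFree c ∧ 0 < s.a c

/-- Edge saturation: the aspirations of two matched copies add up to the weight of their edge. -/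
def EdgeSaturated (s : P.State) : Prop :=
  ∀ u i v j, (⟨u, i⟩, ⟨v, j⟩) ∈ s.M → s.aU u i + s.aV v j = P.W u v

/-- Stability against pairwise deviation. -/
def PairwiseStable (s : P.State) : Prop :=
  ∀ u v, ¬ s.Linked u v → ∀ i j, P.W u v ≤ s.aU u i + s.aV v j

/-- Zero gain for unmatched copies. -/
def ZeroGainFree (s : P.State) : Prop := ∀ c, s.IsFree c → s.a c = 0

/-- `s` is a copies-core solution. -/
def IsCopiesCore (s : P.State) : Prop :=
  s.IsCopiesMatching ∧ s.EdgeSaturated ∧ s.PairwiseStable ∧ s.ZeroGainFree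

/-- `s` is a feasible state. -/
def IsFeasible (s : P.State) : Prop :=
  s.IsCopiesMatching ∧ (∀ c, 0 ≤ s.a c) ∧ s.EdgeSaturated

/-- All aspirations lie on the grid of width `ε`. -/
def OnGrid (ε : ℚ) (s : P.State) : Prop := ∀ c, ∃ k : ℤ, s.a c = k * ε

/-- The reduction function: each node gets the sum of the gains of its copies, and two nodes are
matched if some copies of them are. -/
def reduce [DecidableEq U] [DecidableEq V] (s : P.State) : (U ⊕ V → ℚ) × Finset (U × V) :=
  (fun g => ∑ k, s.a ⟨g, k⟩, s.M.image fun e => (e.1.1, e.2.1))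

/-! ### The dynamics -/

/-- `k` is a copy that node `g` may consider in a proposal: a free copy of minimum aspiration among
the free copies of `g` if there are any, otherwise a copy of minimum aspiration. -/
def IsConsidered (s : P.State) (g : U ⊕ V) (k : Fin (P.B g)) : Prop :=
  ((∃ k', s.IsFree ⟨g, k'⟩) →
      s.IsFree ⟨g, k⟩ ∧ ∀ k', s.IsFree ⟨g, k'⟩ → s.a ⟨g, k⟩ ≤ s.a ⟨g, k'⟩) ∧
    ((¬ ∃ k', s.IsFree ⟨g, k'⟩) → ∀ k', s.a ⟨g, k⟩ ≤ s.a ⟨g, k'⟩)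

/-- `k` is a copy of minimum aspiration among the free copies of `g` of positive aspiration. -/
def IsMinFreePos (s : P.State) (g : U ⊕ V) (k : Fin (P.B g)) : Prop :=
  s.IsFreePos ⟨g, k⟩ ∧ ∀ k', s.IsFreePos ⟨g, k'⟩ → s.a ⟨g, k⟩ ≤ s.a ⟨g, k'⟩

variable [DecidableEq U] [DecidableEq V]

/-- The matching after the copies `x` and `y` dissolve their old matches, if any, and join. -/
def rematch (s : P.State) (x : P.UCopy) (y : P.VCopy) : Finset (P.UCopy × P.VCopy) :=
  insert (x, y) (s.M.filter fun e => e.1 ≠ x ∧ e.2 ≠ y)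

/-- The state after a successful proposal that joins the copy `i` of `π.u` and the copy `j` of
`π.v`: the aspiration of the proposer's copy becomes the weight of the edge minus the aspiration of
the receiver's copy. -/
def accept (s : P.State) (π : Proposal U V) (i : Fin (P.B (Sum.inl π.u)))
    (j : Fin (P.B (Sum.inr π.v))) : P.State where
  a := if π.byU then Function.update s.a ⟨Sum.inl π.u, i⟩ (P.W π.u π.v - s.aV π.v j)
    else Function.update s.a ⟨Sum.inr π.v, j⟩ (P.W π.u π.v - s.aU π.u i)
  M := s.rematch ⟨π.u, i⟩ ⟨π.v, j⟩

/-- The state after the copy `c` lowers its aspiration by `ε`. -/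
def lower (ε : ℚ) (s : P.State) (c : P.Copy) : P.State where
  a := Function.update s.a c (s.a c - ε)
  M := s.M

/-- `Step ε s π s'`: from the state `s`, an iteration with the proposal `π` may lead to the
state `s'`. The only freedom is the choice among several minimizers of the aspiration. -/
inductive Step (ε : ℚ) (s : P.State) (π : Proposal U V) : P.State → Prop
  | skip (h : s.Linked π.u π.v) : Step ε s π s
  | succeed (h : ¬ s.Linked π.u π.v) (i : Fin (P.B (Sum.inl π.u))) (j : Fin (P.B (Sum.inr π.v)))
      (hi : s.IsConsidered (Sum.inl π.u) i) (hj : s.IsConsidered (Sum.inr π.v) j)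
      (hW : s.aU π.u i + s.aV π.v j < P.W π.u π.v) : Step ε s π (s.accept π i j)
  | decrease (h : ¬ s.Linked π.u π.v) (i : Fin (P.B (Sum.inl π.u))) (j : Fin (P.B (Sum.inr π.v)))
      (hi : s.IsConsidered (Sum.inl π.u) i) (hj : s.IsConsidered (Sum.inr π.v) j)
      (hW : P.W π.u π.v ≤ s.aU π.u i + s.aV π.v j) (m : Fin (P.B π.proposer))
      (hm : s.IsMinFreePos π.proposer m) : Step ε s π (s.lower ε ⟨π.proposer, m⟩)
  | stay (h : ¬ s.Linked π.u π.v) (i : Fin (P.B (Sum.inl π.u))) (j : Fin (P.B (Sum.inr π.v)))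
      (hi : s.IsConsidered (Sum.inl π.u) i) (hj : s.IsConsidered (Sum.inr π.v) j)
      (hW : P.W π.u π.v ≤ s.aU π.u i + s.aV π.v j)
      (hm : ∀ k, ¬ s.IsFreePos ⟨π.proposer, k⟩) : Step ε s π s

/-- `s` is absorbing: no proposal can change it. -/
def IsAbsorbing (ε : ℚ) (s : P.State) : Prop := ∀ π s', Step ε s π s' → s' = s

end State

/-- The sequence of random states `X` follows the `B`-Matching Proposals dynamics with proposals
`π`: the `n`-th proposal has the law `proposalLaw` and is independent of the history `ℱ n` up to
time `n`, and each state arises from the preceding one by an iteration of the algorithm. Ties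
between minimizers may be broken in any way, deterministic, random or history-dependent. -/
structure IsProposalsDynamics [Fintype U] [Fintype V] [Nonempty U] [Nonempty V] [DecidableEq U]
    [DecidableEq V] (P : BProblem U V) (ε : ℚ) {Ω : Type*} {mΩ : MeasurableSpace Ω}
    (μ : Measure Ω) (ℱ : Filtration ℕ mΩ) (X : ℕ → Ω → P.State) (π : ℕ → Ω → Proposal U V) :
    Prop where
  measurable_state : ∀ n, Measurable[ℱ n] (X n)
  measurable_proposal : ∀ n, Measurable[ℱ (n + 1)] (π n)
  law : ∀ n, μ.map (π n) = (proposalLaw U V).toMeasure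
  indep : ∀ n, Indep (MeasurableSpace.comap (π n) inferInstance) (ℱ n) μ
  step : ∀ n, ∀ᵐ ω ∂μ, (X n ω).Step ε (π n ω) (X (n + 1) ω)

end BProblem

/-!
Think of the dynamics as a game: one player chooses the proposals, an opponent breaks the ties. A
state is `Forced` if the first player can lead it to the core within a given number of iterations
against every opponent. If all feasible states on the grid are forced, then, as there are only
finitely many of them with aspirations below a bound and every proposal has probability at least
some `c > 0`, there is a number `N` such that each block of `N` iterations reaches the core with
conditional probability at least `c ^ N` (`IsProposalsDynamics.pow_mul_le_of_forced`). Core states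
never change, so the state converges almost surely (`ae_exists_core_of_le`).

Suppose that some state is not forced. Then the opponent can respond to every proposal with another
such state. No iteration creates a link of weight zero, and so, if only the states of this kind with
the fewest links of weight zero are kept, the responses never dissolve such a link, and every
displaced node can return. In units of the grid width and up to the names of the copies, these
states form a nonempty set `L` of profiles that is `Market.Stuck` (`State.stuck_trap`). The main
part of the proof shows that a stuck set is empty (`Market.Stuck.eq_empty`):

* A profile is `Balanced` for lower bounds `q` on the aspirations in `U` if the free copies in `V`
  have aspiration zero and every `u` has at least as many free copies as there are partners with
  which it would gain at the aspiration `q u`. An exponential potential yields one in `L`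
  (`Market.Stuck.exists_balanced`). Consider an `Optimal` one: with as few free copies of nodes with
  `q u > 0` as possible (`tau`), and then with the largest value of twice the sum of the aspirations
  in `V` minus the sum of those in `U` (`objective`).
* In an optimal profile no pair gains under the bounds, and since it is not in the core, some `u₀`
  with `q u₀ > 0` has a free copy (`Optimal.le_add`, `Optimal.exists_free`).
* A `Frame` is a balanced profile except that copies in `U` may be one below the bound. From a frame
  a balanced profile with no more free copies can be reached (`Frame.exists_balanced`). The
  difficult case is a node without free copies, whose aspirations are raised to the bound one after
  the other with the help of a partner that it would gain with (`Frame.raise_full`).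
* Hence no alternating path of tight pairs and links can lead from the free copy of `u₀` to a free
  copy in `V` or to a link of which `V` has the whole weight, since shifting the links along it would
  reduce the number of free copies that `tau` counts (`Frame.not_reach`).
* Let `u₀` lower its free copy below the bound, which increases the objective, and consider the
  profiles in `L` with the same links that are one below the bounds only where no such path starts
  (`InPlace`). Take one with the largest objective. If all nodes below their bounds have enough free
  copies, then it is balanced for smaller bounds, against optimality. Otherwise some node `z` below
  its bound gains with an unlinked `v`; if the two link, the displaced partner of `v` displaces `z`
  in turn, and this increases the objective (`Violation.improve_of_free`,
  `Violation.improve_of_full`).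

That the reduction of a copies-core solution is a nodes-core solution is linear programming duality:
a pair of a `B`-matching is charged to the aspirations on its link if it is linked, and to the least
aspirations of its nodes otherwise (`IsCopiesCore.weight_le`). In a state that is not in the core a
pair gains or a free copy has positive aspiration; in the latter case the capacity bound provides an
unlinked node, and a proposal to it changes the state (`IsAbsorbing.isCopiesCore`).
-/

set_option linter.unusedSectionVars false

/-! ### The proposal game on node profiles -/

namespace ProposalGame

/-- Integer data of a `B`-matching problem: weights in units of the grid width and capacities. -/
structure Market (U V : Type*) [Fintype U] [Fintype V] where
  w : U → V → ℕ
  bU : U → ℕ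
  bV : V → ℕ
  bU_pos : ∀ u, 0 < bU u
  bV_pos : ∀ v, 0 < bV v
  bU_le : ∀ u, bU u ≤ Fintype.card V
  bV_le : ∀ v, bV v ≤ Fintype.card U

/-- A state of the dynamics up to the names of the copies: the linked pairs of nodes `E`, the
aspirations `x` and `y` of the two copies on each link, and for each node the multiset of the
aspirations of its free copies. The values of `x` and `y` outside `E` have no meaning. -/
@[ext] structure Profile (U V : Type*) where
  E : Finset (U × V)
  x : U × V → ℕ
  y : U × V → ℕ
  F : U → Multiset ℕ
  G : V → Multiset ℕ

/-- The aspiration that a node considers: the least free one if there is a free copy, and the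
least linked one otherwise. -/
noncomputable def considered (F : Multiset ℕ) (S : Set ℕ) : ℕ :=
  sInf {a | (F ≠ 0 ∧ a ∈ F) ∨ (F = 0 ∧ a ∈ S)}

theorem considered_mem {F : Multiset ℕ} {S : Set ℕ} (h : F ≠ 0) : considered F S ∈ F := by
  obtain ⟨a, ha⟩ := Multiset.exists_mem_of_ne_zero h
  have := Nat.sInf_mem (s := {a | (F ≠ 0 ∧ a ∈ F) ∨ (F = 0 ∧ a ∈ S)}) ⟨a, Or.inl ⟨h, ha⟩⟩
  rcases this with h1 | h1
  · exact h1.2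
  · exact absurd h1.1 h

theorem considered_le {F : Multiset ℕ} {S : Set ℕ} {a : ℕ} (h : a ∈ F) : considered F S ≤ a :=
  Nat.sInf_le (Or.inl ⟨by rintro rfl; simp at h, h⟩)

theorem considered_mem_set {S : Set ℕ} (h : S.Nonempty) : considered 0 S ∈ S := by
  obtain ⟨a, ha⟩ := h
  have := Nat.sInf_mem (s := {a | ((0 : Multiset ℕ) ≠ 0 ∧ a ∈ (0 : Multiset ℕ)) ∨
    ((0 : Multiset ℕ) = 0 ∧ a ∈ S)}) ⟨a, Or.inr ⟨rfl, ha⟩⟩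
  rcases this with h1 | h1
  · exact absurd rfl h1.1
  · exact h1.2

theorem considered_zero_le {S : Set ℕ} {a : ℕ} (h : a ∈ S) : considered 0 S ≤ a :=
  Nat.sInf_le (Or.inr ⟨rfl, h⟩)

variable {U V : Type*}

namespace Profile

/-- The aspiration that `u` considers. -/
noncomputable def cU (s : Profile U V) (u : U) : ℕ :=
  considered (s.F u) {a | ∃ v, (u, v) ∈ s.E ∧ s.x (u, v) = a}

/-- The aspiration that `v` considers. -/
noncomputable def cV (s : Profile U V) (v : V) : ℕ :=
  considered (s.G v) {a | ∃ u, (u, v) ∈ s.E ∧ s.y (u, v) = a}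

theorem cU_mem {s : Profile U V} {u : U} (h : s.F u ≠ 0) : s.cU u ∈ s.F u := considered_mem h

theorem cV_mem {s : Profile U V} {v : V} (h : s.G v ≠ 0) : s.cV v ∈ s.G v := considered_mem h

theorem cU_le {s : Profile U V} {u : U} {t : ℕ} (h : t ∈ s.F u) : s.cU u ≤ t := considered_le h

theorem cV_le {s : Profile U V} {v : V} {t : ℕ} (h : t ∈ s.G v) : s.cV v ≤ t := considered_le h

theorem cU_le_link {s : Profile U V} {u : U} {v : V} (h : s.F u = 0) (he : (u, v) ∈ s.E) :
    s.cU u ≤ s.x (u, v) := by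
  unfold cU; rw [h]; exact considered_zero_le ⟨v, he, rfl⟩

theorem cV_le_link {s : Profile U V} {u : U} {v : V} (h : s.G v = 0) (he : (u, v) ∈ s.E) :
    s.cV v ≤ s.y (u, v) := by
  unfold cV; rw [h]; exact considered_zero_le ⟨u, he, rfl⟩

/-- The considered aspiration of `v` depends only on the column of `v`. -/
theorem cV_congr {s s' : Profile U V} {v : V} (hG : s'.G v = s.G v)
    (hE : ∀ u, (u, v) ∈ s'.E ↔ (u, v) ∈ s.E)
    (hy : ∀ u, (u, v) ∈ s.E → s'.y (u, v) = s.y (u, v)) : s'.cV v = s.cV v := by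
  unfold cV
  rw [hG]
  congr 1
  ext a
  constructor
  · rintro ⟨u, hu, rfl⟩
    exact ⟨u, (hE u).1 hu, (hy u ((hE u).1 hu)).symm⟩
  · rintro ⟨u, hu, rfl⟩
    exact ⟨u, (hE u).2 hu, hy u hu⟩

variable [DecidableEq U] [DecidableEq V]

/-- The link `e` is dissolved. -/
def release (s : Profile U V) (e : U × V) : Profile U V where
  E := s.E.erase e
  x := s.x
  y := s.y
  F := Function.update s.F e.1 (s.x e ::ₘ s.F e.1)
  G := Function.update s.G e.2 (s.y e ::ₘ s.G e.2)

/-- Free copies of aspirations `t` and `c` of the two nodes of `e` are linked, with the new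
aspirations `xn` and `yn`. -/
def join (s : Profile U V) (e : U × V) (t c xn yn : ℕ) : Profile U V where
  E := insert e s.E
  x := Function.update s.x e xn
  y := Function.update s.y e yn
  F := Function.update s.F e.1 ((s.F e.1).erase t)
  G := Function.update s.G e.2 ((s.G e.2).erase c)

/-- A free copy of `u` of aspiration `h` lowers it by one. -/
def lowerF (s : Profile U V) (u : U) (h : ℕ) : Profile U V :=
  { s with F := Function.update s.F u ((h - 1) ::ₘ (s.F u).erase h) }

/-- A free copy of `v` of aspiration `h` lowers it by one. -/
def lowerG (s : Profile U V) (v : V) (h : ℕ) : Profile U V :=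
  { s with G := Function.update s.G v ((h - 1) ::ₘ (s.G v).erase h) }

/-- The sum of `φ` over the aspirations of all `U`-copies. -/
def sumU [Fintype U] (φ : U → ℕ → ℕ) (s : Profile U V) : ℕ :=
  ∑ e ∈ s.E, φ e.1 (s.x e) + ∑ u, ((s.F u).map (φ u)).sum

/-- The sum of `φ` over the aspirations of all `V`-copies. -/
def sumV [Fintype V] (φ : V → ℕ → ℕ) (s : Profile U V) : ℕ :=
  ∑ e ∈ s.E, φ e.2 (s.y e) + ∑ v, ((s.G v).map (φ v)).sum

theorem sum_update_map {A : Type*} [Fintype A] [DecidableEq A] (φ : A → ℕ → ℕ)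
    (F : A → Multiset ℕ) (u : A) (m : Multiset ℕ) :
    ∑ a, ((Function.update F u m a).map (φ a)).sum + ((F u).map (φ u)).sum =
      ∑ a, ((F a).map (φ a)).sum + (m.map (φ u)).sum := by
  rw [← Finset.add_sum_erase _ _ (Finset.mem_univ u),
    ← Finset.add_sum_erase (a := u) _ (fun a => ((F a).map (φ a)).sum) (Finset.mem_univ u)]
  have : ∑ a ∈ Finset.univ.erase u, ((Function.update F u m a).map (φ a)).sum =
      ∑ a ∈ Finset.univ.erase u, ((F a).map (φ a)).sum :=
    Finset.sum_congr rfl fun a ha => by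
      rw [Function.update_of_ne (Finset.ne_of_mem_erase ha)]
  rw [this, Function.update_self]
  ring

theorem sum_map_erase (φ : ℕ → ℕ) {m : Multiset ℕ} {t : ℕ} (h : t ∈ m) :
    ((m.erase t).map φ).sum + φ t = (m.map φ).sum := by
  conv_rhs => rw [← Multiset.cons_erase h]
  rw [Multiset.map_cons, Multiset.sum_cons, add_comm]

section Sums
variable [Fintype U] [Fintype V]

theorem sumU_release (φ : U → ℕ → ℕ) {s : Profile U V} {e : U × V} (he : e ∈ s.E) :
    (s.release e).sumU φ = s.sumU φ := by
  unfold sumU release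
  have h1 := sum_update_map φ s.F e.1 (s.x e ::ₘ s.F e.1)
  have h2 := Finset.sum_erase_add s.E (fun e => φ e.1 (s.x e)) he
  rw [Multiset.map_cons, Multiset.sum_cons] at h1
  simp only at h1 h2 ⊢
  omega

theorem sumV_release (φ : V → ℕ → ℕ) {s : Profile U V} {e : U × V} (he : e ∈ s.E) :
    (s.release e).sumV φ = s.sumV φ := by
  unfold sumV release
  have h1 := sum_update_map φ s.G e.2 (s.y e ::ₘ s.G e.2)
  have h2 := Finset.sum_erase_add s.E (fun e => φ e.2 (s.y e)) he
  rw [Multiset.map_cons, Multiset.sum_cons] at h1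
  simp only at h1 h2 ⊢
  omega

theorem sumU_join (φ : U → ℕ → ℕ) {s : Profile U V} {e : U × V} {t : ℕ} (c xn yn : ℕ)
    (he : e ∉ s.E) (ht : t ∈ s.F e.1) :
    (s.join e t c xn yn).sumU φ + φ e.1 t = s.sumU φ + φ e.1 xn := by
  unfold sumU join
  have h1 := sum_update_map φ s.F e.1 ((s.F e.1).erase t)
  have h2 := Finset.sum_insert (f := fun f : U × V => φ f.1 (Function.update s.x e xn f)) he
  have h3 : ∑ f ∈ s.E, φ f.1 (Function.update s.x e xn f) = ∑ f ∈ s.E, φ f.1 (s.x f) :=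
    Finset.sum_congr rfl fun f hf => by
      rw [Function.update_of_ne (by rintro rfl; exact he hf)]
  have h4 := sum_map_erase (φ e.1) ht
  simp only [Function.update_self] at h1 h2 h3 ⊢
  omega

theorem sumV_join (φ : V → ℕ → ℕ) {s : Profile U V} {e : U × V} {c : ℕ} (t xn yn : ℕ)
    (he : e ∉ s.E) (hc : c ∈ s.G e.2) :
    (s.join e t c xn yn).sumV φ + φ e.2 c = s.sumV φ + φ e.2 yn := by
  unfold sumV join
  have h1 := sum_update_map φ s.G e.2 ((s.G e.2).erase c)
  have h2 := Finset.sum_insert (f := fun f : U × V => φ f.2 (Function.update s.y e yn f)) he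
  have h3 : ∑ f ∈ s.E, φ f.2 (Function.update s.y e yn f) = ∑ f ∈ s.E, φ f.2 (s.y f) :=
    Finset.sum_congr rfl fun f hf => by
      rw [Function.update_of_ne (by rintro rfl; exact he hf)]
  have h4 := sum_map_erase (φ e.2) hc
  simp only [Function.update_self] at h1 h2 h3 ⊢
  omega

theorem sumU_lowerF (φ : U → ℕ → ℕ) {s : Profile U V} {u : U} {h : ℕ} (hh : h ∈ s.F u) :
    (s.lowerF u h).sumU φ + φ u h = s.sumU φ + φ u (h - 1) := by
  unfold sumU lowerF
  have h1 := sum_update_map φ s.F u ((h - 1) ::ₘ (s.F u).erase h)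
  have h4 := sum_map_erase (φ u) hh
  rw [Multiset.map_cons, Multiset.sum_cons] at h1
  simp only at h1 ⊢
  omega

theorem sumV_lowerG (φ : V → ℕ → ℕ) {s : Profile U V} {v : V} {h : ℕ} (hh : h ∈ s.G v) :
    (s.lowerG v h).sumV φ + φ v h = s.sumV φ + φ v (h - 1) := by
  unfold sumV lowerG
  have h1 := sum_update_map φ s.G v ((h - 1) ::ₘ (s.G v).erase h)
  have h4 := sum_map_erase (φ v) hh
  rw [Multiset.map_cons, Multiset.sum_cons] at h1
  simp only at h1 ⊢
  omega

end Sums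

end Profile

open Profile

variable [Fintype U] [Fintype V] [DecidableEq U] [DecidableEq V]

/-- The links are saturated, and the numbers of copies agree with the capacities. -/
structure Market.Valid (A : Market U V) (s : Profile U V) : Prop where
  sat : ∀ u v, (u, v) ∈ s.E → s.x (u, v) + s.y (u, v) = A.w u v
  cardF : ∀ u, (s.F u).card + (s.E.filter fun e => e.1 = u).card = A.bU u
  cardG : ∀ v, (s.G v).card + (s.E.filter fun e => e.2 = v).card = A.bV v

/-- No pair can gain, and the free copies have aspiration zero. -/
def Market.Core (A : Market U V) (s : Profile U V) : Prop :=
  (∀ u v, (u, v) ∉ s.E → A.w u v ≤ s.cU u + s.cV v) ∧ (∀ u, ∀ t ∈ s.F u, t = 0) ∧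
    ∀ v, ∀ t ∈ s.G v, t = 0

/-- If `u` has no free copy, then one of its links on which `u` has the aspiration `a` is
dissolved. -/
def Market.RelU (A : Market U V) (s : Profile U V) (u : U) (a : ℕ) (s₁ : Profile U V) : Prop :=
  (s.F u ≠ 0 ∧ s₁ = s) ∨
    (s.F u = 0 ∧ ∃ v, (u, v) ∈ s.E ∧ s.x (u, v) = a ∧ A.w u v ≠ 0 ∧ s₁ = s.release (u, v))

/-- If `v` has no free copy, then one of its links on which `v` has the aspiration `c` is
dissolved. -/
def Market.RelV (A : Market U V) (s : Profile U V) (v : V) (c : ℕ) (s₁ : Profile U V) : Prop :=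
  (s.G v ≠ 0 ∧ s₁ = s) ∨
    (s.G v = 0 ∧ ∃ u, (u, v) ∈ s.E ∧ s.y (u, v) = c ∧ A.w u v ≠ 0 ∧ s₁ = s.release (u, v))

/-- A set of profiles, none of them in the core, in which the player who breaks the ties can keep
the dynamics, whatever the proposals are. It is a hypothesis on `L` that this player never has to
dissolve a link of weight zero. -/
structure Market.Stuck (A : Market U V) (L : Set (Profile U V)) : Prop where
  valid : ∀ s ∈ L, A.Valid s
  notCore : ∀ s ∈ L, ¬ A.Core s
  acceptU : ∀ s ∈ L, ∀ u v, (u, v) ∉ s.E → s.cU u + s.cV v < A.w u v →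
    ∃ s₁ s₂, A.RelU s u (s.cU u) s₁ ∧ A.RelV s₁ v (s.cV v) s₂ ∧
      s₂.join (u, v) (s.cU u) (s.cV v) (A.w u v - s.cV v) (s.cV v) ∈ L
  acceptV : ∀ s ∈ L, ∀ u v, (u, v) ∉ s.E → s.cU u + s.cV v < A.w u v →
    ∃ s₁ s₂, A.RelU s u (s.cU u) s₁ ∧ A.RelV s₁ v (s.cV v) s₂ ∧
      s₂.join (u, v) (s.cU u) (s.cV v) (s.cU u) (A.w u v - s.cU u) ∈ L
  lowerU : ∀ s ∈ L, ∀ u v, (u, v) ∉ s.E → A.w u v ≤ s.cU u + s.cV v →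
    ∀ h ∈ s.F u, 0 < h → (∀ t ∈ s.F u, 0 < t → h ≤ t) → s.lowerF u h ∈ L
  lowerV : ∀ s ∈ L, ∀ u v, (u, v) ∉ s.E → A.w u v ≤ s.cU u + s.cV v →
    ∀ h ∈ s.G v, 0 < h → (∀ t ∈ s.G v, 0 < t → h ≤ t) → s.lowerG v h ∈ L

namespace Market
variable {A : Market U V} {s : Profile U V}

theorem Valid.exists_link_of_full (hs : A.Valid s) {u : U} (h : s.F u = 0) :
    ∃ v, (u, v) ∈ s.E ∧ s.x (u, v) = s.cU u := by
  have hne : {a | ∃ v, (u, v) ∈ s.E ∧ s.x (u, v) = a}.Nonempty := by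
    have h1 := hs.cardF u
    have h2 := A.bU_pos u
    rw [h, Multiset.card_zero, zero_add] at h1
    rw [← h1, Finset.card_pos] at h2
    obtain ⟨⟨u', v⟩, hv⟩ := h2
    have h3 := Finset.mem_filter.1 hv
    obtain rfl : u' = u := h3.2
    exact ⟨_, v, h3.1, rfl⟩
  have := considered_mem_set hne
  unfold cU; rw [h]; exact this

theorem Valid.exists_link_of_full' (hs : A.Valid s) {v : V} (h : s.G v = 0) :
    ∃ u, (u, v) ∈ s.E ∧ s.y (u, v) = s.cV v := by
  have hne : {a | ∃ u, (u, v) ∈ s.E ∧ s.y (u, v) = a}.Nonempty := by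
    have h1 := hs.cardG v
    have h2 := A.bV_pos v
    rw [h, Multiset.card_zero, zero_add] at h1
    rw [← h1, Finset.card_pos] at h2
    obtain ⟨⟨u, v'⟩, hv⟩ := h2
    have h3 := Finset.mem_filter.1 hv
    obtain rfl : v' = v := h3.2
    exact ⟨_, u, h3.1, rfl⟩
  have := considered_mem_set hne
  unfold cV; rw [h]; exact this

theorem Valid.le_cU (hs : A.Valid s) {u : U} {a : ℕ} (h1 : ∀ t ∈ s.F u, a ≤ t)
    (h2 : s.F u = 0 → ∀ v, (u, v) ∈ s.E → a ≤ s.x (u, v)) : a ≤ s.cU u := by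
  by_cases h : s.F u = 0
  · obtain ⟨v, hv, he⟩ := hs.exists_link_of_full h
    exact he ▸ h2 h v hv
  · exact h1 _ (cU_mem h)

theorem Valid.le_cV (hs : A.Valid s) {v : V} {a : ℕ} (h1 : ∀ t ∈ s.G v, a ≤ t)
    (h2 : s.G v = 0 → ∀ u, (u, v) ∈ s.E → a ≤ s.y (u, v)) : a ≤ s.cV v := by
  by_cases h : s.G v = 0
  · obtain ⟨u, hv, he⟩ := hs.exists_link_of_full' h
    exact he ▸ h2 h u hv
  · exact h1 _ (cV_mem h)

/-- By the capacity bound, a node with a free copy has an unlinked partner. -/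
theorem Valid.exists_unlinked (hs : A.Valid s) {u : U} (h : s.F u ≠ 0) : ∃ v, (u, v) ∉ s.E := by
  by_contra! hall
  have h1 := hs.cardF u
  have h2 := A.bU_le u
  have h3 : (Finset.univ.image fun v : V => (u, v)) ⊆ s.E.filter fun e => e.1 = u := by
    intro e he
    obtain ⟨v, -, rfl⟩ := Finset.mem_image.1 he
    exact Finset.mem_filter.2 ⟨hall v, rfl⟩
  have h4 := Finset.card_le_card h3
  rw [Finset.card_image_of_injective _ (Prod.mk_right_injective u), Finset.card_univ] at h4
  have h5 := Multiset.card_pos.2 h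
  omega

theorem Valid.exists_unlinked' (hs : A.Valid s) {v : V} (h : s.G v ≠ 0) : ∃ u, (u, v) ∉ s.E := by
  by_contra! hall
  have h1 := hs.cardG v
  have h2 := A.bV_le v
  have h3 : (Finset.univ.image fun u : U => (u, v)) ⊆ s.E.filter fun e => e.2 = v := by
    intro e he
    obtain ⟨u, -, rfl⟩ := Finset.mem_image.1 he
    exact Finset.mem_filter.2 ⟨hall u, rfl⟩
  have h4 := Finset.card_le_card h3
  rw [Finset.card_image_of_injective _ (Prod.mk_left_injective v), Finset.card_univ] at h4
  have h5 := Multiset.card_pos.2 h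
  omega

/-- Two valid profiles with the same links have the same numbers of free copies. -/
theorem Valid.card_eq {s' : Profile U V} (hs : A.Valid s) (hs' : A.Valid s') (h : s'.E = s.E)
    (u : U) : (s'.F u).card = (s.F u).card := by
  have h1 := hs.cardF u
  have h2 := hs'.cardF u
  rw [h] at h2
  omega

end Market

end ProposalGame

namespace ProposalGame
open Profile

/-! ### Links formed by a node with a free copy -/

theorem exists_min_of_exists {α : Type*} (p : α → Prop) (f : α → ℕ) (h : ∃ a, p a) :
    ∃ a, p a ∧ ∀ b, p b → f a ≤ f b := by
  classical
  have h' : ∃ n, ∃ a, p a ∧ f a = n := by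
    obtain ⟨a, ha⟩ := h
    exact ⟨_, a, ha, rfl⟩
  obtain ⟨a, ha, hn⟩ := Nat.find_spec h'
  exact ⟨a, ha, fun b hb => hn ▸ Nat.find_min' h' ⟨b, hb, rfl⟩⟩

theorem exists_max_of_bddAbove {α : Type*} (p : α → Prop) (f : α → ℤ) (C : ℤ) (h : ∃ a, p a)
    (hC : ∀ a, p a → f a ≤ C) : ∃ a, p a ∧ ∀ b, p b → f b ≤ f a := by
  obtain ⟨a, ha, hmin⟩ := exists_min_of_exists p (fun a => (C - f a).toNat) h
  refine ⟨a, ha, fun b hb => ?_⟩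
  have h1 := hmin b hb
  have h2 := hC a ha
  have h3 := hC b hb
  omega

variable {U V : Type*} [DecidableEq U] [DecidableEq V]

namespace Profile

/-- The link of `u'` and `v` is replaced by one of `u` and `v`, for which `u` uses a free copy of
aspiration `t`. -/
def swap (s : Profile U V) (u u' : U) (v : V) (t xn yn : ℕ) : Profile U V where
  E := insert (u, v) (s.E.erase (u', v))
  x := Function.update s.x (u, v) xn
  y := Function.update s.y (u, v) yn
  F := Function.update (Function.update s.F u' (s.x (u', v) ::ₘ s.F u')) u ((s.F u).erase t)
  G := s.G

theorem release_join_eq_swap {s : Profile U V} {u u' : U} {v : V} {t c xn yn : ℕ} (hu : u ≠ u')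
    (hG : s.G v = 0) (hc : s.y (u', v) = c) :
    (s.release (u', v)).join (u, v) t c xn yn = s.swap u u' v t xn yn := by
  ext1
  · rfl
  · rfl
  · rfl
  · simp [release, join, swap, Function.update_of_ne hu]
  · simp only [release, join, swap, Function.update_self, hG, hc, Function.update_idem]
    rw [Multiset.erase_cons_head, ← hG, Function.update_eq_self]

section SumsSwap
variable [Fintype U] [Fintype V]

theorem sumU_swap (φ : U → ℕ → ℕ) {s : Profile U V} {u u' : U} {v : V} {t : ℕ} (xn yn : ℕ)
    (hu : u ≠ u') (hG : s.G v = 0) (h : (u, v) ∉ s.E) (h' : (u', v) ∈ s.E) (ht : t ∈ s.F u) :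
    (s.swap u u' v t xn yn).sumU φ + φ u t = s.sumU φ + φ u xn := by
  rw [← release_join_eq_swap hu hG rfl, ← sumU_release φ h']
  refine sumU_join φ _ _ _ (fun h1 => h (Finset.mem_of_mem_erase h1)) ?_
  simpa [release, Function.update_of_ne hu] using ht

theorem sumV_swap (φ : V → ℕ → ℕ) {s : Profile U V} {u u' : U} {v : V} {c : ℕ} (t xn yn : ℕ)
    (hu : u ≠ u') (hG : s.G v = 0) (h : (u, v) ∉ s.E) (h' : (u', v) ∈ s.E)
    (hc : s.y (u', v) = c) :
    (s.swap u u' v t xn yn).sumV φ + φ v c = s.sumV φ + φ v yn := by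
  rw [← release_join_eq_swap hu hG hc, ← sumV_release φ h']
  refine sumV_join φ _ _ _ (fun h1 => h (Finset.mem_of_mem_erase h1)) ?_
  simp [release, hc]

end SumsSwap

theorem cU_eq {s : Profile U V} {u : U} {a : ℕ} (h : a ∈ s.F u) (h' : ∀ t ∈ s.F u, a ≤ t) :
    s.cU u = a :=
  le_antisymm (cU_le h) (h' _ (cU_mem fun h0 => by rw [h0] at h; simp at h))

theorem cV_eq {s : Profile U V} {v : V} {a : ℕ} (h : a ∈ s.G v) (h' : ∀ t ∈ s.G v, a ≤ t) :
    s.cV v = a :=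
  le_antisymm (cV_le h) (h' _ (cV_mem fun h0 => by rw [h0] at h; simp at h))

theorem lowerF_join {s : Profile U V} {u : U} {v : V} {t c xn yn : ℕ} :
    (s.lowerF u t).join (u, v) (t - 1) c xn yn = s.join (u, v) t c xn yn := by
  ext1 <;> simp [lowerF, join]

theorem lowerF_swap {s : Profile U V} {u u' : U} {v : V} {t xn yn : ℕ} (hu : u ≠ u') :
    (s.lowerF u t).swap u u' v (t - 1) xn yn = s.swap u u' v t xn yn := by
  ext1 <;> try rfl
  simp only [lowerF, swap, Function.update_self, Multiset.erase_cons_head,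
    Function.update_of_ne hu.symm]
  rw [Function.update_comm hu.symm, Function.update_idem, Function.update_comm hu]

theorem lowerF_cU {s : Profile U V} {u : U} (_h : s.F u ≠ 0) :
    (s.lowerF u (s.cU u)).cU u = s.cU u - 1 := by
  refine cU_eq (by simp [lowerF]) fun t ht => ?_
  simp only [lowerF, Function.update_self, Multiset.mem_cons] at ht
  rcases ht with rfl | ht
  · exact le_rfl
  · exact (Nat.sub_le _ _).trans (cU_le (Multiset.mem_of_mem_erase ht))

theorem lowerF_cV {s : Profile U V} {u : U} {h : ℕ} {v : V} : (s.lowerF u h).cV v = s.cV v := rfl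

end Profile

variable [Fintype U] [Fintype V]

/-- The outcome `s'` of a link of `u` and `v` that uses a free copy of `u`: it takes a free copy of
`v` of aspiration `c` if there is a free one, and displaces a partner of `v` otherwise. -/
def Market.Outcome (A : Market U V) (s : Profile U V) (u : U) (v : V) (t c xn yn : ℕ)
    (s' : Profile U V) : Prop :=
  (s.G v ≠ 0 ∧ s' = s.join (u, v) t c xn yn) ∨
    (s.G v = 0 ∧ ∃ u', u ≠ u' ∧ (u', v) ∈ s.E ∧ s.y (u', v) = c ∧ A.w u' v ≠ 0 ∧
      s' = s.swap u u' v t xn yn)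

variable {A : Market U V} {L : Set (Profile U V)} {s : Profile U V}

theorem Market.RelV.outcome {u : U} {v : V} {t c xn yn : ℕ} {s₂ : Profile U V}
    (h : A.RelV s v c s₂) (huv : (u, v) ∉ s.E) :
    A.Outcome s u v t c xn yn (s₂.join (u, v) t c xn yn) := by
  rcases h with ⟨h, rfl⟩ | ⟨h, u', hu', hc, hw, rfl⟩
  · exact Or.inl ⟨h, rfl⟩
  · have hne : u ≠ u' := by rintro rfl; exact huv hu'
    exact Or.inr ⟨h, u', hne, hu', hc, hw, release_join_eq_swap hne h hc⟩

theorem Market.Outcome.of_lowerF {u : U} {v : V} {t c xn yn : ℕ} {s' : Profile U V}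
    (h : A.Outcome (s.lowerF u t) u v (t - 1) c xn yn s') : A.Outcome s u v t c xn yn s' := by
  rcases h with ⟨h, rfl⟩ | ⟨h, u', hne, hu', hc, hw, rfl⟩
  · exact Or.inl ⟨h, lowerF_join⟩
  · exact Or.inr ⟨h, u', hne, hu', hc, hw, lowerF_swap hne⟩

theorem Market.Outcome.sumU {u : U} {v : V} {t c xn yn : ℕ} {s' : Profile U V}
    (h : A.Outcome s u v t c xn yn s') (φ : U → ℕ → ℕ) (huv : (u, v) ∉ s.E) (ht : t ∈ s.F u) :
    s'.sumU φ + φ u t = s.sumU φ + φ u xn := by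
  rcases h with ⟨h, rfl⟩ | ⟨h, u', hne, hu', hc, hw, rfl⟩
  · exact sumU_join φ _ _ _ huv ht
  · exact sumU_swap φ _ _ hne h huv hu' ht

theorem Market.Outcome.sumV {u : U} {v : V} {t c xn yn : ℕ} {s' : Profile U V}
    (h : A.Outcome s u v t c xn yn s') (φ : V → ℕ → ℕ) (huv : (u, v) ∉ s.E)
    (ht : c = s.cV v) :
    s'.sumV φ + φ v c = s.sumV φ + φ v yn := by
  rcases h with ⟨h, rfl⟩ | ⟨h, u', hne, hu', hc, hw, rfl⟩
  · exact sumV_join φ _ _ _ huv (ht ▸ cV_mem h)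
  · exact sumV_swap φ _ _ _ hne h huv hu' hc

namespace Market.Stuck

theorem lower_free (hL : A.Stuck L) (hs : s ∈ L) {u : U} {v : V} (hu : s.F u ≠ 0)
    (huv : (u, v) ∉ s.E) (h0 : 0 < s.cU u) (hw : A.w u v ≤ s.cU u + s.cV v) :
    s.lowerF u (s.cU u) ∈ L :=
  hL.lowerU s hs u v huv hw _ (cU_mem hu) h0 fun _ ht _ => cU_le ht

/-- A node with a free copy can link to any node that considers less than the weight, in such a way
that the aspiration of the receiver does not change. -/
theorem take (hL : A.Stuck L) (hs : s ∈ L) {u : U} {v : V} (hu : s.F u ≠ 0)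
    (huv : (u, v) ∉ s.E) (hw : s.cV v < A.w u v) :
    ∃ s' ∈ L, A.Outcome s u v (s.cU u) (s.cV v) (A.w u v - s.cV v) (s.cV v) s' := by
  induction ht : s.cU u generalizing s with
  | zero =>
    obtain ⟨s₁, s₂, h1, h2, h3⟩ := hL.acceptU s hs u v huv (by omega)
    rcases h1 with ⟨-, rfl⟩ | ⟨h1, -⟩
    · rw [ht] at h3
      exact ⟨_, h3, h2.outcome huv⟩
    · exact absurd h1 hu
  | succ t ih =>
    by_cases hlt : s.cU u + s.cV v < A.w u v
    · obtain ⟨s₁, s₂, h1, h2, h3⟩ := hL.acceptU s hs u v huv hlt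
      rcases h1 with ⟨-, rfl⟩ | ⟨h1, -⟩
      · rw [ht] at h3
        exact ⟨_, h3, h2.outcome huv⟩
      · exact absurd h1 hu
    · have h1 := hL.lower_free hs hu huv (by omega) (by omega)
      obtain ⟨s', hs', ho⟩ := ih h1 (by simp [lowerF]) huv hw (by rw [lowerF_cU hu]; omega)
      refine ⟨s', hs', Market.Outcome.of_lowerF ?_⟩
      rw [ht] at ho
      exact ho

/-- A node with a free copy can link to any node that considers less than the weight, in such a way
that the aspiration of the receiver increases. -/
theorem give (hL : A.Stuck L) (hs : s ∈ L) {u : U} {v : V} (hu : s.F u ≠ 0)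
    (huv : (u, v) ∉ s.E) (hw : s.cV v < A.w u v) :
    ∃ s' ∈ L, A.Outcome s u v (s.cU u) (s.cV v) (min (s.cU u) (A.w u v - s.cV v - 1))
      (A.w u v - min (s.cU u) (A.w u v - s.cV v - 1)) s' := by
  induction ht : s.cU u generalizing s with
  | zero =>
    obtain ⟨s₁, s₂, h1, h2, h3⟩ := hL.acceptV s hs u v huv (by omega)
    rcases h1 with ⟨-, rfl⟩ | ⟨h1, -⟩
    · rw [ht] at h3
      rw [Nat.zero_min]
      exact ⟨_, h3, h2.outcome huv⟩
    · exact absurd h1 hu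
  | succ t ih =>
    by_cases hlt : s.cU u + s.cV v < A.w u v
    · obtain ⟨s₁, s₂, h1, h2, h3⟩ := hL.acceptV s hs u v huv hlt
      rcases h1 with ⟨-, rfl⟩ | ⟨h1, -⟩
      · rw [ht] at h3
        rw [min_eq_left (by omega)]
        exact ⟨_, h3, h2.outcome huv⟩
      · exact absurd h1 hu
    · have h1 := hL.lower_free hs hu huv (by omega) (by omega)
      obtain ⟨s', hs', ho⟩ := ih h1 (by simp [lowerF]) huv hw (by rw [lowerF_cU hu]; omega)
      refine ⟨s', hs', Market.Outcome.of_lowerF ?_⟩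
      rw [ht, lowerF_cV] at ho
      rw [min_eq_right (by omega)] at ho ⊢
      exact ho

/-- A proposal of `u` to `v` that succeeds changes the multiset of the aspirations in `U` in one
place only. -/
theorem acceptU_sum (hL : A.Stuck L) (hs : s ∈ L) {u : U} {v : V} (huv : (u, v) ∉ s.E)
    (hw : s.cU u + s.cV v < A.w u v) (φ : U → ℕ → ℕ) :
    ∃ s' ∈ L, s'.sumU φ + φ u (s.cU u) = s.sumU φ + φ u (A.w u v - s.cV v) := by
  obtain ⟨s₁, s₂, h1, h2, h3⟩ := hL.acceptU s hs u v huv hw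
  have a1 : (u, v) ∉ s₁.E ∧ s.cU u ∈ s₁.F u ∧ s₁.sumU φ = s.sumU φ := by
    rcases h1 with ⟨h, rfl⟩ | ⟨h, v', hv', hx, -, rfl⟩
    · exact ⟨huv, cU_mem h, rfl⟩
    · refine ⟨fun h => huv (Finset.mem_of_mem_erase h), ?_, sumU_release φ hv'⟩
      simp [release, hx]
  have a2 : (u, v) ∉ s₂.E ∧ s.cU u ∈ s₂.F u ∧ s₂.sumU φ = s.sumU φ := by
    rcases h2 with ⟨h, rfl⟩ | ⟨h, u', hu', hx, -, rfl⟩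
    · exact a1
    · have hne : u ≠ u' := by rintro rfl; exact a1.1 hu'
      refine ⟨fun h => a1.1 (Finset.mem_of_mem_erase h), ?_, (sumU_release φ hu').trans a1.2.2⟩
      simpa [release, Function.update_of_ne hne] using a1.2.1
  refine ⟨_, h3, ?_⟩
  rw [← a2.2.2]
  exact sumU_join φ _ _ _ a2.1 a2.2.1

end Market.Stuck

/-! ### Balanced profiles -/

/-- The unlinked nodes with which `u` gains under the bounds `q` and `p`. -/
def Market.bad (A : Market U V) (E : Finset (U × V)) (q : U → ℕ) (p : V → ℕ) (u : U) : Finset V :=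
  Finset.univ.filter fun v => (u, v) ∉ E ∧ q u + p v < A.w u v

theorem Market.mem_bad {E : Finset (U × V)} {q : U → ℕ} {p : V → ℕ} {u : U} {v : V} :
    v ∈ A.bad E q p u ↔ (u, v) ∉ E ∧ q u + p v < A.w u v := by
  simp [Market.bad]

/-- The lower bounds `q` hold for all aspirations in `U`, the free copies in `V` have aspiration
zero, and each `u` has enough free copies for all the partners that it would gain with at the
aspiration `q u`. -/
structure Market.Balanced (A : Market U V) (s : Profile U V) (q : U → ℕ) : Prop where
  zero : ∀ v, ∀ t ∈ s.G v, t = 0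
  le_x : ∀ u v, (u, v) ∈ s.E → q u ≤ s.x (u, v)
  le_F : ∀ u, ∀ t ∈ s.F u, q u ≤ t
  bad_le : ∀ u, (A.bad s.E q s.cV u).card ≤ (s.F u).card

theorem Market.Outcome.mem_E {u : U} {v : V} {t c xn yn : ℕ} {s' : Profile U V}
    (h : A.Outcome s u v t c xn yn s') {u₁ : U} {v₁ : V} (hv : v₁ ≠ v ∨ u₁ = u ∧ (u₁, v₁) ∈ s.E) :
    (u₁, v₁) ∈ s'.E ↔ (u₁, v₁) ∈ s.E := by
  rcases h with ⟨h, rfl⟩ | ⟨h, u', hne, hu', hc, hw, rfl⟩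
  · rcases hv with hv | ⟨rfl, hv⟩
    · simp [join, hv]
    · simp only [join, Finset.mem_insert, hv, or_true]
  · rcases hv with hv | hv
    · simp [swap, hv]
    · have : ¬ (u₁ = u' ∧ v₁ = v) := fun h => hne (hv.1.symm.trans h.1)
      simp [swap, hv.2, this]

theorem Market.Outcome.mem_E_self {u : U} {v : V} {t c xn yn : ℕ} {s' : Profile U V}
    (h : A.Outcome s u v t c xn yn s') : (u, v) ∈ s'.E := by
  rcases h with ⟨h, rfl⟩ | ⟨h, u', hne, hu', hc, hw, rfl⟩ <;> simp [join, swap]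

theorem Market.Outcome.x_eq {u : U} {v : V} {t c xn yn : ℕ} {s' : Profile U V}
    (h : A.Outcome s u v t c xn yn s') : s'.x = Function.update s.x (u, v) xn := by
  rcases h with ⟨h, rfl⟩ | ⟨h, u', hne, hu', hc, hw, rfl⟩ <;> rfl

theorem Market.Outcome.y_eq {u : U} {v : V} {t c xn yn : ℕ} {s' : Profile U V}
    (h : A.Outcome s u v t c xn yn s') : s'.y = Function.update s.y (u, v) yn := by
  rcases h with ⟨h, rfl⟩ | ⟨h, u', hne, hu', hc, hw, rfl⟩ <;> rfl

theorem Market.Outcome.F_self {u : U} {v : V} {t c xn yn : ℕ} {s' : Profile U V}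
    (h : A.Outcome s u v t c xn yn s') : s'.F u = (s.F u).erase t := by
  rcases h with ⟨h, rfl⟩ | ⟨h, u', hne, hu', hc, hw, rfl⟩ <;> simp [join, swap]

/-- The column of another node is not affected. -/
theorem Market.Outcome.cV_of_ne {u : U} {v : V} {t c xn yn : ℕ} {s' : Profile U V}
    (h : A.Outcome s u v t c xn yn s') {v₁ : V} (hv : v₁ ≠ v) : s'.cV v₁ = s.cV v₁ := by
  refine cV_congr ?_ (fun u₁ => h.mem_E (Or.inl hv)) fun u₁ _ => ?_
  · rcases h with ⟨h, rfl⟩ | ⟨h, u', hne, hu', hc, hw, rfl⟩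
    · simp [join, hv]
    · rfl
  · rw [h.y_eq, Function.update_of_ne (by simp [hv])]

/-- If the node with the least aspiration in its row has more partners to gain with than free
copies, then its free copies can be used up until a copy of that least aspiration is raised. -/
theorem Market.Stuck.raise_min (hL : A.Stuck L) {φ : ℕ → ℕ} (hφ : Antitone φ) {u : U} {m : ℕ}
    (n : ℕ) (hs : s ∈ L) (hn : (s.F u).card = n) (hF : ∀ t ∈ s.F u, m ≤ t)
    (hx : ∀ v, (u, v) ∈ s.E → m ≤ s.x (u, v))
    (hm : m ∈ s.F u ∨ ∃ v, (u, v) ∈ s.E ∧ s.x (u, v) = m)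
    (hbad : n < (A.bad s.E (fun _ => m) s.cV u).card) :
    ∃ s' ∈ L, s'.sumU (fun _ => φ) + φ m ≤ s.sumU (fun _ => φ) + (n + 1) * φ (m + 1) := by
  induction n generalizing s with
  | zero =>
    obtain ⟨v, hv⟩ := Finset.card_pos.1 hbad
    obtain ⟨hv, hw⟩ := mem_bad.1 hv
    have hF0 : s.F u = 0 := Multiset.card_eq_zero.1 hn
    have hcm : s.cU u = m := by
      refine le_antisymm ?_ ((hL.valid s hs).le_cU hF fun _ => hx)
      rcases hm with hm | ⟨v', hv', rfl⟩
      · exact cU_le hm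
      · exact cU_le_link hF0 hv'
    obtain ⟨s', hs', h⟩ := hL.acceptU_sum hs hv (by omega) (fun _ => φ)
    refine ⟨s', hs', ?_⟩
    rw [hcm] at h
    have := hφ (show m + 1 ≤ A.w u v - s.cV v by omega)
    omega
  | succ n ih =>
    have hF0 : s.F u ≠ 0 := by intro h; rw [h] at hn; simp at hn
    by_cases hcm : s.cU u = m
    · obtain ⟨v, hv⟩ := Finset.card_pos.1 (lt_trans (Nat.succ_pos n) hbad)
      obtain ⟨hv, hw⟩ := mem_bad.1 hv
      obtain ⟨s', hs', h⟩ := hL.acceptU_sum hs hv (by omega) (fun _ => φ)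
      refine ⟨s', hs', ?_⟩
      rw [hcm] at h
      have := hφ (show m + 1 ≤ A.w u v - s.cV v by omega)
      nlinarith
    · obtain ⟨v, hv⟩ := Finset.card_pos.1 (lt_trans (Nat.succ_pos n) hbad)
      have hvb := hv
      obtain ⟨hv, hw⟩ := mem_bad.1 hv
      have hm' : ∃ v, (u, v) ∈ s.E ∧ s.x (u, v) = m := by
        rcases hm with hm | hm
        · exact absurd (cU_eq hm hF) hcm
        · exact hm
      obtain ⟨s', hs', ho⟩ := hL.take hs hF0 hv (by omega)
      have hsum := ho.sumU (fun _ => φ) hv (cU_mem hF0)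
      obtain ⟨v', hv', hxm⟩ := hm'
      have hne : v' ≠ v := by rintro rfl; exact hv hv'
      have hF' := ho.F_self
      have key := ih hs' ?_ ?_ ?_ ?_ ?_
      · obtain ⟨s'', hs'', h⟩ := key
        refine ⟨s'', hs'', ?_⟩
        have := hφ (show m + 1 ≤ A.w u v - s.cV v by omega)
        nlinarith
      · rw [hF', Multiset.card_erase_of_mem (cU_mem hF0), hn, Nat.pred_succ]
      · intro t ht
        rw [hF'] at ht
        exact hF t (Multiset.mem_of_mem_erase ht)
      · intro v₁ h₁
        rw [ho.x_eq]
        by_cases hv₁ : v₁ = v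
        · subst hv₁
          rw [Function.update_self]
          omega
        · rw [Function.update_of_ne (by simp [hv₁])]
          exact hx v₁ ((ho.mem_E (Or.inl hv₁)).1 h₁)
      · right
        refine ⟨v', (ho.mem_E (Or.inl hne)).2 hv', ?_⟩
        rw [ho.x_eq, Function.update_of_ne (by simp [hne]), hxm]
      · have hsub : (A.bad s.E (fun _ => m) s.cV u).erase v ⊆
            A.bad s'.E (fun _ => m) s'.cV u := by
          intro v₁ h₁
          obtain ⟨h₁, h₂⟩ := Finset.mem_erase.1 h₁
          rw [mem_bad] at h₂ ⊢
          rw [ho.mem_E (Or.inl h₁), ho.cV_of_ne h₁]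
          exact h₂
        have := Finset.card_le_card hsub
        rw [Finset.card_erase_of_mem hvb] at this
        omega

theorem Profile.lowerG_mem_of_pos {v : V} (h : ¬ ∀ t ∈ s.G v, t = 0) :
    ∃ h ∈ s.G v, 0 < h ∧ ∀ t ∈ s.G v, 0 < t → h ≤ t := by
  push Not at h
  obtain ⟨t, ht, h0⟩ := h
  obtain ⟨a, ha, hmin⟩ := exists_min_of_exists (fun t => t ∈ s.G v ∧ 0 < t) id
    ⟨t, ht, Nat.pos_of_ne_zero h0⟩
  exact ⟨a, ha.1, ha.2, fun t h1 h2 => hmin t ⟨h1, h2⟩⟩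

/-- Each copy in `U` of aspiration `a` is charged `M ^ (K - a)`, where `M` exceeds the number of
these copies and `K` bounds the weights. In a profile of `L` with the least total charge, and then
the least sum of aspirations in `V`, the least aspirations `q u` of the nodes are suitable bounds:
raising a copy from `q u` outweighs whatever happens to the copies above `q u`. -/
theorem Market.Stuck.exists_balanced (hL : A.Stuck L) (hne : L.Nonempty) :
    ∃ s ∈ L, ∃ q, A.Balanced s q := by
  obtain ⟨K, hK⟩ : ∃ K, ∀ u v, A.w u v ≤ K :=
    ⟨∑ u, ∑ v, A.w u v, fun u v =>
      (Finset.single_le_sum (f := A.w u) (fun _ _ => Nat.zero_le _) (Finset.mem_univ v)).trans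
        (Finset.single_le_sum (f := fun u => ∑ v, A.w u v) (fun _ _ => Nat.zero_le _)
          (Finset.mem_univ u))⟩
  set M := ∑ u, A.bU u + 2 with hM
  set φ : ℕ → ℕ := fun a => M ^ (K - a) with hφdef
  have hφ : Antitone φ := fun a b hab => Nat.pow_le_pow_right (by omega) (by omega)
  have hφ' : ∀ m < K, ∀ u, ∀ n ≤ A.bU u, (n + 1) * φ (m + 1) < φ m := by
    intro m hm u n hn
    have h1 : φ m = M * φ (m + 1) := by
      simp only [hφdef]
      rw [← pow_succ']
      congr 1
      omega
    have h2 : 0 < φ (m + 1) := Nat.pos_of_ne_zero (pow_ne_zero _ (by omega))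
    have h3 := Finset.single_le_sum (f := A.bU) (fun _ _ => Nat.zero_le _) (Finset.mem_univ u)
    rw [h1]
    exact Nat.mul_lt_mul_of_pos_right (by omega) h2
  obtain ⟨s₀, hs₀, hmin₀⟩ := exists_min_of_exists (· ∈ L) (fun s => s.sumU fun _ => φ) hne
  obtain ⟨s, ⟨hs, hmin⟩, hminV⟩ := exists_min_of_exists
    (fun s => s ∈ L ∧ ∀ s' ∈ L, s.sumU (fun _ => φ) ≤ s'.sumU fun _ => φ)
    (fun s => s.sumV fun _ t => t) ⟨s₀, hs₀, hmin₀⟩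
  have hval := hL.valid s hs
  have hzero : ∀ v, ∀ t ∈ s.G v, t = 0 := by
    intro v
    by_contra hv
    obtain ⟨h, hh, hpos, hhmin⟩ := lowerG_mem_of_pos hv
    obtain ⟨u, hu⟩ := hval.exists_unlinked' (v := v) (by intro h0; rw [h0] at hh; simp at hh)
    by_cases hlt : s.cU u + s.cV v < A.w u v
    · obtain ⟨s', hs', h1⟩ := hL.acceptU_sum hs hu hlt (fun _ => φ)
      have h2 := hφ (show s.cU u + 1 ≤ A.w u v - s.cV v by omega)
      have h3 := hφ' (s.cU u) (by have := hK u v; omega) u 0 (Nat.zero_le _)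
      have := hmin s' hs'
      omega
    · have h1 := hL.lowerV s hs u v hu (by omega) h hh hpos hhmin
      have h2 := hminV (s.lowerG v h) ⟨h1, hmin⟩
      have h3 := sumV_lowerG (fun _ t => t) hh
      omega
  have hmins : ∀ u, ∃ m, (∀ t ∈ s.F u, m ≤ t) ∧ (∀ v, (u, v) ∈ s.E → m ≤ s.x (u, v)) ∧
      (m ∈ s.F u ∨ ∃ v, (u, v) ∈ s.E ∧ s.x (u, v) = m) := by
    intro u
    have key := exists_min_of_exists
      (fun m => m ∈ s.F u ∨ ∃ v, (u, v) ∈ s.E ∧ s.x (u, v) = m) id ?_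
    · obtain ⟨m, hm, hmin⟩ := key
      exact ⟨m, fun t ht => hmin t (Or.inl ht), fun v hv => hmin _ (Or.inr ⟨v, hv, rfl⟩), hm⟩
    · by_cases h : s.F u = 0
      · obtain ⟨v, hv, -⟩ := hval.exists_link_of_full h
        exact ⟨_, Or.inr ⟨v, hv, rfl⟩⟩
      · exact ⟨_, Or.inl (cU_mem h)⟩
  choose q hqF hqx hq using hmins
  refine ⟨s, hs, q, hzero, fun u v => hqx u v, hqF, fun u => ?_⟩
  by_contra! hlt
  have hbad : A.bad s.E q s.cV u = A.bad s.E (fun _ => q u) s.cV u := rfl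
  obtain ⟨v, hv⟩ := Finset.card_pos.1 (lt_of_le_of_lt (Nat.zero_le _) hlt)
  have hv := (mem_bad.1 hv).2
  rw [hbad] at hlt
  obtain ⟨s', hs', h1⟩ := hL.raise_min hφ _ hs rfl (hqF u) (hqx u) (hq u) hlt
  have h2 := hφ' (q u) (by have := hK u v; omega) u (s.F u).card (by
    have := hval.cardF u; omega)
  have := hmin s' hs'
  omega

end ProposalGame

namespace ProposalGame
open Profile

variable {U V : Type*} [DecidableEq U] [DecidableEq V] [Fintype U] [Fintype V]
variable {A : Market U V} {L : Set (Profile U V)} {s s' : Profile U V}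

/-! ### Counting the free copies -/

theorem sum_le_of_shift {g g' : U → ℕ} {u u' : U} (h1 : g' u + 1 ≤ g u)
    (h2 : g' u' ≤ g u' + 1) (h3 : ∀ a, a ≠ u → a ≠ u' → g' a ≤ g a) :
    ∑ a, g' a ≤ ∑ a, g a := by
  have key : ∀ a, g' a + (if a = u then 1 else 0) ≤ g a + if a = u' then 1 else 0 := by
    intro a
    by_cases ha : a = u
    · subst ha
      rw [if_pos rfl]
      split_ifs <;> omega
    · by_cases ha' : a = u'
      · subst ha'
        simpa [ha] using h2
      · simpa [ha, ha'] using h3 a ha ha'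
  have := Finset.sum_le_sum fun a (_ : a ∈ Finset.univ) => key a
  rw [Finset.sum_add_distrib, Finset.sum_add_distrib] at this
  simpa using this

/-- The number of free copies of the nodes with a positive bound `q u`. For a node with bound zero
the number of its partners to gain with is counted instead. -/
def Market.tau (A : Market U V) (s : Profile U V) (q : U → ℕ) (p : V → ℕ) : ℕ :=
  ∑ u, if q u = 0 then (A.bad s.E q p u).card else (s.F u).card

/-- Twice the sum of the aspirations in `V`, minus the sum of the aspirations in `U`. By the
factor two, a gain of one unit in `V` outweighs the loss of one unit by raising a copy in `U` to its
bound. -/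
def Profile.objective (s : Profile U V) : ℤ :=
  2 * (s.sumV fun _ t => t : ℕ) - (s.sumU fun _ t => t : ℕ)

namespace Market

theorem bad_mono {E : Finset (U × V)} {q : U → ℕ} {p p' : V → ℕ} (h : ∀ v, p v ≤ p' v) (u : U) :
    A.bad E q p' u ⊆ A.bad E q p u := by
  intro v hv
  rw [mem_bad] at hv ⊢
  have := h v
  exact ⟨hv.1, by omega⟩

theorem tau_mono {q : U → ℕ} {p p' : V → ℕ} (h : ∀ v, p v ≤ p' v) :
    A.tau s q p' ≤ A.tau s q p := by
  refine Finset.sum_le_sum fun u _ => ?_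
  split_ifs
  · exact Finset.card_le_card (bad_mono h u)
  · exact le_rfl

namespace Outcome

variable {u : U} {v : V} {t c xn yn : ℕ}

theorem link (h : A.Outcome s u v t c xn yn s') {u₁ : U} {v₁ : V} (h₁ : (u₁, v₁) ∈ s'.E) :
    (u₁ = u ∧ v₁ = v ∧ s'.x (u₁, v₁) = xn ∧ s'.y (u₁, v₁) = yn) ∨
      ((u₁, v₁) ∈ s.E ∧ ((u₁, v₁) ≠ (u, v)) ∧ s'.x (u₁, v₁) = s.x (u₁, v₁) ∧
        s'.y (u₁, v₁) = s.y (u₁, v₁)) := by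
  rw [h.x_eq, h.y_eq]
  by_cases he : (u₁, v₁) = (u, v)
  · obtain ⟨rfl, rfl⟩ := Prod.mk.inj he
    exact Or.inl ⟨rfl, rfl, by simp, by simp⟩
  · refine Or.inr ⟨?_, he, by rw [Function.update_of_ne he], by rw [Function.update_of_ne he]⟩
    rcases h with ⟨h, rfl⟩ | ⟨h, u', hne, hu', hc, hw, rfl⟩
    · exact (Finset.mem_insert.1 h₁).resolve_left he
    · exact Finset.mem_of_mem_erase ((Finset.mem_insert.1 h₁).resolve_left he)

theorem free (h : A.Outcome s u v t c xn yn s') {u₁ : U} {b : ℕ} (hb : b ∈ s'.F u₁) :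
    b ∈ s.F u₁ ∨ ((u₁, v) ∈ s.E ∧ b = s.x (u₁, v)) := by
  by_cases hu : u₁ = u
  · subst hu
    rw [h.F_self] at hb
    exact Or.inl (Multiset.mem_of_mem_erase hb)
  · rcases h with ⟨h, rfl⟩ | ⟨h, u', hne, hu', hc, hw, rfl⟩
    · left
      simpa [join, hu] using hb
    · by_cases hu2 : u₁ = u'
      · subst hu2
        simp only [swap, Function.update_of_ne hu, Function.update_self, Multiset.mem_cons] at hb
        rcases hb with rfl | hb
        · exact Or.inr ⟨hu', rfl⟩
        · exact Or.inl hb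
      · left
        simpa [swap, hu, hu2] using hb

theorem G_le (h : A.Outcome s u v t c xn yn s') (v₁ : V) : s'.G v₁ ≤ s.G v₁ := by
  rcases h with ⟨h, rfl⟩ | ⟨h, u', hne, hu', hc, hw, rfl⟩
  · by_cases hv : v₁ = v
    · subst hv
      simp [join, Multiset.erase_le]
    · simp [join, hv]
  · exact le_rfl

theorem bad_self (h : A.Outcome s u v t c xn yn s') (q : U → ℕ) (p : V → ℕ) :
    A.bad s'.E q p u = (A.bad s.E q p u).erase v := by
  ext v₁
  rw [Finset.mem_erase, mem_bad, mem_bad]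
  by_cases hv : v₁ = v
  · subst hv
    simp [h.mem_E_self]
  · rw [h.mem_E (Or.inl hv)]
    simp [hv]

theorem bad_of_eq {E E' : Finset (U × V)} {u₁ : U} (h : ∀ v₁, (u₁, v₁) ∈ E' ↔ (u₁, v₁) ∈ E)
    (q : U → ℕ) (p : V → ℕ) : A.bad E' q p u₁ = A.bad E q p u₁ := by
  ext v₁
  rw [mem_bad, mem_bad, h]

/-- A displaced node gains a free copy and at most one partner to gain with. -/
theorem cases_of_ne (h : A.Outcome s u v t c xn yn s') {u₁ : U} (hu : u₁ ≠ u) (q : U → ℕ)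
    (p : V → ℕ) :
    (A.bad s'.E q p u₁ = A.bad s.E q p u₁ ∧ s'.F u₁ = s.F u₁) ∨
      (A.bad s'.E q p u₁ ⊆ insert v (A.bad s.E q p u₁) ∧ s'.F u₁ = s.x (u₁, v) ::ₘ s.F u₁) := by
  rcases h with ⟨h, rfl⟩ | ⟨h, u', hne, hu', hc, hw, rfl⟩
  · refine Or.inl ⟨bad_of_eq (fun v₁ => ?_) q p, ?_⟩
    · simp [join, hu]
    · simp [join, hu]
  · by_cases hu2 : u₁ = u'
    · subst hu2
      refine Or.inr ⟨fun v₁ hv₁ => ?_, ?_⟩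
      · rw [Finset.mem_insert, mem_bad]
        rw [mem_bad] at hv₁
        by_cases hv : v₁ = v
        · exact Or.inl hv
        · refine Or.inr ⟨fun h1 => hv₁.1 ?_, hv₁.2⟩
          simp [swap, hv, h1]
      · simp [swap, hu]
    · refine Or.inl ⟨bad_of_eq (fun v₁ => ?_) q p, ?_⟩
      · simp [swap, hu, hu2]
      · simp [swap, hu, hu2]

theorem bad_card_le (h : A.Outcome s u v t c xn yn s') {u₁ : U} (hu : u₁ ≠ u) {q : U → ℕ}
    {p : V → ℕ} (hb : (A.bad s.E q p u₁).card ≤ (s.F u₁).card) :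
    (A.bad s'.E q p u₁).card ≤ (s'.F u₁).card := by
  rcases h.cases_of_ne hu q p with ⟨h1, h2⟩ | ⟨h1, h2⟩
  · rw [h1, h2]
    exact hb
  · rw [h2, Multiset.card_cons]
    have := Finset.card_le_card h1
    have := Finset.card_insert_le v (A.bad s.E q p u₁)
    omega

theorem tau_le (h : A.Outcome s u v t c xn yn s') {q : U → ℕ} {p : V → ℕ} (ht : t ∈ s.F u)
    (hq : q u = 0 → v ∈ A.bad s.E q p u) : A.tau s' q p ≤ A.tau s q p := by
  have hu1 : (if q u = 0 then (A.bad s'.E q p u).card else (s'.F u).card) + 1 ≤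
      if q u = 0 then (A.bad s.E q p u).card else (s.F u).card := by
    split_ifs with h0
    · rw [h.bad_self, Finset.card_erase_of_mem (hq h0)]
      have := Finset.card_pos.2 ⟨v, hq h0⟩
      omega
    · rw [h.F_self, Multiset.card_erase_of_mem ht]
      have := Multiset.card_pos_iff_exists_mem.2 ⟨t, ht⟩
      rw [Nat.pred_eq_sub_one]
      omega
  have hne1 : ∀ u₁, u₁ ≠ u → (if q u₁ = 0 then (A.bad s'.E q p u₁).card else (s'.F u₁).card) ≤
      (if q u₁ = 0 then (A.bad s.E q p u₁).card else (s.F u₁).card) + 1 := by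
    intro u₁ h1
    rcases h.cases_of_ne h1 q p with ⟨h2, h3⟩ | ⟨h2, h3⟩
    · rw [h2, h3]
      omega
    · rw [h3, Multiset.card_cons]
      have := Finset.card_le_card h2
      have := Finset.card_insert_le v (A.bad s.E q p u₁)
      split_ifs <;> omega
  have hcopy := h
  rcases h with ⟨h, rfl⟩ | ⟨h, u', hne, hu', hc, hw, rfl⟩
  · refine sum_le_of_shift hu1 (u' := u) (by omega) fun u₁ h1 _ => ?_
    have h2 : (s.join (u, v) t c xn yn).F u₁ = s.F u₁ := by simp [join, h1]
    rw [h2, bad_of_eq (E := s.E) (fun v₁ => by simp [join, h1])]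
  · refine sum_le_of_shift hu1 (hne1 u' hne.symm) fun u₁ h1 h3 => ?_
    have h2 : (s.swap u u' v t xn yn).F u₁ = s.F u₁ := by simp [swap, h1, h3]
    rw [h2, bad_of_eq (E := s.E) (fun v₁ => by simp [swap, h1, h3])]

/-- If the receiver has a free copy, then the number of free copies decreases. -/
theorem tau_lt (h : A.Outcome s u v t c xn yn s') {q : U → ℕ} {p : V → ℕ} (ht : t ∈ s.F u)
    (hq : q u ≠ 0) (hG : s.G v ≠ 0) : A.tau s' q p < A.tau s q p := by
  rcases h with ⟨h, rfl⟩ | ⟨h, -⟩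
  swap
  · exact absurd h hG
  · refine Finset.sum_lt_sum (fun u₁ _ => ?_) ⟨u, Finset.mem_univ u, ?_⟩
    · by_cases h1 : u₁ = u
      · subst h1
        rw [if_neg hq, if_neg hq]
        simp [join, Multiset.card_erase_of_mem ht]
      · have h2 : (s.join (u, v) t c xn yn).F u₁ = s.F u₁ := by simp [join, h1]
        rw [h2, bad_of_eq (E := s.E) (fun v₁ => by simp [join, h1])]
    · rw [if_neg hq, if_neg hq]
      have := Multiset.card_pos_iff_exists_mem.2 ⟨t, ht⟩
      simp only [join, Function.update_self, Multiset.card_erase_of_mem ht]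
      rw [Nat.pred_eq_sub_one]
      omega

theorem le_cV (h : A.Outcome s u v t c xn yn s') (hs' : A.Valid s')
    (hz : s.G v ≠ 0 → s.cV v = 0) (hyn : s.cV v ≤ yn) (v₁ : V) : s.cV v₁ ≤ s'.cV v₁ := by
  by_cases hv : v₁ = v
  · subst hv
    refine hs'.le_cV (fun b hb => ?_) fun hG u₁ hu₁ => ?_
    · exact cV_le (Multiset.mem_of_le (h.G_le _) hb)
    · rcases h.link hu₁ with ⟨-, -, -, h1⟩ | ⟨h1, -, -, h2⟩
      · rwa [h1]
      · rw [h2]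
        by_cases h0 : s.G v₁ = 0
        · exact cV_le_link h0 h1
        · rw [hz h0]
          exact Nat.zero_le _
  · exact (h.cV_of_ne hv).ge

end Outcome

/-! ### Optimal balanced profiles -/

/-- The balanced profile `s` has the least number of free copies, and the largest objective under
this condition. -/
structure Optimal (A : Market U V) (L : Set (Profile U V)) (s : Profile U V) (q : U → ℕ) :
    Prop where
  mem : s ∈ L
  balanced : A.Balanced s q
  tau_le : ∀ s' ∈ L, ∀ q', A.Balanced s' q' → A.tau s q s.cV ≤ A.tau s' q' s'.cV
  le_objective : ∀ s' ∈ L, ∀ q', A.Balanced s' q' → A.tau s' q' s'.cV ≤ A.tau s q s.cV →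
    s'.objective ≤ s.objective

/-- When the free copies in `V` have aspiration zero, the objective is bounded by the weights. -/
theorem Valid.objective_le (hs : A.Valid s) (hz : ∀ v, ∀ t ∈ s.G v, t = 0) :
    s.objective ≤ 2 * (∑ e : U × V, A.w e.1 e.2 : ℕ) := by
  have h1 : s.sumV (fun _ t => t) ≤ ∑ e : U × V, A.w e.1 e.2 := by
    unfold sumV
    have h2 : ∑ v, ((s.G v).map fun t => t).sum = 0 := by
      refine Finset.sum_eq_zero fun v _ => ?_
      rw [Multiset.map_id']
      exact Multiset.sum_eq_zero (hz v)
    rw [h2, add_zero]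
    refine (Finset.sum_le_sum fun e he => ?_).trans
      (Finset.sum_le_sum_of_subset (Finset.subset_univ s.E))
    have : s.x e + s.y e = A.w e.1 e.2 := hs.sat e.1 e.2 he
    exact (Nat.le_add_left _ _).trans this.le
  unfold Profile.objective
  omega

theorem Stuck.exists_optimal (hL : A.Stuck L) (hne : L.Nonempty) :
    ∃ s q, A.Optimal L s q := by
  obtain ⟨s₀, hs₀, q₀, h₀⟩ := hL.exists_balanced hne
  obtain ⟨⟨s₁, q₁⟩, ⟨hs₁, hb₁⟩, hmin⟩ := exists_min_of_exists
    (fun z : Profile U V × (U → ℕ) => z.1 ∈ L ∧ A.Balanced z.1 z.2)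
    (fun z => A.tau z.1 z.2 z.1.cV) ⟨(s₀, q₀), hs₀, h₀⟩
  obtain ⟨⟨s, q⟩, ⟨hs, hb, hτ⟩, hmax⟩ := exists_max_of_bddAbove
    (fun z : Profile U V × (U → ℕ) => z.1 ∈ L ∧ A.Balanced z.1 z.2 ∧
      A.tau z.1 z.2 z.1.cV ≤ A.tau s₁ q₁ s₁.cV)
    (fun z => z.1.objective) (2 * (∑ e : U × V, A.w e.1 e.2 : ℕ)) ⟨(s₁, q₁), hs₁, hb₁, le_rfl⟩
    fun z hz => (hL.valid _ hz.1).objective_le hz.2.1.zero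
  refine ⟨s, q, hs, hb, fun s' hs' q' hb' => hτ.trans (hmin (s', q') ⟨hs', hb'⟩),
    fun s' hs' q' hb' hτ' => hmax (s', q') ⟨hs', hb', hτ'.trans hτ⟩⟩

theorem Outcome.objective_eq {u : U} {v : V} {t xn yn : ℕ}
    (h : A.Outcome s u v t (s.cV v) xn yn s') (huv : (u, v) ∉ s.E) (ht : t ∈ s.F u) :
    s'.objective = s.objective + 2 * ((yn : ℤ) - s.cV v) - ((xn : ℤ) - t) := by
  have h1 := h.sumU (fun _ t => t) huv ht
  have h2 := h.sumV (fun _ t => t) huv rfl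
  unfold Profile.objective
  omega

theorem objective_lowerF {u : U} {h : ℕ} (hh : h ∈ s.F u) (h0 : 0 < h) :
    (s.lowerF u h).objective = s.objective + 1 := by
  have h1 := sumU_lowerF (fun _ t => t) hh
  have h2 : (s.lowerF u h).sumV (fun _ t => t) = s.sumV (fun _ t => t) := rfl
  unfold Profile.objective
  omega

theorem card_lowerF {u : U} {h : ℕ} (hh : h ∈ s.F u) (u₁ : U) :
    ((s.lowerF u h).F u₁).card = (s.F u₁).card := by
  by_cases hu : u₁ = u
  · subst hu
    simp [lowerF, Multiset.card_erase_add_one hh]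
  · simp [lowerF, hu]

theorem mem_lowerF {u : U} {h : ℕ} {u₁ : U} {b : ℕ} (hb : b ∈ (s.lowerF u h).F u₁) :
    b ∈ s.F u₁ ∨ (u₁ = u ∧ b = h - 1) := by
  by_cases hu : u₁ = u
  · subst hu
    simp only [lowerF, Function.update_self, Multiset.mem_cons] at hb
    rcases hb with hb | hb
    · exact Or.inr ⟨rfl, hb⟩
    · exact Or.inl (Multiset.mem_of_mem_erase hb)
  · left
    simpa [lowerF, hu] using hb

theorem Balanced.cV_eq_zero {q : U → ℕ} (h : A.Balanced s q) {v : V} (hG : s.G v ≠ 0) :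
    s.cV v = 0 := h.zero v _ (cV_mem hG)

/-- No pair gains under the bounds of an optimal profile, since otherwise a link of the pair on which
`v` gains would increase the objective. -/
theorem Optimal.le_add (hL : A.Stuck L) {q : U → ℕ} (ho : A.Optimal L s q) {u : U} {v : V}
    (huv : (u, v) ∉ s.E) : A.w u v ≤ q u + s.cV v := by
  by_contra! hlt
  have hb := ho.balanced
  have hv : v ∈ A.bad s.E q s.cV u := mem_bad.2 ⟨huv, hlt⟩
  have hF : s.F u ≠ 0 := by
    intro h0
    have h1 := hb.bad_le u
    rw [h0, Multiset.card_zero] at h1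
    exact absurd (Finset.card_pos.2 ⟨v, hv⟩) (by omega)
  have hq := hb.le_F u _ (cU_mem hF)
  obtain ⟨s', hs', h⟩ := hL.give ho.mem hF huv (by omega)
  have hcV := h.le_cV (hL.valid s' hs') hb.cV_eq_zero (by omega)
  have hobj := h.objective_eq huv (cU_mem hF)
  have hb' : A.Balanced s' q := by
    refine ⟨fun v₁ t ht => hb.zero v₁ t (Multiset.mem_of_le (h.G_le v₁) ht), fun u₁ v₁ h₁ => ?_,
      fun u₁ t ht => ?_, fun u₁ => ?_⟩
    · rcases h.link h₁ with ⟨rfl, rfl, h2, -⟩ | ⟨h2, -, h3, -⟩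
      · omega
      · exact h3 ▸ hb.le_x _ _ h2
    · rcases h.free ht with h1 | ⟨h1, rfl⟩
      · exact hb.le_F _ _ h1
      · exact hb.le_x _ _ h1
    · refine (Finset.card_le_card (bad_mono hcV u₁)).trans ?_
      by_cases hu : u₁ = u
      · subst hu
        rw [h.bad_self, h.F_self, Finset.card_erase_of_mem hv,
          Multiset.card_erase_of_mem (cU_mem hF)]
        exact Nat.sub_le_sub_right (hb.bad_le u₁) 1
      · exact h.bad_card_le hu (hb.bad_le u₁)
  have hτ := (tau_mono hcV).trans (h.tau_le (cU_mem hF) (q := q) fun _ => hv)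
  have := ho.le_objective s' hs' q hb' hτ
  omega

theorem Optimal.bad_eq_empty (hL : A.Stuck L) {q : U → ℕ} (ho : A.Optimal L s q) (u : U) :
    A.bad s.E q s.cV u = ∅ := by
  refine Finset.eq_empty_of_forall_notMem fun v hv => ?_
  rw [mem_bad] at hv
  have := ho.le_add hL hv.1
  omega

/-- As an optimal profile is not in the core, some node with a positive bound has a free copy. -/
theorem Optimal.exists_free (hL : A.Stuck L) {q : U → ℕ} (ho : A.Optimal L s q) :
    ∃ u, q u ≠ 0 ∧ s.F u ≠ 0 := by
  by_contra! hno
  have hb := ho.balanced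
  have hval := hL.valid s ho.mem
  have hqc : ∀ u, q u ≤ s.cU u := fun u =>
    hval.le_cU (hb.le_F u) fun _ v hv => hb.le_x u v hv
  refine hL.notCore s ho.mem ⟨fun u v huv => ?_, fun u => ?_, hb.zero⟩
  · have := ho.le_add hL huv
    have := hqc u
    omega
  · by_contra! hu
    have hF : s.F u ≠ 0 := by
      obtain ⟨t, ht, -⟩ := hu
      intro h0
      simp [h0] at ht
    have hq : q u = 0 := by
      by_contra h
      exact hF (hno u h)
    obtain ⟨t, ht, ht0⟩ := hu
    obtain ⟨h, ⟨hh, hpos⟩, hmin⟩ := exists_min_of_exists (fun t => t ∈ s.F u ∧ 0 < t) id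
      ⟨t, ht, Nat.pos_of_ne_zero ht0⟩
    obtain ⟨v, hv⟩ := hval.exists_unlinked hF
    have h1 := hL.lowerU s ho.mem u v hv
      ((ho.le_add hL hv).trans (Nat.add_le_add_right (hqc u) _)) h hh hpos
      fun t h1 h2 => hmin t ⟨h1, h2⟩
    have h2 := objective_lowerF hh hpos
    have hτ : A.tau (s.lowerF u h) q (s.lowerF u h).cV = A.tau s q s.cV := by
      unfold tau
      simp only [card_lowerF hh]
      rfl
    have h3 := ho.le_objective _ h1 q ⟨hb.zero, hb.le_x, fun u₁ b hb₁ => ?_, fun u₁ => ?_⟩ hτ.le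
    · omega
    · rcases mem_lowerF hb₁ with h4 | ⟨rfl, h4⟩
      · exact hb.le_F _ _ h4
      · omega
    · rw [card_lowerF hh]
      exact hb.bad_le u₁

end Market

end ProposalGame

namespace ProposalGame
open Profile

variable {U V : Type*} [DecidableEq U] [DecidableEq V] [Fintype U] [Fintype V]
variable {A : Market U V} {L : Set (Profile U V)} {s s' : Profile U V}

/-! ### Restoring balance -/

/-- A weakening of balance for the bounds `q` and `p`, in which some copies of `U` may have an
aspiration one below the bound `q`. -/
structure Market.Frame (A : Market U V) (L : Set (Profile U V)) (s : Profile U V) (q : U → ℕ)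
    (p : V → ℕ) : Prop where
  mem : s ∈ L
  zero : ∀ v, ∀ t ∈ s.G v, t = 0
  p_le : ∀ u v, (u, v) ∈ s.E → p v ≤ s.y (u, v)
  p_zero : ∀ v, s.G v ≠ 0 → p v = 0
  le_w : ∀ u v, (u, v) ∈ s.E → q u + p v ≤ A.w u v
  bad_le : ∀ u, (A.bad s.E q p u).card ≤ (s.F u).card
  le_x : ∀ u v, (u, v) ∈ s.E → q u ≤ s.x (u, v) + 1
  le_F : ∀ u, ∀ t ∈ s.F u, q u ≤ t + 1
  full : ∀ u v, (u, v) ∈ s.E → s.x (u, v) < q u → s.G v = 0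

/-- The number of copies in `U` with an aspiration below the bound `q`. -/
def Profile.dirty (s : Profile U V) (q : U → ℕ) : ℕ :=
  s.sumU fun u a => if a < q u then 1 else 0

/-- Some copy of `u` has an aspiration below the bound `q`. -/
def Profile.IsDirty (s : Profile U V) (q : U → ℕ) (u : U) : Prop :=
  (∃ t ∈ s.F u, t < q u) ∨ ∃ v, (u, v) ∈ s.E ∧ s.x (u, v) < q u

/-- The partners that `u` would gain with at the aspiration `q u - 1`. -/
noncomputable def Market.viol (A : Market U V) (s : Profile U V) (q : U → ℕ) (u : U) : Finset V :=
  Finset.univ.filter fun v => (u, v) ∉ s.E ∧ q u + s.cV v ≤ A.w u v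

namespace Market

theorem mem_viol {q : U → ℕ} {u : U} {v : V} :
    v ∈ A.viol s q u ↔ (u, v) ∉ s.E ∧ q u + s.cV v ≤ A.w u v := by
  simp [viol]

theorem Balanced.frame (hL : A.Stuck L) (hs : s ∈ L) {q : U → ℕ} (h : A.Balanced s q) :
    A.Frame L s q s.cV := by
  have hy : ∀ u v, (u, v) ∈ s.E → s.cV v ≤ s.y (u, v) := by
    intro u v huv
    by_cases hG : s.G v = 0
    · exact cV_le_link hG huv
    · rw [h.cV_eq_zero hG]
      exact Nat.zero_le _
  refine ⟨hs, h.zero, hy, fun v => h.cV_eq_zero, fun u v huv => ?_, h.bad_le,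
    fun u v huv => (h.le_x u v huv).trans (Nat.le_succ _),
    fun u t ht => (h.le_F u t ht).trans (Nat.le_succ _), fun u v huv hlt => ?_⟩
  · rw [← (hL.valid s hs).sat u v huv]
    exact Nat.add_le_add (h.le_x u v huv) (hy u v huv)
  · exact absurd (h.le_x u v huv) (by omega)

variable {q : U → ℕ} {p : V → ℕ}

theorem Frame.p_le_cV (hL : A.Stuck L) (h : A.Frame L s q p) (v : V) : p v ≤ s.cV v := by
  refine (hL.valid s h.mem).le_cV (fun t ht => ?_) fun _ u hu => h.p_le u v hu
  rw [h.p_zero v (by intro h0; rw [h0] at ht; simp at ht)]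
  exact Nat.zero_le _

theorem Frame.cV_eq_zero (h : A.Frame L s q p) {v : V} (hG : s.G v ≠ 0) : s.cV v = 0 :=
  h.zero v _ (cV_mem hG)

theorem Frame.cV_le_y (h : A.Frame L s q p) {u : U} {v : V} (he : (u, v) ∈ s.E) :
    s.cV v ≤ s.y (u, v) := by
  by_cases hG : s.G v = 0
  · exact cV_le_link hG he
  · rw [h.cV_eq_zero hG]
    exact Nat.zero_le _

/-- If every node with an aspiration below its bound can satisfy the partners that it would gain
with, then the bound can be lowered. -/
theorem Frame.balanced (hL : A.Stuck L) (h : A.Frame L s q p)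
    (hd : ∀ u, s.IsDirty q u → (A.viol s q u).card ≤ (s.F u).card) :
    ∃ q', A.Balanced s q' ∧ A.tau s q' s.cV ≤ A.tau s q p := by
  classical
  have hpos : ∀ u, s.IsDirty q u → q u ≠ 0 := by
    rintro u (⟨t, -, ht⟩ | ⟨v, -, hv⟩) <;> omega
  set q' : U → ℕ := fun u => if s.IsDirty q u then q u - 1 else q u with hq'
  have hbad : ∀ u, s.IsDirty q u → A.bad s.E q' s.cV u = A.viol s q u := by
    intro u hu
    ext v
    have := hpos u hu
    rw [mem_bad, mem_viol]
    simp only [hq', if_pos hu]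
    exact and_congr_right fun _ => by omega
  have hbad' : ∀ u, ¬ s.IsDirty q u → A.bad s.E q' s.cV u ⊆ A.bad s.E q p u := by
    intro u hu v hv
    rw [mem_bad] at hv ⊢
    have := h.p_le_cV hL v
    simp only [hq', if_neg hu] at hv
    exact ⟨hv.1, by omega⟩
  refine ⟨q', ⟨h.zero, fun u v huv => ?_, fun u t ht => ?_, fun u => ?_⟩, ?_⟩
  · by_cases hu : s.IsDirty q u
    · have := h.le_x u v huv
      simp only [hq', if_pos hu]
      omega
    · simp only [hq', if_neg hu]
      by_contra! hlt
      exact hu (Or.inr ⟨v, huv, hlt⟩)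
  · by_cases hu : s.IsDirty q u
    · have := h.le_F u t ht
      simp only [hq', if_pos hu]
      omega
    · simp only [hq', if_neg hu]
      by_contra! hlt
      exact hu (Or.inl ⟨t, ht, hlt⟩)
  · by_cases hu : s.IsDirty q u
    · rw [hbad u hu]
      exact hd u hu
    · exact (Finset.card_le_card (hbad' u hu)).trans (h.bad_le u)
  · refine Finset.sum_le_sum fun u _ => ?_
    by_cases hu : s.IsDirty q u
    · rw [if_neg (hpos u hu), hbad u hu]
      split_ifs
      · exact hd u hu
      · exact le_rfl
    · have h1 : q' u = q u := by simp only [hq', if_neg hu]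
      rw [h1]
      split_ifs
      · exact Finset.card_le_card (hbad' u hu)
      · exact le_rfl

theorem Frame.raise_p (hL : A.Stuck L) (h : A.Frame L s q p) :
    A.Frame L s q fun v => max (p v) (s.cV v - 1) := by
  refine ⟨h.mem, h.zero, fun u v he => ?_, fun v hG => ?_, fun u v he => ?_, fun u => ?_, h.le_x,
    h.le_F, h.full⟩
  · have := h.cV_le_y he
    exact max_le (h.p_le u v he) (by omega)
  · simp [h.p_zero v hG, h.cV_eq_zero hG]
  · have h1 := h.le_w u v he
    have h2 := h.cV_le_y he
    have h3 := h.le_x u v he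
    have h4 := (hL.valid s h.mem).sat u v he
    show q u + max (p v) (s.cV v - 1) ≤ A.w u v
    rcases max_choice (p v) (s.cV v - 1) with h5 | h5 <;> rw [h5] <;> omega
  · exact (Finset.card_le_card (bad_mono (fun v => le_max_left _ _) u)).trans (h.bad_le u)

/-- The frame is preserved when `u` takes a partner at the bound `q u` or above. -/
theorem Frame.of_take (h : A.Frame L s q p) {s₁ : Profile U V} (hs₁ : s₁ ∈ L) {u : U} {v : V}
    (ho : A.Outcome s u v (s.cU u) (s.cV v) (A.w u v - s.cV v) (s.cV v) s₁) (hF : s.F u ≠ 0)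
    (huv : (u, v) ∉ s.E) (hq : q u ≠ 0) (hle : q u + s.cV v ≤ A.w u v) (hpc : p v ≤ s.cV v)
    (hvb : (A.bad s.E q p u).Nonempty → v ∈ A.bad s.E q p u) : A.Frame L s₁ q p := by
  refine ⟨hs₁, fun v₁ t ht => h.zero v₁ t (Multiset.mem_of_le (ho.G_le v₁) ht),
    fun u₁ v₁ he => ?_, fun v₁ hG => ?_, fun u₁ v₁ he => ?_, fun u₁ => ?_,
    fun u₁ v₁ he => ?_, fun u₁ t ht => ?_, fun u₁ v₁ he hlt => ?_⟩
  · rcases ho.link he with ⟨rfl, rfl, -, h2⟩ | ⟨h2, -, -, h3⟩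
    · rw [h2]
      exact hpc
    · rw [h3]
      exact h.p_le _ _ h2
  · refine h.p_zero v₁ fun h0 => hG ?_
    have := ho.G_le v₁
    rw [h0] at this
    exact Multiset.le_zero.1 this
  · rcases ho.link he with ⟨rfl, rfl, -, -⟩ | ⟨h2, -, -, -⟩
    · omega
    · exact h.le_w _ _ h2
  · by_cases hu : u₁ = u
    · subst hu
      rw [ho.bad_self, ho.F_self, Multiset.card_erase_of_mem (cU_mem hF)]
      rcases (A.bad s.E q p u₁).eq_empty_or_nonempty with h0 | h0
      · simp [h0]
      · rw [Finset.card_erase_of_mem (hvb h0)]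
        exact Nat.sub_le_sub_right (h.bad_le u₁) 1
    · exact ho.bad_card_le hu (h.bad_le u₁)
  · rcases ho.link he with ⟨rfl, rfl, h2, -⟩ | ⟨h2, -, h3, -⟩
    · omega
    · rw [h3]
      exact h.le_x _ _ h2
  · rcases ho.free ht with h1 | ⟨h1, rfl⟩
    · exact h.le_F _ _ h1
    · exact h.le_x _ _ h1
  · rcases ho.link he with ⟨rfl, rfl, h2, -⟩ | ⟨h2, -, h3, -⟩
    · omega
    · rw [h3] at hlt
      have := ho.G_le v₁
      rw [h.full _ _ h2 hlt] at this
      exact Multiset.le_zero.1 this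

/-- A node with an aspiration below its bound that cannot satisfy all partners uses up its free
copies, at the bound. -/
theorem Frame.use_free (hL : A.Stuck L) (n : ℕ) {u : U} (h : A.Frame L s q p)
    (hn : (s.F u).card = n) (hd : s.IsDirty q u) (hv : n < (A.viol s q u).card) :
    ∃ s' p', A.Frame L s' q p' ∧ A.tau s' q p' ≤ A.tau s q p ∧ (s'.dirty q < s.dirty q ∨
      (s'.dirty q ≤ s.dirty q ∧ s'.F u = 0 ∧ s'.IsDirty q u ∧ (A.viol s' q u).Nonempty)) := by
  induction n generalizing s p with
  | zero =>
    exact ⟨s, p, h, le_rfl, Or.inr ⟨le_rfl, Multiset.card_eq_zero.1 hn, hd, Finset.card_pos.1 hv⟩⟩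
  | succ n ih =>
    have hF : s.F u ≠ 0 := by intro h0; rw [h0] at hn; simp at hn
    have hq : q u ≠ 0 := by rcases hd with ⟨t, -, ht⟩ | ⟨v, -, hv⟩ <;> omega
    have hfr := h.raise_p hL
    set p' : V → ℕ := fun v => max (p v) (s.cV v - 1) with hp'
    have hp1 : ∀ v, s.cV v ≤ p' v + 1 := fun v => by
      have : s.cV v - 1 ≤ p' v := le_max_right _ _
      omega
    have hsub : A.bad s.E q p' u ⊆ A.viol s q u := by
      intro v hv
      rw [mem_bad] at hv
      rw [mem_viol]
      have := hp1 v
      exact ⟨hv.1, by omega⟩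
    obtain ⟨v, hvv, hvb⟩ : ∃ v ∈ A.viol s q u, (A.bad s.E q p' u).Nonempty →
        v ∈ A.bad s.E q p' u := by
      by_cases hne : (A.bad s.E q p' u).Nonempty
      · obtain ⟨v, hv⟩ := hne
        exact ⟨v, hsub hv, fun _ => hv⟩
      · obtain ⟨v, hv⟩ := Finset.card_pos.1 (lt_trans (Nat.succ_pos n) hv)
        exact ⟨v, hv, fun h => absurd h hne⟩
    obtain ⟨huv, hle⟩ := mem_viol.1 hvv
    have hpc := hfr.p_le_cV hL v
    obtain ⟨s₁, hs₁, ho⟩ := hL.take h.mem hF huv (by omega)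
    have hfr₁ : A.Frame L s₁ q p' := hfr.of_take hs₁ ho hF huv hq hle hpc hvb
    have hτ : A.tau s₁ q p' ≤ A.tau s q p :=
      (ho.tau_le (cU_mem hF) fun h0 => absurd h0 hq).trans (tau_mono fun v => le_max_left _ _)
    have hdirty := ho.sumU (fun u a => if a < q u then 1 else 0) huv (cU_mem hF)
    change s₁.dirty q + _ = s.dirty q + _ at hdirty
    rw [if_neg (show ¬ A.w u v - s.cV v < q u by omega)] at hdirty
    by_cases ht : s.cU u < q u
    · rw [if_pos ht] at hdirty
      exact ⟨s₁, p', hfr₁, hτ, Or.inl (by omega)⟩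
    · rw [if_neg ht] at hdirty
      have key := ih hfr₁ ?_ ?_ ?_
      · obtain ⟨s', p'', h1, h2, h3⟩ := key
        refine ⟨s', p'', h1, h2.trans hτ, ?_⟩
        rcases h3 with h3 | ⟨h3, h4⟩
        · exact Or.inl (by omega)
        · exact Or.inr ⟨by omega, h4⟩
      · rw [ho.F_self, Multiset.card_erase_of_mem (cU_mem hF), hn, Nat.pred_succ]
      · rcases hd with ⟨t, ht1, ht2⟩ | ⟨v', hv', hx⟩
        · refine Or.inl ⟨t, ?_, ht2⟩
          rw [ho.F_self]
          exact (Multiset.mem_erase_of_ne (by rintro rfl; exact ht ht2)).2 ht1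
        · have hne : v' ≠ v := by rintro rfl; exact huv hv'
          refine Or.inr ⟨v', (ho.mem_E (Or.inl hne)).2 hv', ?_⟩
          rwa [ho.x_eq, Function.update_of_ne (by simp [hne])]
      · have hsub2 : (A.viol s q u).erase v ⊆ A.viol s₁ q u := by
          intro v₁ h₁
          obtain ⟨h₁, h₂⟩ := Finset.mem_erase.1 h₁
          rw [mem_viol] at h₂ ⊢
          rwa [ho.mem_E (Or.inl h₁), ho.cV_of_ne h₁]
        have := Finset.card_le_card hsub2
        rw [Finset.card_erase_of_mem hvv] at this
        omega

end Market

end ProposalGame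

namespace ProposalGame
open Profile

variable {U V : Type*} [DecidableEq U] [DecidableEq V] [Fintype U] [Fintype V]
variable {A : Market U V} {L : Set (Profile U V)} {s σ ρ : Profile U V}

/-! ### Raising the aspirations of a node without free copies -/

namespace Profile

theorem cV_singleton {v : V} {a : ℕ} (h : s.G v = {a}) : s.cV v = a :=
  Multiset.mem_singleton.1 (h ▸ cV_mem (by rw [h]; exact Multiset.singleton_ne_zero a))

theorem release_comm {u u' : U} {v v' : V} (hu : u ≠ u') (hv : v ≠ v') :
    (s.release (u, v)).release (u', v') = (s.release (u', v')).release (u, v) := by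
  ext1
  · exact Finset.erase_right_comm
  · rfl
  · rfl
  · simp only [release, Function.update_of_ne hu.symm, Function.update_of_ne hu]
    exact Function.update_comm hu _ _ _
  · simp only [release, Function.update_of_ne hv.symm, Function.update_of_ne hv]
    exact Function.update_comm hv _ _ _

/-- The profile that arises from a proposal between `u` without free copies and `v` with a free
copy: the link of `u` with `v'` is replaced by one with `v`. -/
def reswap (s : Profile U V) (u : U) (v v' : V) (c xn yn : ℕ) : Profile U V where
  E := insert (u, v) (s.E.erase (u, v'))
  x := Function.update s.x (u, v) xn
  y := Function.update s.y (u, v) yn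
  F := s.F
  G := Function.update (Function.update s.G v' (s.y (u, v') ::ₘ s.G v')) v ((s.G v).erase c)

theorem release_join_eq_reswap {u : U} {v v' : V} {a c xn yn : ℕ} (hv : v ≠ v')
    (hF : s.F u = 0) (ha : s.x (u, v') = a) :
    (s.release (u, v')).join (u, v) a c xn yn = s.reswap u v v' c xn yn := by
  ext1
  · rfl
  · rfl
  · rfl
  · simp only [release, join, reswap, Function.update_self, hF, ha, Function.update_idem]
    rw [Multiset.erase_cons_head, ← hF, Function.update_eq_self]
  · simp [release, join, reswap, Function.update_of_ne hv]

theorem sumU_reswap (φ : U → ℕ → ℕ) {u : U} {v v' : V} {a : ℕ} (c xn yn : ℕ) (hv : v ≠ v')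
    (hF : s.F u = 0) (ha : s.x (u, v') = a) (h : (u, v) ∉ s.E) (h' : (u, v') ∈ s.E) :
    (s.reswap u v v' c xn yn).sumU φ + φ u a = s.sumU φ + φ u xn := by
  rw [← release_join_eq_reswap hv hF ha, ← sumU_release φ h']
  refine sumU_join φ _ _ _ (fun h1 => h (Finset.mem_of_mem_erase h1)) ?_
  simp [release, ha]

end Profile

namespace Market

theorem Stuck.acceptU_full (hL : A.Stuck L) (hs : s ∈ L) {u : U} {v : V} (hF : s.F u = 0)
    (hG : s.G v ≠ 0) (huv : (u, v) ∉ s.E) (hw : s.cU u + s.cV v < A.w u v) :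
    ∃ v', v ≠ v' ∧ (u, v') ∈ s.E ∧ s.x (u, v') = s.cU u ∧
      s.reswap u v v' (s.cV v) (A.w u v - s.cV v) (s.cV v) ∈ L := by
  obtain ⟨s₁, s₂, h1, h2, h3⟩ := hL.acceptU s hs u v huv hw
  rcases h1 with ⟨h1, -⟩ | ⟨-, v', hv', hx, -, rfl⟩
  · exact absurd hF h1
  · have hne : v ≠ v' := by rintro rfl; exact huv hv'
    rcases h2 with ⟨-, rfl⟩ | ⟨h2, -⟩
    · rw [release_join_eq_reswap hne hF hx] at h3
      exact ⟨v', hne, hv', hx, h3⟩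
    · simp only [release, Function.update_of_ne hne] at h2
      exact absurd h2 hG

theorem Stuck.acceptV_full (hL : A.Stuck L) (hs : s ∈ L) {u : U} {v : V} (hF : s.F u = 0)
    (hG : s.G v ≠ 0) (huv : (u, v) ∉ s.E) (hw : s.cU u + s.cV v < A.w u v) :
    ∃ v', v ≠ v' ∧ (u, v') ∈ s.E ∧ s.x (u, v') = s.cU u ∧
      s.reswap u v v' (s.cV v) (s.cU u) (A.w u v - s.cU u) ∈ L := by
  obtain ⟨s₁, s₂, h1, h2, h3⟩ := hL.acceptV s hs u v huv hw
  rcases h1 with ⟨h1, -⟩ | ⟨-, v', hv', hx, -, rfl⟩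
  · exact absurd hF h1
  · have hne : v ≠ v' := by rintro rfl; exact huv hv'
    rcases h2 with ⟨-, rfl⟩ | ⟨h2, -⟩
    · rw [release_join_eq_reswap hne hF hx] at h3
      exact ⟨v', hne, hv', hx, h3⟩
    · simp only [release, Function.update_of_ne hne] at h2
      exact absurd h2 hG

/-- Properties of the profiles `σ` that occur while the aspirations of `w` are raised with the help
of the violator `v₃`, in comparison to the initial profile `s`. The columns of all nodes but `v₃`
and `vs` have the same free copies as in `s`. -/
structure Round (s : Profile U V) (q : U → ℕ) (p : V → ℕ) (w : U) (v₃ : V) (F₁ : U → Multiset ℕ)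
    (vs : V) (σ : Profile U V) : Prop where
  F_eq : σ.F = F₁
  same : ∀ u v, (u, v) ∈ σ.E → u ≠ w → σ.x (u, v) = s.x (u, v) ∧ σ.y (u, v) = s.y (u, v)
  le_x : ∀ v, (w, v) ∈ σ.E → q w ≤ σ.x (w, v) + 1
  p_le : ∀ v, (w, v) ∈ σ.E → p v ≤ σ.y (w, v)
  full : ∀ v, (w, v) ∈ σ.E → v ≠ v₃ → σ.x (w, v) < q w → s.G v = 0
  G_eq : ∀ v, v ≠ v₃ → v ≠ vs → σ.G v = s.G v
  G_mem : ∀ t ∈ σ.G v₃, p v₃ ≤ t ∧ t ≤ p v₃ + 1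

/-- A profile of the raising procedure in which `v₃` has a free copy and all other links of `w` are
in place. -/
structure RoundA (A : Market U V) (L : Set (Profile U V)) (s : Profile U V) (q : U → ℕ)
    (p : V → ℕ) (w : U) (v₃ : V) (F₁ : U → Multiset ℕ) (E₁ : Finset (U × V)) (σ : Profile U V) :
    Prop extends Round s q p w v₃ F₁ v₃ σ where
  mem : σ ∈ L
  E_eq : σ.E = E₁
  G_ne : σ.G v₃ ≠ 0

/-- A profile of the raising procedure in which `w` is linked with `v₃` instead of `vs`, which has a
free copy. -/
structure RoundB (A : Market U V) (L : Set (Profile U V)) (s : Profile U V) (q : U → ℕ)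
    (p : V → ℕ) (w : U) (v₃ : V) (F₁ : U → Multiset ℕ) (E₁ : Finset (U × V)) (vs : V)
    (σ : Profile U V) : Prop extends Round s q p w v₃ F₁ vs σ where
  mem : σ ∈ L
  E_eq : σ.E = insert (w, v₃) (E₁.erase (w, vs))
  vs_ne : vs ≠ v₃
  vs_mem : (w, vs) ∈ E₁
  G_vs : σ.G vs = {A.w w vs + 1 - q w}
  G_vs' : s.G vs = 0
  x_eq : σ.x (w, v₃) + 1 = q w
  y_eq : σ.y (w, v₃) = p v₃ + 1

variable {q : U → ℕ} {p : V → ℕ} {w : U} {v₃ : V} {F₁ : U → Multiset ℕ} {E₁ : Finset (U × V)}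

/-- The violator `v₃` takes a free copy of aspiration `p v₃` to `w`, which leaves `v'`. -/
theorem Round.reswap_roundB (h : Round s q p w v₃ F₁ v₃ σ) (hE : σ.E = E₁) (h3 : (w, v₃) ∉ E₁)
    (hw3 : A.w w v₃ = q w + p v₃) {v' : V} (hv' : (w, v') ∈ E₁)
    (hx : σ.x (w, v') + 1 = q w) (hsat : σ.x (w, v') + σ.y (w, v') = A.w w v')
    (hρ : ρ = σ.reswap w v₃ v' (p v₃) (q w - 1) (A.w w v₃ - (q w - 1))) (hρL : ρ ∈ L) :
    A.RoundB L s q p w v₃ F₁ E₁ v' ρ := by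
  have hne : v' ≠ v₃ := by rintro rfl; exact h3 hv'
  have hlink : ∀ u v, (u, v) ∈ ρ.E → (u, v) ≠ (w, v₃) → (u, v) ∈ σ.E := by
    intro u v huv hne'
    rw [hρ] at huv
    exact Finset.mem_of_mem_erase ((Finset.mem_insert.1 huv).resolve_left hne')
  have hG0 : σ.G v' = 0 := by
    rw [h.G_eq v' hne hne]
    exact h.full v' (hE ▸ hv') hne (by omega)
  refine ⟨⟨?_, fun u v huv hu => ?_, fun v hv => ?_, fun v hv => ?_, fun v hv hv3 hlt => ?_,
    fun v hv hvs => ?_, fun t ht => ?_⟩, hρL, ?_, hne, hv', ?_, ?_, ?_, ?_⟩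
  · rw [hρ]
    exact h.F_eq
  · have hne' : (u, v) ≠ (w, v₃) := fun h => hu (Prod.mk.inj h).1
    have h1 := hlink u v huv hne'
    rw [hρ]
    simp only [reswap, Function.update_of_ne hne']
    exact h.same u v h1 hu
  · by_cases hv3 : v = v₃
    · rw [hρ, hv3]
      simp only [reswap, Function.update_self]
      omega
    · have hne' : (w, v) ≠ (w, v₃) := fun h => hv3 (Prod.mk.inj h).2
      have h1 := hlink w v hv hne'
      rw [hρ]
      simp only [reswap, Function.update_of_ne hne']
      exact h.le_x v h1
  · by_cases hv3 : v = v₃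
    · rw [hρ, hv3]
      simp only [reswap, Function.update_self]
      omega
    · have hne' : (w, v) ≠ (w, v₃) := fun h => hv3 (Prod.mk.inj h).2
      have h1 := hlink w v hv hne'
      rw [hρ]
      simp only [reswap, Function.update_of_ne hne']
      exact h.p_le v h1
  · have hne' : (w, v) ≠ (w, v₃) := fun h => hv3 (Prod.mk.inj h).2
    have h1 := hlink w v hv hne'
    rw [hρ] at hlt
    simp only [reswap, Function.update_of_ne hne'] at hlt
    exact h.full v h1 hv3 hlt
  · rw [hρ]
    simp only [reswap, Function.update_of_ne hv, Function.update_of_ne hvs]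
    exact h.G_eq v hv hv
  · rw [hρ] at ht
    simp only [reswap, Function.update_self] at ht
    exact h.G_mem t (Multiset.mem_of_mem_erase ht)
  · rw [hρ, ← hE]
    rfl
  · rw [hρ]
    simp only [reswap, Function.update_of_ne hne, Function.update_self, hG0]
    rw [show σ.y (w, v') = A.w w v' + 1 - q w by omega]
    rfl
  · rw [← h.G_eq v' hne hne, hG0]
  · rw [hρ]
    simp only [reswap, Function.update_self]
    omega
  · rw [hρ]
    simp only [reswap, Function.update_self]
    omega

theorem dirty_reswap {v v' : V} {a c xn yn : ℕ} (hv : v ≠ v') (hF : σ.F w = 0)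
    (ha : σ.x (w, v') = a) (h : (w, v) ∉ σ.E) (h' : (w, v') ∈ σ.E) :
    (σ.reswap w v v' c xn yn).dirty q + (if a < q w then 1 else 0) =
      σ.dirty q + if xn < q w then 1 else 0 :=
  sumU_reswap (fun u a => if a < q u then 1 else 0) c xn yn hv hF ha h h'

/-- If `w` still has an aspiration below its bound, then `v₃` takes one of these copies over. The
tie-breaking player chooses the partner `vs` that `w` leaves. -/
theorem RoundA.exists_roundB (hL : A.Stuck L) (h : A.RoundA L s q p w v₃ F₁ E₁ σ)
    (h3 : (w, v₃) ∉ E₁) (hw3 : A.w w v₃ = q w + p v₃) (hF : F₁ w = 0) {v : V}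
    (hv : (w, v) ∈ E₁) (hx : σ.x (w, v) < q w) :
    ∃ vs ρ, A.RoundB L s q p w v₃ F₁ E₁ vs ρ ∧ ρ.dirty q ≤ σ.dirty q := by
  have hFw : σ.F w = 0 := by rw [h.F_eq, hF]
  -- it suffices to consider the case that the considered aspiration of `v₃` is `p v₃`
  have main : ∀ σ, A.RoundA L s q p w v₃ F₁ E₁ σ → σ.x (w, v) < q w → σ.cV v₃ = p v₃ →
      ∃ vs ρ, A.RoundB L s q p w v₃ F₁ E₁ vs ρ ∧ ρ.dirty q ≤ σ.dirty q := by
    intro σ h hx hc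
    have hFw : σ.F w = 0 := by rw [h.F_eq, hF]
    have hcU : σ.cU w + 1 = q w := by
      have h1 := cU_le_link hFw (h.E_eq ▸ hv)
      have h2 := (hL.valid σ h.mem).le_cU (u := w) (a := q w - 1)
        (by rw [hFw]; simp) fun _ v hv => by have := h.le_x v hv; omega
      omega
    obtain ⟨v', hne, hv', hx', hρ⟩ := hL.acceptV_full h.mem hFw h.G_ne (h.E_eq ▸ h3)
      (by omega)
    rw [hc, show σ.cU w = q w - 1 by omega] at hρ
    refine ⟨v', _, h.toRound.reswap_roundB h.E_eq h3 hw3 (h.E_eq ▸ hv') (by omega)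
      ((hL.valid σ h.mem).sat w v' hv') rfl hρ, ?_⟩
    have := dirty_reswap (q := q) (c := p v₃) (xn := q w - 1) (yn := A.w w v₃ - (q w - 1))
      hne hFw hx' (h.E_eq ▸ h3) hv'
    rw [if_pos (by omega), if_pos (by omega)] at this
    omega
  have hmem := h.G_mem _ (cV_mem h.G_ne)
  by_cases hc : σ.cV v₃ = p v₃
  · exact main σ h hx hc
  · have hcU := (hL.valid σ h.mem).le_cU (u := w) (a := q w - 1)
        (by rw [hFw]; simp) fun _ v hv => by have := h.le_x v hv; omega
    have h1 := hL.lowerV σ h.mem w v₃ (h.E_eq ▸ h3) (by omega) _ (cV_mem h.G_ne) (by omega)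
      fun t ht _ => cV_le ht
    have hA : A.RoundA L s q p w v₃ F₁ E₁ (σ.lowerG v₃ (σ.cV v₃)) := by
      refine ⟨⟨h.F_eq, h.same, h.le_x, h.p_le, h.full, fun v hv _ => ?_, fun t ht => ?_⟩, h1,
        h.E_eq, ?_⟩
      · simp only [lowerG, Function.update_of_ne hv]
        exact h.G_eq v hv hv
      · simp only [lowerG, Function.update_self, Multiset.mem_cons] at ht
        rcases ht with rfl | ht
        · omega
        · exact h.G_mem t (Multiset.mem_of_mem_erase ht)
      · simp [lowerG]
    obtain ⟨vs, ρ, h2, h3⟩ := main _ hA hx (cV_eq (by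
        simp only [lowerG, Function.update_self, Multiset.mem_cons]
        left
        omega) fun t ht => (hA.G_mem t ht).1)
    exact ⟨vs, ρ, h2, h3⟩

/-- The deserted node `vs` lowers its free copy by one, and `w` returns to it at the bound `q w`. To
this end `w` leaves `v₃` or another partner with which it is below the bound. -/
theorem RoundB.next (hL : A.Stuck L) {vs : V} (h : A.RoundB L s q p w v₃ F₁ E₁ vs σ)
    (h3 : (w, v₃) ∉ E₁) (hF : F₁ w = 0)
    (hle : q w + p vs ≤ A.w w vs) :
    ∃ ρ, ρ.dirty q < σ.dirty q ∧ (A.RoundA L s q p w v₃ F₁ E₁ ρ ∨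
      ∃ vs', A.RoundB L s q p w v₃ F₁ E₁ vs' ρ) := by
  have hFw : σ.F w = 0 := by rw [h.F_eq, hF]
  have h3E : (w, v₃) ∈ σ.E := by rw [h.E_eq]; exact Finset.mem_insert_self _ _
  have hxq := h.x_eq
  have hcU : σ.cU w + 1 = q w := by
    have h1 := cU_le_link hFw h3E
    have h2 := (hL.valid σ h.mem).le_cU (u := w) (a := q w - 1)
      (by rw [hFw]; simp) fun _ v hv => by have := h.le_x v hv; omega
    omega
  have hvsE : (w, vs) ∉ σ.E := by
    rw [h.E_eq]
    simp [h.vs_ne]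
  have hcV : σ.cV vs = A.w w vs + 1 - q w := cV_singleton h.G_vs
  have hb : A.w w vs + 1 - q w ∈ σ.G vs := by simp [h.G_vs]
  -- the free copy of `vs` is lowered by one, so that `w` gains with `vs`
  have hlow := hL.lowerV σ h.mem w vs hvsE (by omega) _ hb (by omega)
    fun t ht _ => by rw [h.G_vs, Multiset.mem_singleton] at ht; omega
  set σ' := σ.lowerG vs (A.w w vs + 1 - q w) with hσ'
  have hGvs : σ'.G vs = {A.w w vs - q w} := by
    simp only [hσ', lowerG, Function.update_self, h.G_vs]
    rw [show A.w w vs + 1 - q w - 1 = A.w w vs - q w by omega]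
    simp
  have hcV' : σ'.cV vs = A.w w vs - q w := cV_singleton hGvs
  have hcU' : σ'.cU w = σ.cU w := rfl
  obtain ⟨v', hne, hv', hx', hρ⟩ := hL.acceptU_full hlow hFw (by rw [hGvs]; simp) hvsE (by omega)
  rw [hcV', show A.w w vs - (A.w w vs - q w) = q w by omega] at hρ
  have hd := dirty_reswap (σ := σ') (q := q) (c := A.w w vs - q w) (xn := q w)
    (yn := A.w w vs - q w) hne hFw hx' hvsE hv'
  rw [if_pos (by omega), if_neg (lt_irrefl _)] at hd
  set ρ := σ'.reswap w vs v' (A.w w vs - q w) (q w) (A.w w vs - q w) with hρdef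
  have hd' : σ'.dirty q = σ.dirty q := rfl
  refine ⟨ρ, by omega, ?_⟩
  have hlink : ∀ u v, (u, v) ∈ ρ.E → (u, v) ≠ (w, vs) → (u, v) ∈ σ.E := by
    intro u v huv hne'
    exact Finset.mem_of_mem_erase ((Finset.mem_insert.1 huv).resolve_left hne')
  have hx'' : σ.x (w, v') + 1 = q w := by
    have : σ'.x (w, v') = σ.x (w, v') := rfl
    omega
  have hG : ∀ v, v ≠ vs → v ≠ v' → ρ.G v = σ.G v := by
    intro v h1 h2
    simp only [hρdef, reswap, Function.update_of_ne h1, Function.update_of_ne h2, hσ', lowerG]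
  have hGvs' : ρ.G vs = 0 := by
    simp only [hρdef, reswap, Function.update_self, hGvs]
    simp
  have hGv' : ρ.G v' = σ.y (w, v') ::ₘ σ.G v' := by
    simp only [hρdef, reswap, Function.update_of_ne hne.symm, Function.update_self, hσ', lowerG]
  have hxρ : ∀ v, v ≠ vs → ρ.x (w, v) = σ.x (w, v) := fun v hv => by
    simp only [hρdef, reswap, hσ', lowerG]
    rw [Function.update_of_ne (by simp [hv])]
  have hyρ : ∀ v, v ≠ vs → ρ.y (w, v) = σ.y (w, v) := fun v hv => by
    simp only [hρdef, reswap, hσ', lowerG]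
    rw [Function.update_of_ne (by simp [hv])]
  have hxvs : ρ.x (w, vs) = q w := by simp [hρdef, reswap]
  have hyvs : ρ.y (w, vs) = A.w w vs - q w := by simp [hρdef, reswap]
  have hround : ∀ v'', (∀ v, v ≠ v₃ → v ≠ v'' → ρ.G v = s.G v) →
      (∀ t ∈ ρ.G v₃, p v₃ ≤ t ∧ t ≤ p v₃ + 1) → Round s q p w v₃ F₁ v'' ρ := by
    intro v'' hG1 hG2
    refine ⟨h.F_eq, fun u v huv hu => ?_, fun v hv => ?_, fun v hv => ?_, fun v hv hv3 hlt => ?_,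
      hG1, hG2⟩
    · have hne' : (u, v) ≠ (w, vs) := fun h => hu (Prod.mk.inj h).1
      simp only [hρdef, reswap, Function.update_of_ne hne']
      exact h.same u v (hlink u v huv hne') hu
    · by_cases hvs : v = vs
      · subst hvs
        omega
      · rw [hxρ v hvs]
        exact h.le_x v (hlink w v hv fun h => hvs (Prod.mk.inj h).2)
    · by_cases hvs : v = vs
      · subst hvs
        omega
      · rw [hyρ v hvs]
        exact h.p_le v (hlink w v hv fun h => hvs (Prod.mk.inj h).2)
    · by_cases hvs : v = vs
      · subst hvs
        omega
      · rw [hxρ v hvs] at hlt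
        exact h.full v (hlink w v hv fun h => hvs (Prod.mk.inj h).2) hv3 hlt
  by_cases hv3 : v' = v₃
  · subst hv3
    left
    refine ⟨hround v' (fun v h1 _ => ?_) fun t ht => ?_, hρ, ?_, ?_⟩
    · by_cases hvs : v = vs
      · rw [hvs, hGvs', h.G_vs']
      · rw [hG v hvs h1]
        exact h.G_eq v h1 hvs
    · rw [hGv', Multiset.mem_cons] at ht
      rcases ht with rfl | ht
      · rw [h.y_eq]
        omega
      · exact h.G_mem t ht
    · have : ρ.E = insert (w, vs) (σ.E.erase (w, v')) := rfl
      rw [this, h.E_eq, Finset.erase_insert (by simp [h3]), Finset.insert_erase h.vs_mem]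
    · rw [hGv']
      exact Multiset.cons_ne_zero
  · right
    have hv'1 : (w, v') ∈ E₁ := by
      have : (w, v') ∈ σ.E := hv'
      rw [h.E_eq, Finset.mem_insert] at this
      exact Finset.mem_of_mem_erase (this.resolve_left fun h => hv3 (Prod.mk.inj h).2)
    have hs0 : s.G v' = 0 := h.full v' hv' hv3 (by omega)
    have hσ0 : σ.G v' = 0 := by rw [h.G_eq v' hv3 hne.symm, hs0]
    have hsat := (hL.valid σ h.mem).sat w v' hv'
    have h3ne : v₃ ≠ vs := h.vs_ne.symm
    refine ⟨v', hround v' (fun v h1 h2 => ?_) fun t ht => ?_, hρ, ?_, hv3, hv'1, ?_, hs0, ?_, ?_⟩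
    · by_cases hvs : v = vs
      · rw [hvs, hGvs', h.G_vs']
      · rw [hG v hvs h2]
        exact h.G_eq v h1 hvs
    · rw [hG v₃ h3ne (Ne.symm hv3)] at ht
      exact h.G_mem t ht
    · have : ρ.E = insert (w, vs) (σ.E.erase (w, v')) := rfl
      rw [this, h.E_eq]
      ext e
      simp only [Finset.mem_insert, Finset.mem_erase]
      have h4 := h.vs_mem
      have h5 : (w, v₃) ≠ (w, v') := fun h => hv3 (Prod.mk.inj h).2.symm
      have h6 : (w, vs) ≠ (w, v') := fun h => hne (Prod.mk.inj h).2
      by_cases he1 : e = (w, vs)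
      · subst he1
        simp [h4, h6]
      · by_cases he2 : e = (w, v₃)
        · subst he2
          simp [h5]
        · simp [he1, he2]
    · rw [hGv', hσ0, show σ.y (w, v') = A.w w v' + 1 - q w by omega]
      rfl
    · rw [hxρ v₃ h3ne]
      exact h.x_eq
    · rw [hyρ v₃ h3ne]
      exact h.y_eq

/-- The raising procedure ends, since each return of `w` to a partner reduces the number of copies
below the bound. -/
theorem RoundB.finish (hL : A.Stuck L) {vs : V} (h : A.RoundB L s q p w v₃ F₁ E₁ vs σ)
    (h3 : (w, v₃) ∉ E₁) (hw3 : A.w w v₃ = q w + p v₃) (hF : F₁ w = 0)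
    (hle : ∀ v, (w, v) ∈ E₁ → q w + p v ≤ A.w w v) :
    ∃ ρ, A.RoundA L s q p w v₃ F₁ E₁ ρ ∧ ρ.dirty q < σ.dirty q ∧
      ∀ v, (w, v) ∈ ρ.E → q w ≤ ρ.x (w, v) := by
  induction hn : σ.dirty q using Nat.strong_induction_on generalizing σ vs with
  | _ n ih =>
    obtain ⟨ρ, hd, hρ | ⟨vs', hρ⟩⟩ := h.next hL h3 hF (hle vs h.vs_mem)
    · by_cases hcl : ∀ v, (w, v) ∈ ρ.E → q w ≤ ρ.x (w, v)
      · exact ⟨ρ, hρ, by omega, hcl⟩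
      · push Not at hcl
        obtain ⟨v, hv, hx⟩ := hcl
        obtain ⟨vs', ρ', h1, h2⟩ := hρ.exists_roundB hL h3 hw3 hF (hρ.E_eq ▸ hv) hx
        obtain ⟨τ, hτ, hτd, hτc⟩ := ih (ρ'.dirty q) (by omega) h1 rfl
        exact ⟨τ, hτ, by omega, hτc⟩
    · obtain ⟨τ, hτ, hτd, hτc⟩ := ih (ρ.dirty q) (by omega) hρ rfl
      exact ⟨τ, hτ, by omega, hτc⟩

end Market

end ProposalGame

namespace ProposalGame
open Profile

variable {U V : Type*} [DecidableEq U] [DecidableEq V] [Fintype U] [Fintype V]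
variable {A : Market U V} {L : Set (Profile U V)} {s σ ρ κ : Profile U V}
variable {q : U → ℕ} {p : V → ℕ} {w : U} {v₃ : V}

namespace Market

theorem Frame.of_links_eq (hL : A.Stuck L) (h : A.Frame L s q p) (hκ : κ ∈ L) (hE : κ.E = s.E)
    (hz : ∀ v, ∀ t ∈ κ.G v, t = 0) (hG : ∀ v, s.G v = 0 → κ.G v = 0)
    (hy : ∀ u v, (u, v) ∈ s.E → p v ≤ κ.y (u, v))
    (hx : ∀ u v, (u, v) ∈ s.E → q u ≤ κ.x (u, v) + 1)
    (hfull : ∀ u v, (u, v) ∈ s.E → κ.x (u, v) < q u → s.G v = 0)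
    (hF : ∀ u, ∀ t ∈ κ.F u, q u ≤ t + 1) :
    A.Frame L κ q p ∧ A.tau κ q p ≤ A.tau s q p := by
  have hc := (hL.valid s h.mem).card_eq (hL.valid κ hκ) hE
  refine ⟨⟨hκ, hz, ?_, fun v h1 => h.p_zero v fun h2 => h1 (hG v h2), ?_, ?_, ?_, hF, ?_⟩, ?_⟩
  · rw [hE]
    exact hy
  · rw [hE]
    exact h.le_w
  · intro u
    rw [hc, hE]
    exact h.bad_le u
  · rw [hE]
    exact hx
  · rw [hE]
    exact fun u v h1 h2 => hG v (hfull u v h1 h2)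
  · unfold tau
    rw [hE]
    simp only [hc]
    exact le_rfl

/-- The free copies of `v₃` can be lowered until it considers `p v₃ - 1`. -/
theorem Stuck.lower_to (hL : A.Stuck L) (hρ : ρ ∈ L) (h3 : (w, v₃) ∉ ρ.E) {c : ℕ}
    (hw : A.w w v₃ ≤ ρ.cU w + c) (hG : ρ.G v₃ ≠ 0) (hc : ∀ t ∈ ρ.G v₃, c - 1 ≤ t) :
    ∃ σ ∈ L, σ.E = ρ.E ∧ σ.x = ρ.x ∧ σ.y = ρ.y ∧ σ.F = ρ.F ∧ (∀ v, v ≠ v₃ → σ.G v = ρ.G v) ∧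
      σ.G v₃ ≠ 0 ∧ σ.cV v₃ = c - 1 ∧ (c = 0 → ∀ t ∈ σ.G v₃, t = 0) := by
  obtain ⟨σ, ⟨hσ, hE, hx, hy, hF, hGv, hG3, hge⟩, hmin⟩ := exists_min_of_exists
    (fun σ : Profile U V => σ ∈ L ∧ σ.E = ρ.E ∧ σ.x = ρ.x ∧ σ.y = ρ.y ∧ σ.F = ρ.F ∧
      (∀ v, v ≠ v₃ → σ.G v = ρ.G v) ∧ σ.G v₃ ≠ 0 ∧ ∀ t ∈ σ.G v₃, c - 1 ≤ t)
    (fun σ => σ.sumV fun _ t => t) ⟨ρ, hρ, rfl, rfl, rfl, rfl, fun _ _ => rfl, hG, hc⟩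
  have hcU : σ.cU w = ρ.cU w := by
    unfold cU
    rw [hE, hx, hF]
  have hstep : ∀ h ∈ σ.G v₃, 0 < h → (∀ t ∈ σ.G v₃, 0 < t → h ≤ t) → c ≤ h → ¬ c ≤ σ.cV v₃ := by
    intro h hh hpos hhmin hch hcV
    have h1 := hL.lowerV σ hσ w v₃ (hE ▸ h3) (by omega) h hh hpos hhmin
    have h2 := sumV_lowerG (fun _ t => t) hh
    have h3 := hmin (σ.lowerG v₃ h) ⟨h1, hE, hx, hy, hF, fun v hv => ?_, ?_, fun t ht => ?_⟩
    · omega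
    · rw [← hGv v hv]
      simp [lowerG, hv]
    · simp [lowerG]
    · simp only [lowerG, Function.update_self, Multiset.mem_cons] at ht
      rcases ht with rfl | ht
      · omega
      · exact hge t (Multiset.mem_of_mem_erase ht)
  have hcmem := cV_mem hG3
  have hcge := hge _ hcmem
  refine ⟨σ, hσ, hE, hx, hy, hF, hGv, hG3, ?_, fun h0 => ?_⟩
  · by_contra hne
    exact hstep _ hcmem (by omega) (fun t ht _ => cV_le ht) (by omega) (by omega)
  · by_contra hne
    obtain ⟨h, hh, hpos, hhmin⟩ := lowerG_mem_of_pos hne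
    exact hstep h hh hpos hhmin (by omega) (by omega)

/-- The end of the raising procedure if `v₃` has a free copy in the initial profile. -/
theorem RoundA.frame_of_free (hL : A.Stuck L) (h : A.Frame L s q p) (hG : s.G v₃ ≠ 0)
    (hr : A.RoundA L s q p w v₃ s.F s.E ρ) (h3 : (w, v₃) ∉ s.E) (hF : s.F w = 0)
    (hw3 : A.w w v₃ = q w + p v₃) (hx : ∀ v, (w, v) ∈ ρ.E → q w ≤ ρ.x (w, v)) :
    ∃ κ, A.Frame L κ q p ∧ A.tau κ q p ≤ A.tau s q p ∧ κ.dirty q = ρ.dirty q := by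
  have hp := h.p_zero v₃ hG
  have hcU := (hL.valid ρ hr.mem).le_cU (u := w) (a := q w)
    (by rw [hr.F_eq, hF]; simp) fun _ => hx
  obtain ⟨κ, hκ, hE, hxκ, hyκ, hFκ, hGv, -, -, hz⟩ := hL.lower_to (w := w) (c := 0) hr.mem (hr.E_eq ▸ h3)
    (by omega) hr.G_ne (fun _ _ => Nat.zero_le _)
  have hG' : ∀ v, v ≠ v₃ → κ.G v = s.G v := fun v hv => (hGv v hv).trans (hr.G_eq v hv hv)
  have hE' : κ.E = s.E := hE.trans hr.E_eq
  have key := h.of_links_eq hL hκ hE' (fun v t ht => ?_) (fun v hv => ?_)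
    (fun u v huv => ?_) (fun u v huv => ?_) (fun u v huv hlt => ?_) (fun u t ht => ?_)
  · refine ⟨κ, key.1, key.2, ?_⟩
    unfold dirty sumU
    rw [hE, hxκ, hFκ]
  · by_cases hv : v = v₃
    · subst hv
      exact hz rfl t ht
    · exact h.zero v t (hG' v hv ▸ ht)
  · have hne : v ≠ v₃ := by rintro rfl; exact hG hv
    rw [hG' v hne, hv]
  · rw [hyκ]
    rw [← hr.E_eq] at huv
    by_cases hu : u = w
    · subst hu
      exact hr.p_le v huv
    · rw [(hr.same u v huv hu).2]
      exact h.p_le u v (hr.E_eq ▸ huv)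
  · rw [hxκ]
    rw [← hr.E_eq] at huv
    by_cases hu : u = w
    · subst hu
      exact hr.le_x v huv
    · rw [(hr.same u v huv hu).1]
      exact h.le_x u v (hr.E_eq ▸ huv)
  · rw [hxκ] at hlt
    rw [← hr.E_eq] at huv
    by_cases hu : u = w
    · subst hu
      exact absurd (hx v huv) (by omega)
    · rw [(hr.same u v huv hu).1] at hlt
      exact h.full u v (hr.E_eq ▸ huv) hlt
  · rw [hFκ, hr.F_eq] at ht
    exact h.le_F u t ht

/-- The end of the raising procedure if the node `x₃` has been displaced from `v₃`. -/
theorem RoundA.frame_of_displaced (hL : A.Stuck L) (h : A.Frame L s q p) (hG : s.G v₃ = 0)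
    {x₃ : U} (hx3 : (x₃, v₃) ∈ s.E) (hy3 : s.y (x₃, v₃) = p v₃) (hw0 : A.w x₃ v₃ ≠ 0)
    (hr : A.RoundA L s q p w v₃ (s.release (x₃, v₃)).F (s.release (x₃, v₃)).E ρ)
    (h3 : (w, v₃) ∉ s.E) (hF : s.F w = 0)
    (hw3 : A.w w v₃ = q w + p v₃) (hx : ∀ v, (w, v) ∈ ρ.E → q w ≤ ρ.x (w, v)) :
    ∃ κ, A.Frame L κ q p ∧ A.tau κ q p ≤ A.tau s q p ∧ κ.dirty q ≤ ρ.dirty q := by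
  have hne : w ≠ x₃ := by rintro rfl; exact h3 hx3
  have hF1 : (s.release (x₃, v₃)).F w = 0 := by simp [release, hne, hF]
  have hcU := (hL.valid ρ hr.mem).le_cU (u := w) (a := q w)
    (by rw [hr.F_eq, hF1]; simp) fun _ => hx
  have hE1 : (s.release (x₃, v₃)).E = s.E.erase (x₃, v₃) := rfl
  obtain ⟨σ, hσ, hE, hxσ, hyσ, hFσ, hGv, hG3, hc, -⟩ := hL.lower_to (w := w) (c := p v₃) hr.mem
    (by rw [hr.E_eq, hE1]; simp [h3]) (by omega) hr.G_ne
    (fun t ht => by have := hr.G_mem t ht; omega)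
  have hEσ : σ.E = s.E.erase (x₃, v₃) := hE.trans hr.E_eq
  have hFx : σ.F x₃ = s.x (x₃, v₃) ::ₘ s.F x₃ := by rw [hFσ, hr.F_eq]; simp [release]
  have hFne : ∀ u, u ≠ x₃ → σ.F u = s.F u := fun u hu => by
    rw [hFσ, hr.F_eq]
    simp [release, hu]
  have hF3 : σ.F x₃ ≠ 0 := by rw [hFx]; exact Multiset.cons_ne_zero
  have hx3E : (x₃, v₃) ∉ σ.E := by rw [hEσ]; simp
  have hsat := (hL.valid s h.mem).sat x₃ v₃ hx3
  have hlew := h.le_w x₃ v₃ hx3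
  have hqt : ∀ t ∈ σ.F x₃, q x₃ ≤ t + 1 := by
    intro t ht
    rw [hFx, Multiset.mem_cons] at ht
    rcases ht with rfl | ht
    · exact h.le_x x₃ v₃ hx3
    · exact h.le_F x₃ t ht
  have htx : σ.cU x₃ ≤ s.x (x₃, v₃) := cU_le (by rw [hFx]; exact Multiset.mem_cons_self _ _)
  -- with `c = p v₃ - 1` the node `x₃` keeps its aspiration, unless `p v₃ = 0`
  obtain ⟨κ, xn, yn, hκ, ho, hxn, hyn, hxd⟩ : ∃ κ xn yn, κ ∈ L ∧
      A.Outcome σ x₃ v₃ (σ.cU x₃) (σ.cV v₃) xn yn κ ∧ q x₃ ≤ xn + 1 ∧ p v₃ ≤ yn ∧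
      (xn < q x₃ → σ.cU x₃ < q x₃) := by
    by_cases hp : p v₃ = 0
    · obtain ⟨κ, hκ, ho⟩ := hL.take hσ hF3 hx3E (by omega)
      exact ⟨κ, _, _, hκ, ho, by omega, by omega, by omega⟩
    · obtain ⟨κ, hκ, ho⟩ := hL.give hσ hF3 hx3E (by omega)
      rw [min_eq_left (by omega)] at ho
      exact ⟨κ, _, _, hκ, ho, hqt _ (cU_mem hF3), by omega, id⟩
  have hd := ho.sumU (fun u a => if a < q u then 1 else 0) hx3E (cU_mem hF3)
  change κ.dirty q + _ = σ.dirty q + _ at hd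
  have hdσ : σ.dirty q = ρ.dirty q := by
    unfold dirty sumU
    rw [hE, hxσ, hFσ]
  have hκJ : κ = σ.join (x₃, v₃) (σ.cU x₃) (σ.cV v₃) xn yn := by
    rcases ho with ⟨-, h1⟩ | ⟨h1, -⟩
    · exact h1
    · exact absurd h1 hG3
  have hEκ : κ.E = s.E := by
    rw [hκJ]
    show insert (x₃, v₃) σ.E = s.E
    rw [hEσ, Finset.insert_erase hx3]
  have hG3κ : κ.G v₃ = 0 := by
    have h1 := (hL.valid s h.mem).cardG v₃
    have h2 := (hL.valid κ hκ).cardG v₃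
    rw [hEκ] at h2
    rw [hG, Multiset.card_zero] at h1
    exact Multiset.card_eq_zero.1 (by omega)
  have hGκ : ∀ v, v ≠ v₃ → κ.G v = s.G v := fun v hv => by
    rw [← hr.G_eq v hv hv, ← hGv v hv, hκJ]
    simp [join, hv]
  have hlk : ∀ u v, (u, v) ∈ s.E → (u = x₃ ∧ v = v₃ ∧ κ.x (u, v) = xn ∧ κ.y (u, v) = yn) ∨
      ((u, v) ∈ ρ.E ∧ κ.x (u, v) = ρ.x (u, v) ∧ κ.y (u, v) = ρ.y (u, v)) := by
    intro u v huv
    rcases ho.link (hEκ.symm ▸ huv) with h1 | ⟨h1, -, h2, h3⟩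
    · exact Or.inl h1
    · rw [hE] at h1
      rw [hxσ] at h2
      rw [hyσ] at h3
      exact Or.inr ⟨h1, h2, h3⟩
  have key := h.of_links_eq hL hκ hEκ (fun v t ht => ?_) (fun v hv => ?_)
    (fun u v huv => ?_) (fun u v huv => ?_) (fun u v huv hlt => ?_) (fun u t ht => ?_)
  · refine ⟨κ, key.1, key.2, ?_⟩
    split_ifs at hd <;> omega
  · by_cases hv : v = v₃
    · subst hv
      rw [hG3κ] at ht
      simp at ht
    · exact h.zero v t (hGκ v hv ▸ ht)
  · by_cases hv : v = v₃
    · rw [hv, hG3κ]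
    · rw [hGκ v hv]
      assumption
  · rcases hlk u v huv with ⟨rfl, rfl, h1, h2⟩ | ⟨h1, h2, h3⟩
    · omega
    · rw [h3]
      by_cases hu : u = w
      · subst hu
        exact hr.p_le v h1
      · rw [(hr.same u v h1 hu).2]
        exact h.p_le u v huv
  · rcases hlk u v huv with ⟨rfl, rfl, h1, h2⟩ | ⟨h1, h2, h3⟩
    · omega
    · rw [h2]
      by_cases hu : u = w
      · subst hu
        exact hr.le_x v h1
      · rw [(hr.same u v h1 hu).1]
        exact h.le_x u v huv
  · rcases hlk u v huv with ⟨rfl, rfl, h1, h2⟩ | ⟨h1, h2, h3⟩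
    · exact hG
    · rw [h2] at hlt
      by_cases hu : u = w
      · subst hu
        exact absurd (hx v h1) (by omega)
      · rw [(hr.same u v h1 hu).1] at hlt
        exact h.full u v huv hlt
  · have h1 : t ∈ σ.F u := by
      by_cases hu : u = x₃
      · subst hu
        rw [ho.F_self] at ht
        exact Multiset.mem_of_mem_erase ht
      · rw [hκJ] at ht
        simpa [join, hu] using ht
    by_cases hu : u = x₃
    · subst hu
      exact hqt t h1
    · exact h.le_F u t (hFne u hu ▸ h1)

/-- If a node without free copies has an aspiration below its bound, then the violator `v₃` serves
to raise all its aspirations to the bound: it takes a copy of `w` away from some node `vs`, which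
`w` wins back at the bound after `vs` has lowered its aspiration by one, and so on until `v₃` itself
is left. The node that `v₃` has given up for `w` finally returns to it. -/
theorem Frame.raise_full (hL : A.Stuck L) (h : A.Frame L s q p) (hF : s.F w = 0)
    (hd : s.IsDirty q w) (hv : (A.viol s q w).Nonempty) :
    ∃ κ, A.Frame L κ q p ∧ A.tau κ q p ≤ A.tau s q p ∧ κ.dirty q < s.dirty q := by
  obtain ⟨v₃, hv⟩ := hv
  obtain ⟨h3, hle⟩ := mem_viol.1 hv
  obtain ⟨v, hvE, hvx⟩ : ∃ v, (w, v) ∈ s.E ∧ s.x (w, v) < q w := by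
    rcases hd with ⟨t, ht, -⟩ | hd
    · rw [hF] at ht
      simp at ht
    · exact hd
  have hq : q w ≠ 0 := by omega
  have hval := hL.valid s h.mem
  have hpc := h.p_le_cV hL v₃
  have hw3 : A.w w v₃ = q w + p v₃ := by
    have h1 := h.bad_le w
    rw [hF, Multiset.card_zero, Nat.le_zero, Finset.card_eq_zero] at h1
    by_contra hne
    have : v₃ ∈ A.bad s.E q p w := mem_bad.2 ⟨h3, by omega⟩
    rw [h1] at this
    simp at this
  have hc : s.cV v₃ = p v₃ := by omega
  have hlew : ∀ v, (w, v) ∈ s.E → q w + p v ≤ A.w w v := h.le_w w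
  by_cases hG : s.G v₃ = 0
  · have hcU : s.cU w + 1 = q w := by
      have h1 := cU_le_link hF hvE
      have h2 := hval.le_cU (u := w) (a := q w - 1)
        (by rw [hF]; simp) fun _ v hv => by have := h.le_x w v hv; omega
      omega
    obtain ⟨s₁, s₂, h1, h2, hρ⟩ := hL.acceptV s h.mem w v₃ h3 (by omega)
    rcases h1 with ⟨h1, -⟩ | ⟨-, v', hv', hx', -, rfl⟩
    · exact absurd hF h1
    have hne : v₃ ≠ v' := by rintro rfl; exact h3 hv'
    rcases h2 with ⟨h2, -⟩ | ⟨-, x₃, hx3, hy3, hw0, rfl⟩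
    · simp only [release, Function.update_of_ne hne] at h2
      exact absurd hG h2
    have hx3 : (x₃, v₃) ∈ s.E := Finset.mem_of_mem_erase hx3
    have hne' : w ≠ x₃ := by rintro rfl; exact h3 hx3
    have hy3 : s.y (x₃, v₃) = s.cV v₃ := hy3
    rw [release_comm hne' hne.symm] at hρ
    set σ := s.release (x₃, v₃) with hσ
    have hσF : σ.F w = 0 := by simp [hσ, release, hne', hF]
    have hσG : σ.G v₃ = {p v₃} := by
      simp only [hσ, release, Function.update_self, hG, hy3, hc]
      rfl
    rw [release_join_eq_reswap hne hσF hx', hc, show s.cU w = q w - 1 by omega] at hρ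
    have hround : Round s q p w v₃ σ.F v₃ σ := by
      refine ⟨rfl, fun _ _ _ _ => ⟨rfl, rfl⟩, fun v hv => h.le_x w v (Finset.mem_of_mem_erase hv),
        fun v hv => h.p_le w v (Finset.mem_of_mem_erase hv),
        fun v hv _ => h.full w v (Finset.mem_of_mem_erase hv), fun v hv _ => ?_, fun t ht => ?_⟩
      · simp [hσ, release, hv]
      · rw [hσG, Multiset.mem_singleton] at ht
        omega
    have h3σ : (w, v₃) ∉ σ.E := fun h1 => h3 (Finset.mem_of_mem_erase h1)
    have hv'σ : (w, v') ∈ σ.E :=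
      Finset.mem_erase.2 ⟨fun h1 => hne' (Prod.mk.inj h1).1, hv'⟩
    have hxσ : σ.x (w, v') = s.cU w := hx'
    have hB := hround.reswap_roundB (A := A) rfl h3σ hw3 hv'σ (by omega) (hval.sat w v' hv') rfl hρ
    have hd1 := dirty_reswap (q := q) (c := p v₃) (xn := q w - 1) (yn := A.w w v₃ - (q w - 1))
      hne hσF hx' h3σ hv'σ
    rw [if_pos (by omega), if_pos (by omega)] at hd1
    have hd2 : σ.dirty q = s.dirty q := sumU_release _ hx3
    obtain ⟨ρ, hρA, hρd, hρx⟩ := hB.finish hL h3σ hw3 hσF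
      fun v hv => hlew v (Finset.mem_of_mem_erase hv)
    obtain ⟨κ, hκ, hτ, hdκ⟩ := hρA.frame_of_displaced hL h hG hx3 (hy3.trans hc) hw0 h3 hF hw3 hρx
    exact ⟨κ, hκ, hτ, by omega⟩
  · have hA : A.RoundA L s q p w v₃ s.F s.E s := by
      refine ⟨⟨rfl, fun _ _ _ _ => ⟨rfl, rfl⟩, h.le_x w, fun v hv => h.p_le w v hv,
        fun v hv _ => h.full w v hv, fun _ _ _ => rfl, fun t ht => ?_⟩, h.mem, rfl, hG⟩
      rw [h.zero v₃ t ht, h.p_zero v₃ hG]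
      omega
    obtain ⟨vs, ρ', hB, hd1⟩ := hA.exists_roundB hL h3 hw3 hF hvE hvx
    obtain ⟨ρ, hρA, hρd, hρx⟩ := hB.finish hL h3 hw3 hF hlew
    obtain ⟨κ, hκ, hτ, hdκ⟩ := hρA.frame_of_free hL h hG h3 hF hw3 hρx
    exact ⟨κ, hκ, hτ, by omega⟩

/-- A frame can be turned into a balanced profile without more free copies: as long as some node
below its bound has too few free copies for the partners that it would gain with, the number of
copies below the bounds can be reduced. -/
theorem Frame.exists_balanced (hL : A.Stuck L) (h : A.Frame L s q p) :
    ∃ s' ∈ L, ∃ q', A.Balanced s' q' ∧ A.tau s' q' s'.cV ≤ A.tau s q p := by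
  induction hn : s.dirty q using Nat.strong_induction_on generalizing s p with
  | _ n ih =>
    by_cases hd : ∀ u, s.IsDirty q u → (A.viol s q u).card ≤ (s.F u).card
    · obtain ⟨q', h1, h2⟩ := h.balanced hL hd
      exact ⟨s, h.mem, q', h1, h2⟩
    · push Not at hd
      obtain ⟨w, hw, hlt⟩ := hd
      obtain ⟨s₁, p₁, h1, hτ, hdec⟩ := h.use_free hL _ rfl hw hlt
      have key : ∃ s₂ p₂, A.Frame L s₂ q p₂ ∧ A.tau s₂ q p₂ ≤ A.tau s q p ∧
          s₂.dirty q < s.dirty q := by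
        rcases hdec with hdec | ⟨hle, hF, hw1, hv1⟩
        · exact ⟨s₁, p₁, h1, hτ, hdec⟩
        · obtain ⟨κ, h2, h3, h4⟩ := h1.raise_full hL hF hw1 hv1
          exact ⟨κ, p₁, h2, h3.trans hτ, h4.trans_le hle⟩
      obtain ⟨s₂, p₂, h2, h3, h4⟩ := key
      obtain ⟨s', hs', q', h5, h6⟩ := ih _ (hn ▸ h4) h2 rfl
      exact ⟨s', hs', q', h5, h6.trans h3⟩

end Market

end ProposalGame

namespace ProposalGame
open Profile

variable {U V : Type*} [DecidableEq U] [DecidableEq V] [Fintype U] [Fintype V]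
variable {A : Market U V} {L : Set (Profile U V)} {s s' σ : Profile U V}
variable {q : U → ℕ} {p : V → ℕ}

/-! ### Displacing a given partner -/

/-- `s'` arises from `s` by links formed with `v` only, each of which increases the aspiration of a
copy of `v` from `p`, such that `v` is linked with `x₀` instead of `xs` in the end. The aspirations
in `U` respect the bounds `ℓ`. -/
structure Profile.Shifted (s : Profile U V) (v : V) (p : ℕ) (ℓ : U → ℕ) (x₀ xs : U)
    (s' : Profile U V) : Prop where
  E_eq : s'.E = insert (x₀, v) (s.E.erase (xs, v))
  x_eq : ∀ u v', v' ≠ v → s'.x (u, v') = s.x (u, v')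
  y_eq : ∀ u v', v' ≠ v → s'.y (u, v') = s.y (u, v')
  G_eq : s'.G = s.G
  le_F : ∀ u, ∀ t ∈ s'.F u, ℓ u ≤ t
  le_x : ∀ u, (u, v) ∈ s'.E → ℓ u ≤ s'.x (u, v)
  p_le : ∀ u, (u, v) ∈ s'.E → p ≤ s'.y (u, v)
  mono : ∀ u, (u, v) ∈ s.E → (u, v) ∈ s'.E → s.y (u, v) ≤ s'.y (u, v)
  F_xs : s'.F xs = s.x (xs, v) ::ₘ s.F xs
  card_F : ∀ u, (s'.F u).card + (if u = x₀ then 1 else 0) =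
    (s.F u).card + if u = xs then 1 else 0
  objective : s.objective + 2 ≤ s'.objective

namespace Market

/-- The tie-breaking player cannot protect a partner of `v` with the least aspiration `p` of `v`:
every link that increases this aspiration makes the number of such partners smaller. -/
theorem Stuck.shift (hL : A.Stuck L) {v : V} {p : ℕ} {ℓ : U → ℕ} {T : U → Prop} {x₀ : U}
    (hs : s ∈ L) (hG : s.G v = 0) (hp : ∀ u, (u, v) ∈ s.E → p ≤ s.y (u, v))
    (hT : ∃ xs, T xs ∧ (xs, v) ∈ s.E ∧ s.y (xs, v) = p) (hx0 : s.F x₀ ≠ 0) (hx0E : (x₀, v) ∉ s.E)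
    (hw0 : ℓ x₀ + p < A.w x₀ v)
    (hw : ∀ u, (u, v) ∈ s.E → s.y (u, v) = p → ¬ T u → ℓ u + p < A.w u v)
    (hF : ∀ u, ∀ t ∈ s.F u, ℓ u ≤ t) (hx : ∀ u, (u, v) ∈ s.E → ℓ u ≤ s.x (u, v)) :
    ∃ s' ∈ L, ∃ xs, T xs ∧ (xs, v) ∈ s.E ∧ s.y (xs, v) = p ∧ s.Shifted v p ℓ x₀ xs s' := by
  classical
  induction hn : (Finset.univ.filter fun u => (u, v) ∈ s.E ∧ s.y (u, v) = p).card
    using Nat.strong_induction_on generalizing s x₀ with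
  | _ n ih =>
    have hcV : s.cV v = p := by
      obtain ⟨xs, -, h1, h2⟩ := hT
      obtain ⟨u, hu, hy⟩ := (hL.valid s hs).exists_link_of_full' hG
      have := cV_le_link hG h1
      have := hp u hu
      omega
    obtain ⟨s₁, hs₁, ho⟩ := hL.give hs hx0 hx0E (by omega)
    have hobj := ho.objective_eq hx0E (cU_mem hx0)
    rw [hcV] at ho hobj
    have hcopy := ho
    have ht := hF x₀ _ (cU_mem hx0)
    set xn := min (s.cU x₀) (A.w x₀ v - p - 1) with hxn
    rcases ho with ⟨h1, -⟩ | ⟨-, x', hne, hx', hyx', -, hs₁eq⟩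
    · exact absurd hG h1
    have hE₁ : s₁.E = insert (x₀, v) (s.E.erase (x', v)) := by rw [hs₁eq]; rfl
    have hG₁ : s₁.G = s.G := by rw [hs₁eq]; rfl
    have hy0 : s₁.y (x₀, v) = A.w x₀ v - xn := by rw [hcopy.y_eq, Function.update_self]
    have hx0n : s₁.x (x₀, v) = xn := by rw [hcopy.x_eq, Function.update_self]
    have hFx' : s₁.F x' = s.x (x', v) ::ₘ s.F x' := by
      rw [hs₁eq]
      simp [swap, hne.symm]
    have hF₁ : ∀ u, ∀ t ∈ s₁.F u, ℓ u ≤ t := by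
      intro u t ht
      rcases hcopy.free ht with h1 | ⟨h1, rfl⟩
      · exact hF u t h1
      · exact hx u h1
    have hx₁ : ∀ u, (u, v) ∈ s₁.E → ℓ u ≤ s₁.x (u, v) := by
      intro u hu
      rcases hcopy.link hu with ⟨rfl, -, h2, -⟩ | ⟨h2, -, h3, -⟩
      · omega
      · rw [h3]
        exact hx u h2
    have hp₁ : ∀ u, (u, v) ∈ s₁.E → p ≤ s₁.y (u, v) := by
      intro u hu
      rcases hcopy.link hu with ⟨rfl, -, -, h2⟩ | ⟨h2, -, -, h3⟩
      · omega
      · rw [h3]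
        exact hp u h2
    have hyne : ∀ u, u ≠ x₀ → s₁.y (u, v) = s.y (u, v) := fun u hu => by
      rw [hcopy.y_eq, Function.update_of_ne (by simp [hu])]
    have hxne : ∀ u, u ≠ x₀ → s₁.x (u, v) = s.x (u, v) := fun u hu => by
      rw [hcopy.x_eq, Function.update_of_ne (by simp [hu])]
    have hcol : ∀ u v', v' ≠ v → s₁.x (u, v') = s.x (u, v') ∧ s₁.y (u, v') = s.y (u, v') := by
      intro u v' hv'
      rw [hcopy.x_eq, hcopy.y_eq, Function.update_of_ne (by simp [hv']),
        Function.update_of_ne (by simp [hv'])]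
      exact ⟨rfl, rfl⟩
    have hcard : ∀ u, (s₁.F u).card + (if u = x₀ then 1 else 0) =
        (s.F u).card + if u = x' then 1 else 0 := by
      intro u
      by_cases hu : u = x₀
      · subst hu
        rw [hcopy.F_self, if_pos rfl, if_neg hne, Multiset.card_erase_add_one (cU_mem hx0),
          add_zero]
      · by_cases hu' : u = x'
        · subst hu'
          rw [hFx', if_neg hu, if_pos rfl, Multiset.card_cons]
        · rw [hs₁eq]
          simp [swap, hu, hu']
    by_cases hTx : T x'
    · refine ⟨s₁, hs₁, x', hTx, hx', hyx', ⟨hE₁, fun u v' hv' => (hcol u v' hv').1,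
        fun u v' hv' => (hcol u v' hv').2, hG₁, hF₁, hx₁, hp₁, fun u h1 h2 => ?_, hFx', hcard, ?_⟩⟩
      · rw [hyne u (by rintro rfl; exact hx0E h1)]
      · omega
    · have hmemE : ∀ u, (u, v) ∈ s.E → u ≠ x' → (u, v) ∈ s₁.E := by
        intro u h1 h2
        rw [hE₁]
        exact Finset.mem_insert_of_mem (Finset.mem_erase.2 ⟨by simp [h2], h1⟩)
      have hx'E : (x', v) ∉ s₁.E := by
        rw [hE₁]
        simp [hne.symm]
      have hplain : ∀ u, (u, v) ∈ s₁.E → s₁.y (u, v) = p →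
          u ≠ x₀ ∧ u ≠ x' ∧ (u, v) ∈ s.E ∧ s.y (u, v) = p := by
        intro u h1 h2
        have hu : u ≠ x₀ := by
          rintro rfl
          omega
        have hu' : u ≠ x' := by
          rintro rfl
          exact hx'E h1
        refine ⟨hu, hu', ?_, (hyne u hu).symm.trans h2⟩
        rw [hE₁] at h1
        exact Finset.mem_of_mem_erase ((Finset.mem_insert.1 h1).resolve_left (by simp [hu]))
      have key := ih (s := s₁) (x₀ := x') _ ?_ hs₁ (hG₁ ▸ hG) hp₁ ?_ ?_ hx'E (hw x' hx' hyx' hTx)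
        ?_ hF₁ hx₁ rfl
      · obtain ⟨s', hs', xs, hTs, hxs, hys, hsh⟩ := key
        obtain ⟨hxs0, hxs', hxsE, hxsy⟩ := hplain xs hxs hys
        refine ⟨s', hs', xs, hTs, hxsE, hxsy, ⟨?_, fun u v' hv' => ?_, fun u v' hv' => ?_,
          hsh.G_eq.trans hG₁, hsh.le_F, hsh.le_x, hsh.p_le, fun u h1 h2 => ?_, ?_, fun u => ?_,
          ?_⟩⟩
        · rw [hsh.E_eq, hE₁]
          ext e
          simp only [Finset.mem_insert, Finset.mem_erase]
          have h4 : (x', v) ≠ (xs, v) := by simpa using hxs'.symm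
          have h5 : (x₀, v) ≠ (xs, v) := by simpa using hxs0.symm
          by_cases he1 : e = (x', v)
          · subst he1
            simp [hx', h4]
          · by_cases he2 : e = (x₀, v)
            · subst he2
              simp [h5]
            · simp [he1, he2]
        · rw [hsh.x_eq u v' hv', (hcol u v' hv').1]
        · rw [hsh.y_eq u v' hv', (hcol u v' hv').2]
        · by_cases hu' : u = x'
          · subst hu'
            rw [hyx']
            exact hsh.p_le u h2
          · rw [← hyne u (by rintro rfl; exact hx0E h1)]
            exact hsh.mono u (hmemE u h1 hu') h2
        · rw [hsh.F_xs, hxne xs hxs0, hs₁eq]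
          simp [swap, hxs0, hxs']
        · have h1 := hsh.card_F u
          have h2 := hcard u
          omega
        · have := hsh.objective
          omega
      · rw [← hn]
        refine Finset.card_lt_card (Finset.ssubset_iff_of_subset ?_ |>.2 ⟨x', ?_, ?_⟩)
        · intro u hu
          rw [Finset.mem_filter] at hu ⊢
          exact ⟨hu.1, (hplain u hu.2.1 hu.2.2).2.2⟩
        · simp [hx', hyx']
        · simp [hx'E]
      · obtain ⟨xs, hTs, hxs, hys⟩ := hT
        have h1 : xs ≠ x' := by rintro rfl; exact hTx hTs
        have h2 : xs ≠ x₀ := by rintro rfl; exact hx0E hxs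
        exact ⟨xs, hTs, hmemE xs hxs h1, (hyne xs h2).trans hys⟩
      · rw [hFx']
        exact Multiset.cons_ne_zero
      · intro u h1 h2 h3
        obtain ⟨-, -, h4, h5⟩ := hplain u h1 h2
        exact hw u h4 h5 h3

/-! ### Alternating paths -/

/-- The unlinked pair of `u` and `v` gains as soon as `u` goes below its bound `q u`. -/
def Tight (A : Market U V) (s : Profile U V) (q : U → ℕ) (p : V → ℕ) (u : U) (v : V) : Prop :=
  (u, v) ∉ s.E ∧ A.w u v = q u + p v ∧ s.cV v = p v

/-- An alternating path of `n` links leads from `v` to a node of `V` with a free copy or to a link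
of which `V` has the whole weight. All links on the path have their least possible aspirations. -/
def Reach (A : Market U V) (s : Profile U V) (q : U → ℕ) (p : V → ℕ) : ℕ → V → Prop
  | 0, v => s.G v ≠ 0 ∨ ∃ x, (x, v) ∈ s.E ∧ s.y (x, v) = p v ∧ A.w x v = p v
  | n + 1, v => ∃ x, (x, v) ∈ s.E ∧ s.y (x, v) = p v ∧ A.w x v = q x + p v ∧
      ∃ v', A.Tight s q p x v' ∧ Reach A s q p n v'

theorem Reach.persist {v : V} (hE : ∀ u v', v' ≠ v → ((u, v') ∈ s'.E ↔ (u, v') ∈ s.E))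
    (hy : ∀ u v', v' ≠ v → s'.y (u, v') = s.y (u, v')) (hG : s'.G = s.G) (m : ℕ)
    (hv : ∀ k ≤ m, ¬ A.Reach s q p k v) {v' : V} (hne : v' ≠ v) (h : A.Reach s q p m v') :
    A.Reach s' q p m v' := by
  induction m generalizing v' with
  | zero =>
    rcases h with h | ⟨x, h1, h2, h3⟩
    · exact Or.inl (hG ▸ h)
    · exact Or.inr ⟨x, (hE x v' hne).2 h1, (hy x v' hne).trans h2, h3⟩
  | succ m ih =>
    obtain ⟨x, h1, h2, h3, v'', h4, h5⟩ := h
    have hne' : v'' ≠ v := by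
      rintro rfl
      exact hv m (Nat.le_succ m) h5
    refine ⟨x, (hE x v' hne).2 h1, (hy x v' hne).trans h2, h3, v'', ⟨?_, h4.2.1, ?_⟩,
      ih (fun k hk => hv k (hk.trans (Nat.le_succ m))) hne' h5⟩
    · rw [hE x v'' hne']
      exact h4.1
    · rw [← h4.2.2]
      exact cV_congr (by rw [hG]) (fun u => hE u v'' hne') fun u _ => hy u v'' hne'

theorem tau_eq_of_bad (hb : ∀ u, A.bad s.E q p u = ∅) :
    A.tau s q p = ∑ u, if q u = 0 then 0 else (s.F u).card := by
  unfold tau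
  simp only [hb, Finset.card_empty]

theorem Frame.shifted (h : A.Frame L s q p) (hb : ∀ u, A.bad s.E q p u = ∅)
    {v : V} (hG : s.G v = 0) {x₀ xs : U} (hs' : s' ∈ L)
    (hsh : s.Shifted v (p v) (fun u => q u - 1) x₀ xs s') (hx0 : q x₀ + p v ≤ A.w x₀ v)
    (hxs : A.w xs v ≤ q xs + p v) :
    A.Frame L s' q p ∧ ∀ u, A.bad s'.E q p u = ∅ := by
  have hlink : ∀ u v', (u, v') ∈ s'.E → (u, v') ∈ s.E ∨ (u = x₀ ∧ v' = v) := by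
    intro u v' hu
    rw [hsh.E_eq, Finset.mem_insert, Finset.mem_erase] at hu
    rcases hu with hu | hu
    · exact Or.inr (Prod.mk.inj hu)
    · exact Or.inl hu.2
  have hb' : ∀ u, A.bad s'.E q p u = ∅ := by
    intro u
    refine Finset.eq_empty_of_forall_notMem fun v' hv' => ?_
    rw [mem_bad] at hv'
    by_cases he : (u, v') ∈ s.E
    · have : (u, v') = (xs, v) := by
        by_contra hne
        exact hv'.1 (hsh.E_eq ▸ Finset.mem_insert_of_mem (Finset.mem_erase.2 ⟨hne, he⟩))
      obtain ⟨rfl, rfl⟩ := Prod.mk.inj this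
      omega
    · have : v' ∈ A.bad s.E q p u := mem_bad.2 ⟨he, hv'.2⟩
      rw [hb u] at this
      simp at this
  refine ⟨⟨hs', ?_, fun u v' hu => ?_, ?_, fun u v' hu => ?_, fun u => ?_, fun u v' hu => ?_,
    fun u t ht => ?_, fun u v' hu hlt => ?_⟩, hb'⟩
  · rw [hsh.G_eq]
    exact h.zero
  · by_cases hv : v' = v
    · subst hv
      exact hsh.p_le u hu
    · rw [hsh.y_eq u v' hv]
      exact h.p_le u v' ((hlink u v' hu).resolve_right fun h => hv h.2)
  · rw [hsh.G_eq]
    exact h.p_zero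
  · rcases hlink u v' hu with h1 | ⟨rfl, rfl⟩
    · exact h.le_w u v' h1
    · exact hx0
  · rw [hb' u]
    simp
  · by_cases hv : v' = v
    · subst hv
      have : q u - 1 ≤ s'.x (u, v') := hsh.le_x u hu
      omega
    · rw [hsh.x_eq u v' hv]
      exact h.le_x u v' ((hlink u v' hu).resolve_right fun h => hv h.2)
  · have : q u - 1 ≤ t := hsh.le_F u t ht
    omega
  · rw [hsh.G_eq]
    by_cases hv : v' = v
    · subst hv
      exact hG
    · rw [hsh.x_eq u v' hv] at hlt
      exact h.full u v' ((hlink u v' hu).resolve_right fun h => hv h.2) hlt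

/-- If the number of free copies is minimal, then no alternating path starts at a node with a
positive bound that has a free copy. -/
theorem Frame.not_reach (hL : A.Stuck L) {τ : ℕ}
    (hτ : ∀ s' ∈ L, ∀ q', A.Balanced s' q' → τ ≤ A.tau s' q' s'.cV) (n : ℕ) {u : U} {v : V}
    (h : A.Frame L s q p) (hb : ∀ u, A.bad s.E q p u = ∅) (hs : A.tau s q p ≤ τ) (hq : q u ≠ 0)
    (hF : s.F u ≠ 0) (ht : A.Tight s q p u v) : ¬ A.Reach s q p n v := by
  have hcontra : ∀ s', A.Frame L s' q p → ¬ A.tau s' q p < τ := by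
    intro s' hs' hlt
    obtain ⟨s'', h1, q', h2, h3⟩ := hs'.exists_balanced hL
    have := hτ s'' h1 q' h2
    omega
  induction n using Nat.strong_induction_on generalizing s u v with
  | _ n ih =>
    intro hr
    by_cases hm : ∃ m < n, A.Reach s q p m v
    · obtain ⟨m, hm, hr⟩ := hm
      exact ih m hm h hb hs hq hF ht hr
    push Not at hm
    obtain ⟨huv, hw, hc⟩ := ht
    by_cases hG : s.G v = 0
    swap
    · -- the node `u` can take the free copy of `v`
      obtain ⟨s', hs', ho⟩ := hL.take h.mem hF huv (by omega)
      refine hcontra s' (h.of_take hs' ho hF huv hq (by omega) (h.p_le_cV hL v) ?_)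
        ((ho.tau_lt (cU_mem hF) hq hG).trans_le hs)
      intro hne
      rw [hb u] at hne
      simp at hne
    have hF1 : ∀ u, ∀ t ∈ s.F u, q u - 1 ≤ t := fun u t ht => by
      have := h.le_F u t ht
      omega
    have hx1 : ∀ u, (u, v) ∈ s.E → q u - 1 ≤ s.x (u, v) := fun u hu => by
      have := h.le_x u v hu
      omega
    have htau : ∀ s' xs, A.Frame L s' q p → (∀ u, A.bad s'.E q p u = ∅) →
        s.Shifted v (p v) (fun u => q u - 1) u xs s' → A.tau s' q p ≤ A.tau s q p ∧
        (q xs = 0 → A.tau s' q p < A.tau s q p) := by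
      intro s' xs h1 h2 hsh
      rw [tau_eq_of_bad hb, tau_eq_of_bad h2]
      have hne : xs ≠ u := by
        rintro rfl
        have h3 := hsh.card_F xs
        have h4 := hsh.F_xs
        rw [if_pos rfl, h4, Multiset.card_cons] at h3
        omega
      have h5 := hsh.card_F u
      rw [if_pos rfl, if_neg hne.symm] at h5
      constructor
      · refine sum_le_of_shift (u := u) (u' := xs) ?_ ?_ fun a h3 h4 => ?_
        · rw [if_neg hq, if_neg hq]
          omega
        · have := hsh.card_F xs
          rw [if_neg hne, if_pos rfl] at this
          split_ifs <;> omega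
        · have := hsh.card_F a
          rw [if_neg h3, if_neg h4] at this
          split_ifs <;> omega
      · intro h0
        refine Finset.sum_lt_sum (fun a _ => ?_) ⟨u, Finset.mem_univ u, ?_⟩
        · by_cases h4 : a = xs
          · subst h4
            simp [h0]
          · have := hsh.card_F a
            rw [if_neg h4] at this
            split_ifs at this ⊢ <;> omega
        · rw [if_neg hq, if_neg hq]
          omega
    cases n with
    | zero =>
      rcases hr with hr | ⟨z, hz1, hz2, hz3⟩
      · exact hr hG
      · -- the displaced node has the bound zero, so that its free copies do not count
        obtain ⟨s', hs', xs, hT, hxs1, hxs2, hsh⟩ := hL.shift (ℓ := fun u => q u - 1)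
          (T := fun z => A.w z v = p v) h.mem hG (fun u hu => h.p_le u v hu) ⟨z, hz3, hz1, hz2⟩
          hF huv (by omega) (fun a h1 h2 h3 => by
            have := h.le_w a v h1
            omega) hF1 hx1
        have hle := h.le_w xs v hxs1
        have hq0 : q xs = 0 := by omega
        obtain ⟨h1, h2⟩ := h.shifted hb hG hs' hsh (by omega) (by omega)
        exact hcontra s' h1 (((htau s' xs h1 h2 hsh).2 hq0).trans_le hs)
    | succ n =>
      -- displacing the first node of the path gives it a free copy and makes the path shorter
      obtain ⟨x, hx, hyx, hwx, v', ht', hr'⟩ := hr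
      have hno0 := hm 0 (Nat.succ_pos n)
      have hplain : ∀ a, (a, v) ∈ s.E → s.y (a, v) = p v → A.w a v ≠ p v :=
        fun a h1 h2 h3 => hno0 (Or.inr ⟨a, h1, h2, h3⟩)
      obtain ⟨s', hs', xs, rfl, hxs1, hxs2, hsh⟩ := hL.shift (ℓ := fun u => q u - 1)
        (T := fun z => z = x) h.mem hG (fun u hu => h.p_le u v hu) ⟨x, rfl, hx, hyx⟩
        hF huv (by omega) (fun a h1 h2 _ => by
          have := h.le_w a v h1
          have := hplain a h1 h2
          omega) hF1 hx1
      have hne : v' ≠ v := by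
        rintro rfl
        exact ht'.1 hx
      obtain ⟨h1, h2⟩ := h.shifted hb hG hs' hsh (by omega) (by omega)
      have hE' : ∀ a v'', v'' ≠ v → ((a, v'') ∈ s'.E ↔ (a, v'') ∈ s.E) := by
        intro a v'' hv''
        rw [hsh.E_eq]
        simp [hv'']
      have hq' : q xs ≠ 0 := by
        intro h0
        have := hplain xs hx hyx
        omega
      refine ih n (Nat.lt_succ_self n) h1 h2 ((htau s' xs h1 h2 hsh).1.trans hs) hq'
        (by rw [hsh.F_xs]; exact Multiset.cons_ne_zero) ⟨?_, ht'.2.1, ?_⟩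
        (Reach.persist hE' hsh.y_eq hsh.G_eq n (fun k hk => hm k (Nat.lt_succ_of_le hk)) hne hr')
      · rw [hE' xs v' hne]
        exact ht'.1
      · rw [← ht'.2.2]
        exact cV_congr (by rw [hsh.G_eq]) (fun a => hE' a v' hne) fun a _ => hsh.y_eq a v' hne

end Market

end ProposalGame

namespace ProposalGame
open Profile

variable {U V : Type*} [DecidableEq U] [DecidableEq V] [Fintype U] [Fintype V]
variable {A : Market U V} {L : Set (Profile U V)} {s s' σ : Profile U V}
variable {q : U → ℕ}

/-! ### Increasing the objective of an optimal profile -/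

namespace Market

/-- No alternating path starts at `v`. -/
def Safe (A : Market U V) (s : Profile U V) (q : U → ℕ) (v : V) : Prop :=
  ∀ n, ¬ A.Reach s q s.cV n v

/-- No alternating path starts at a tight partner of `u`. -/
def Tame (A : Market U V) (s : Profile U V) (q : U → ℕ) (u : U) : Prop :=
  ∀ v, A.Tight s q s.cV u v → A.Safe s q v

open Classical in
/-- The aspirations of a tame node may go below its bound by one. -/
noncomputable def floor (A : Market U V) (s : Profile U V) (q : U → ℕ) (u : U) : ℕ :=
  if A.Tame s q u then q u - 1 else q u

/-- The profile `σ` has the links of `s`, and the aspirations in `V` are not smaller than in `s`.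
The aspirations of a tame node of `U` may be one below its bound, on links with safe nodes. -/
structure InPlace (A : Market U V) (L : Set (Profile U V)) (s : Profile U V) (q : U → ℕ)
    (σ : Profile U V) : Prop where
  mem : σ ∈ L
  E_eq : σ.E = s.E
  zero : ∀ v, ∀ t ∈ σ.G v, t = 0
  mono : ∀ u v, (u, v) ∈ s.E → s.y (u, v) ≤ σ.y (u, v)
  le_x : ∀ u v, (u, v) ∈ s.E → A.floor s q u ≤ σ.x (u, v)
  le_F : ∀ u, ∀ t ∈ σ.F u, A.floor s q u ≤ t
  safe : ∀ u v, (u, v) ∈ s.E → σ.x (u, v) < q u → A.Safe s q v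

theorem floor_le (u : U) : A.floor s q u ≤ q u := by
  unfold floor
  split_ifs <;> omega

theorem le_floor (u : U) : q u ≤ A.floor s q u + 1 := by
  unfold floor
  split_ifs <;> omega

theorem floor_of_tame {u : U} (h : A.Tame s q u) : A.floor s q u = q u - 1 := if_pos h

theorem tame_of_floor_lt {u : U} (h : A.floor s q u < q u) : A.Tame s q u := by
  by_contra hn
  rw [floor, if_neg hn] at h
  exact lt_irrefl _ h

theorem Safe.G_eq_zero {v : V} (h : A.Safe s q v) : s.G v = 0 := by
  by_contra hG
  exact h 0 (Or.inl hG)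

/-- A partner of a safe node with the least aspiration is tame, or the weight exceeds the bounds. -/
theorem Safe.floor_add_lt {v : V} (h : A.Safe s q v) {u : U} (hu : (u, v) ∈ s.E)
    (hy : s.y (u, v) = s.cV v) (hle : q u + s.cV v ≤ A.w u v) :
    A.floor s q u + s.cV v < A.w u v := by
  have h0 : A.w u v ≠ s.cV v := fun h1 => h 0 (Or.inr ⟨u, hu, hy, h1⟩)
  by_cases hex : A.w u v = q u + s.cV v
  · have : A.Tame s q u := fun v' hv' n hr => h (n + 1) ⟨u, hu, hy, hex, v', hv', hr⟩
    rw [floor_of_tame this]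
    omega
  · have := floor_le (A := A) (s := s) (q := q) u
    omega

theorem Valid.G_eq_zero (hs : A.Valid s) (hs' : A.Valid s') (h : s'.E = s.E) {v : V}
    (hG : s.G v = 0) : s'.G v = 0 := by
  have h1 := hs.cardG v
  have h2 := hs'.cardG v
  rw [h] at h2
  rw [hG, Multiset.card_zero] at h1
  exact Multiset.card_eq_zero.1 (by omega)

/-- The considered aspirations in `V` serve as the bounds `p` of the frame. -/
theorem Optimal.frame (hL : A.Stuck L) (ho : A.Optimal L s q) : A.Frame L s q s.cV :=
  ho.balanced.frame hL ho.mem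

theorem InPlace.frame (hL : A.Stuck L) (ho : A.Optimal L s q) (h : A.InPlace L s q σ) :
    A.Frame L σ q s.cV ∧ A.tau σ q s.cV ≤ A.tau s q s.cV := by
  have hfr := ho.frame hL
  refine hfr.of_links_eq hL h.mem h.E_eq h.zero
    (fun v hv => (hL.valid s ho.mem).G_eq_zero (hL.valid σ h.mem) h.E_eq hv)
    (fun u v huv => (hfr.p_le u v huv).trans (h.mono u v huv)) (fun u v huv => ?_)
    (fun u v huv hlt => (h.safe u v huv hlt).G_eq_zero) fun u t ht => ?_
  · have := h.le_x u v huv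
    have := le_floor (A := A) (s := s) (q := q) u
    omega
  · have := h.le_F u t ht
    have := le_floor (A := A) (s := s) (q := q) u
    omega

theorem objective_lowerG {v : V} {h : ℕ} (hh : h ∈ s.G v) (h0 : 0 < h) :
    (s.lowerG v h).objective = s.objective - 2 := by
  have h1 := sumV_lowerG (fun _ t => t) hh
  have h2 : (s.lowerG v h).sumU (fun _ t => t) = s.sumU (fun _ t => t) := rfl
  unfold Profile.objective
  omega

theorem objective_release {e : U × V} (he : e ∈ s.E) :
    (s.release e).objective = s.objective := by
  unfold Profile.objective
  rw [sumU_release _ he, sumV_release _ he]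

/-- The situation of a node `z` with an aspiration below its bound, for which `v` is a violator. -/
structure Violation (A : Market U V) (L : Set (Profile U V)) (s : Profile U V) (q : U → ℕ)
    (σ : Profile U V) (z : U) (v : V) : Prop where
  inPlace : A.InPlace L s q σ
  tame : A.Tame s q z
  safe : A.Safe s q v
  notMem : (z, v) ∉ s.E
  pos : q z ≠ 0
  w_eq : A.w z v = q z + s.cV v
  cV_eq : σ.cV v = s.cV v

/-- After `z` has been linked with `v` at the bound `q z`, which displaces the node `x'`, it can be
displaced from `v` by `x'` again. -/
theorem Violation.return (hL : A.Stuck L) (ho : A.Optimal L s q) {z : U} {v : V}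
    (h : A.Violation L s q σ z v) {κ : Profile U V} {x' : U} (hκ : κ ∈ L)
    (hx' : (x', v) ∈ s.E) (hyx' : σ.y (x', v) = s.cV v)
    (hEv : ∀ u, (u, v) ∈ κ.E ↔ u = z ∨ (u ≠ x' ∧ (u, v) ∈ s.E))
    (hG : κ.G v = 0) (hxz : κ.x (z, v) = q z) (hyz : κ.y (z, v) = s.cV v)
    (hx : ∀ u, u ≠ z → κ.x (u, v) = σ.x (u, v)) (hy : ∀ u, u ≠ z → κ.y (u, v) = σ.y (u, v))
    (hF : ∀ u, ∀ t ∈ κ.F u, A.floor s q u ≤ t) (hFx' : κ.F x' ≠ 0) :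
    ∃ s' ∈ L, κ.Shifted v (s.cV v) (A.floor s q) x' z s' ∧
      (∀ u, (u, v) ∈ s'.E ↔ (u, v) ∈ s.E) ∧
      ∀ u, (u, v) ∈ s.E → s.y (u, v) ≤ s'.y (u, v) := by
  have hfr := ho.frame hL
  have hne : x' ≠ z := by rintro rfl; exact h.notMem hx'
  have hplain : ∀ u, (u, v) ∈ s.E → σ.y (u, v) = s.cV v →
      A.floor s q u + s.cV v < A.w u v := by
    intro u hu hy
    have h1 := h.inPlace.mono u v hu
    have h2 := hfr.p_le u v hu
    exact h.safe.floor_add_lt hu (by omega) (hfr.le_w u v hu)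
  have hfl := floor_of_tame h.tame
  have key := hL.shift (s := κ) (v := v) (p := s.cV v)
    (ℓ := A.floor s q) (T := fun u => u = z) (x₀ := x') hκ hG ?_ ?_ hFx' ?_ (hplain x' hx' hyx')
    ?_ hF ?_
  · obtain ⟨s', hs', xs, rfl, -, -, hsh⟩ := key
    have hcol : ∀ u, (u, v) ∈ s'.E ↔ (u, v) ∈ s.E := by
      intro u
      rw [hsh.E_eq, Finset.mem_insert, Finset.mem_erase, hEv]
      by_cases h1 : u = x'
      · subst h1
        simp [hx']
      · by_cases h2 : u = xs
        · subst h2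
          simp [h1, h.notMem]
        · simp [h1, h2]
    refine ⟨s', hs', hsh, hcol, fun u hu => ?_⟩
    have h0 := h.inPlace.mono u v hu
    by_cases h1 : u = x'
    · subst h1
      exact (h0.trans hyx'.le).trans (hsh.p_le u ((hcol u).2 hu))
    · have h2 : u ≠ xs := by rintro rfl; exact h.notMem hu
      rw [← hy u h2] at h0
      exact h0.trans (hsh.mono u ((hEv u).2 (Or.inr ⟨h1, hu⟩)) ((hcol u).2 hu))
  · intro u hu
    rcases (hEv u).1 hu with rfl | ⟨-, h2⟩
    · exact hyz.ge
    · have hu' : u ≠ z := by rintro rfl; exact h.notMem h2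
      rw [hy u hu']
      exact (hfr.p_le u v h2).trans (h.inPlace.mono u v h2)
  · exact ⟨z, rfl, (hEv z).2 (Or.inl rfl), hyz⟩
  · intro h1
    rcases (hEv x').1 h1 with h2 | ⟨h2, -⟩
    · exact hne h2
    · exact h2 rfl
  · intro u h1 h2 h3
    rcases (hEv u).1 h1 with h4 | ⟨-, h4⟩
    · exact absurd h4 h3
    · exact hplain u h4 ((hy u h3).symm.trans h2)
  · intro u hu
    rcases (hEv u).1 hu with rfl | ⟨-, h2⟩
    · rw [hxz]
      exact floor_le u
    · have hu' : u ≠ z := by rintro rfl; exact h.notMem h2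
      rw [hx u hu']
      exact h.inPlace.le_x u v h2

/-- The node `z` links a free copy with `v` at the bound and is displaced again, after which the
links are those of `s`. Raising the copy to the bound costs one unit of the objective at most, and
the gain of `v` adds at least two. -/
theorem Violation.improve_of_free (hL : A.Stuck L) (ho : A.Optimal L s q) {z : U} {v : V}
    (h : A.Violation L s q σ z v) (hF : σ.F z ≠ 0) :
    ∃ σ', A.InPlace L s q σ' ∧ σ.objective < σ'.objective := by
  have hin := h.inPlace
  have hE := hin.E_eq
  have hz := h.pos
  have hw := h.w_eq
  have hc := h.cV_eq
  have hzE : (z, v) ∉ σ.E := hE ▸ h.notMem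
  have hG : σ.G v = 0 :=
    (hL.valid s ho.mem).G_eq_zero (hL.valid σ hin.mem) hE h.safe.G_eq_zero
  obtain ⟨κ, hκ, hout⟩ := hL.take hin.mem hF hzE (by omega)
  have hobj := hout.objective_eq hzE (cU_mem hF)
  have ht := hin.le_F z _ (cU_mem hF)
  rw [floor_of_tame h.tame] at ht
  rcases id hout with ⟨h1, -⟩ | ⟨-, x', hne, hx', hyx', -, hκeq⟩
  · exact absurd hG h1
  have hx's : (x', v) ∈ s.E := hE ▸ hx'
  have hκE : κ.E = insert (z, v) (s.E.erase (x', v)) := by rw [hκeq, ← hE]; rfl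
  have hκG : κ.G = σ.G := by rw [hκeq]; rfl
  have hκF : ∀ u, ∀ t ∈ κ.F u, A.floor s q u ≤ t := by
    intro u t ht
    rcases hout.free ht with h1 | ⟨h1, rfl⟩
    · exact hin.le_F u t h1
    · exact hin.le_x u v (hE ▸ h1)
  obtain ⟨s', hs', hsh, hcol, hmono⟩ := h.return hL ho (x' := x') hκ hx's (hyx'.trans hc)
    (fun u => by rw [hκE]; simp) (hκG ▸ hG)
    (by rw [hout.x_eq, Function.update_self]; omega)
    (by rw [hout.y_eq, Function.update_self]; omega)
    (fun u hu => by rw [hout.x_eq, Function.update_of_ne (by simp [hu])])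
    (fun u hu => by rw [hout.y_eq, Function.update_of_ne (by simp [hu])]) hκF
    (by rw [hκeq]; simp [swap, hne.symm])
  have hother : ∀ u v', v' ≠ v → s'.x (u, v') = σ.x (u, v') ∧ s'.y (u, v') = σ.y (u, v') := by
    intro u v' hv
    rw [hsh.x_eq u v' hv, hsh.y_eq u v' hv, hout.x_eq, hout.y_eq,
      Function.update_of_ne (by simp [hv]), Function.update_of_ne (by simp [hv])]
    exact ⟨rfl, rfl⟩
  refine ⟨s', ⟨hs', ?_, ?_, fun u v' hu => ?_, fun u v' hu => ?_, hsh.le_F,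
    fun u v' hu hlt => ?_⟩, ?_⟩
  · ext ⟨u, v'⟩
    by_cases hv : v' = v
    · subst hv
      exact hcol u
    · rw [hsh.E_eq, hκE]
      simp [hv]
  · rw [hsh.G_eq, hκG]
    exact hin.zero
  · by_cases hv : v' = v
    · subst hv
      exact hmono u hu
    · rw [(hother u v' hv).2]
      exact hin.mono u v' hu
  · by_cases hv : v' = v
    · subst hv
      exact hsh.le_x u ((hcol u).2 hu)
    · rw [(hother u v' hv).1]
      exact hin.le_x u v' hu
  · by_cases hv : v' = v
    · subst hv
      exact h.safe
    · rw [(hother u v' hv).1] at hlt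
      exact hin.safe u v' hu hlt
  · have := hsh.objective
    omega

/-- Without a free copy, `z` leaves another partner `v''` for `v`. When it has been displaced from
`v`, it is won back by `v''`. -/
theorem Violation.improve_of_full (hL : A.Stuck L) (ho : A.Optimal L s q) {z : U} {v : V}
    (h : A.Violation L s q σ z v) (hF : σ.F z = 0) (hd : σ.IsDirty q z) :
    ∃ σ', A.InPlace L s q σ' ∧ σ.objective < σ'.objective := by
  have hin := h.inPlace
  have hE := hin.E_eq
  have hz := h.pos
  have hw := h.w_eq
  have hc := h.cV_eq
  have hfl := floor_of_tame h.tame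
  have hval := hL.valid σ hin.mem
  have hvals := hL.valid s ho.mem
  have hzE : (z, v) ∉ σ.E := hE ▸ h.notMem
  have hG : σ.G v = 0 := hvals.G_eq_zero hval hE h.safe.G_eq_zero
  have hcU : σ.cU z + 1 = q z := by
    rcases hd with ⟨t, ht, -⟩ | ⟨v₁, hv₁, hx₁⟩
    · rw [hF] at ht
      simp at ht
    · have h1 := cU_le_link hF hv₁
      have h2 := hval.le_cU (u := z) (a := q z - 1) (by rw [hF]; simp)
        fun _ v hv => hfl ▸ hin.le_x z v (hE ▸ hv)
      omega
  -- `z` gives up its link with `v''` and joins `v` at the bound, which displaces `x'`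
  obtain ⟨s₁, s₂, h1, h2, hκ⟩ := hL.acceptU σ hin.mem z v hzE (by omega)
  rcases h1 with ⟨h1, -⟩ | ⟨-, v'', hv'', hx'', -, rfl⟩
  · exact absurd hF h1
  have hvne : v'' ≠ v := by rintro rfl; exact hzE hv''
  have hv''s : (z, v'') ∈ s.E := hE ▸ hv''
  have hsafe'' : A.Safe s q v'' := hin.safe z v'' hv''s (by omega)
  have hG'' : σ.G v'' = 0 := hvals.G_eq_zero hval hE hsafe''.G_eq_zero
  have hsat'' := hval.sat z v'' hv''
  set σ₁ := σ.release (z, v'') with hσ₁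
  have hzE₁ : (z, v) ∉ σ₁.E := fun h1 => hzE (Finset.mem_of_mem_erase h1)
  have hG₁ : σ₁.G v = 0 := by
    rw [← hG]
    simp [hσ₁, release, hvne.symm]
  have hFz₁ : σ₁.F z = {σ.cU z} := by
    simp only [hσ₁, release, Function.update_self, hF, hx'']
    rfl
  have hcV₁ : σ₁.cV v = σ.cV v := cV_congr (by rw [hG₁, hG])
    (fun u => by simp [hσ₁, release, hvne.symm]) fun u _ => rfl
  set κ := s₂.join (z, v) (σ.cU z) (σ.cV v) (A.w z v - σ.cV v) (σ.cV v) with hκdef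
  have hout : A.Outcome σ₁ z v (σ.cU z) (σ₁.cV v) (A.w z v - σ.cV v) (σ.cV v) κ := by
    rw [hcV₁]
    exact h2.outcome hzE₁
  have hobj := hout.objective_eq hzE₁ (by rw [hFz₁]; simp)
  rw [objective_release hv''] at hobj
  rcases id hout with ⟨h1, -⟩ | ⟨-, x', hne, hx', hyx', -, hκeq⟩
  · exact absurd hG₁ h1
  have hx's : (x', v) ∈ s.E := hE ▸ Finset.mem_of_mem_erase hx'
  have hκE : κ.E = insert (z, v) ((s.E.erase (z, v'')).erase (x', v)) := by
    rw [hκeq, ← hE]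
    rfl
  have hκG : κ.G = σ₁.G := by rw [hκeq]; rfl
  have hF₁ : ∀ u, ∀ t ∈ σ₁.F u, A.floor s q u ≤ t := by
    intro u t ht
    by_cases hu : u = z
    · subst hu
      rw [hFz₁, Multiset.mem_singleton] at ht
      omega
    · simp only [hσ₁, release, Function.update_of_ne hu] at ht
      exact hin.le_F u t ht
  have hκF : ∀ u, ∀ t ∈ κ.F u, A.floor s q u ≤ t := by
    intro u t ht
    rcases hout.free ht with h1 | ⟨h1, rfl⟩
    · exact hF₁ u t h1
    · exact hin.le_x u v (hE ▸ Finset.mem_of_mem_erase h1)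
  have hκFz : κ.F z = 0 := by
    rw [hout.F_self, hFz₁]
    simp
  have hκx : κ.x (z, v) = q z := by rw [hout.x_eq, Function.update_self]; omega
  obtain ⟨κ', hκ', hsh, hcol, hmono⟩ := h.return hL ho (x' := x') hκ hx's
    ((show σ.y (x', v) = σ₁.cV v from hyx').trans (hcV₁.trans hc))
    (fun u => by rw [hκE]; simp [hvne.symm]) (hκG ▸ hG₁) hκx
    (by rw [hout.y_eq, Function.update_self]; omega)
    (fun u hu => by rw [hout.x_eq, Function.update_of_ne (by simp [hu])]; rfl)
    (fun u hu => by rw [hout.y_eq, Function.update_of_ne (by simp [hu])]; rfl) hκF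
    (by rw [hκeq]; simp [swap, hne.symm])
  have hother : ∀ u v', v' ≠ v → κ'.x (u, v') = σ.x (u, v') ∧ κ'.y (u, v') = σ.y (u, v') := by
    intro u v' hv
    rw [hsh.x_eq u v' hv, hsh.y_eq u v' hv, hout.x_eq, hout.y_eq,
      Function.update_of_ne (by simp [hv]), Function.update_of_ne (by simp [hv])]
    exact ⟨rfl, rfl⟩
  have hκ'E : κ'.E = s.E.erase (z, v'') := by
    ext ⟨u, v'⟩
    by_cases hv : v' = v
    · subst hv
      rw [hcol u]
      simp [hvne.symm]
    · rw [hsh.E_eq, hκE]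
      simp [hv]
  have hκ'F : κ'.F z = {q z} := by
    rw [hsh.F_xs, hκFz, hκx]
    rfl
  have hκ'G : κ'.G v'' = {A.w z v'' + 1 - q z} := by
    rw [hsh.G_eq, hκG]
    simp only [hσ₁, release, Function.update_self, hG'']
    rw [show σ.y (z, v'') = A.w z v'' + 1 - q z by omega]
    rfl
  have hκ'G' : ∀ v', v' ≠ v'' → κ'.G v' = σ.G v' := fun v' hv' => by
    rw [hsh.G_eq, hκG]
    simp [hσ₁, release, hv']
  -- `v''` lowers its aspiration by one, and then wins `z` back at the previous aspirations
  have hzE' : (z, v'') ∉ κ'.E := by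
    rw [hκ'E]
    simp
  have hcU' : κ'.cU z = q z :=
    Multiset.mem_singleton.1 (hκ'F ▸ cU_mem (by rw [hκ'F]; exact Multiset.singleton_ne_zero _))
  have hcV' : κ'.cV v'' = A.w z v'' + 1 - q z := cV_singleton hκ'G
  have hgt : q z ≤ A.w z v'' := by
    have h1 := (ho.frame hL).le_w z v'' hv''s
    omega
  have hb : A.w z v'' + 1 - q z ∈ κ'.G v'' := by rw [hκ'G]; simp
  have hlow := hL.lowerV κ' hκ' z v'' hzE' (by omega) _ hb (by omega)
    fun t ht _ => by rw [hκ'G, Multiset.mem_singleton] at ht; omega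
  have hobj2 := objective_lowerG hb (by omega)
  set κ₂ := κ'.lowerG v'' (A.w z v'' + 1 - q z) with hκ₂
  have hG₂ : κ₂.G v'' = {A.w z v'' - q z} := by
    simp only [hκ₂, lowerG, Function.update_self, hκ'G]
    rw [show A.w z v'' + 1 - q z - 1 = A.w z v'' - q z by omega]
    simp
  have hcV₂ : κ₂.cV v'' = A.w z v'' - q z := cV_singleton hG₂
  have hcU₂ : κ₂.cU z = q z := hcU'
  have hF₂ : κ₂.F z ≠ 0 := by
    have : κ₂.F z = {q z} := hκ'F
    rw [this]
    exact Multiset.singleton_ne_zero _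
  obtain ⟨σ', hσ', hout'⟩ := hL.give hlow hF₂ hzE' (by omega)
  rw [hcU₂, show min (q z) (A.w z v'' - κ₂.cV v'' - 1) = q z - 1 by
    rw [hcV₂, min_eq_right] <;> omega] at hout'
  have hobj3 := hout'.objective_eq hzE' (hcU₂ ▸ cU_mem hF₂)
  have hσ'eq : σ' = κ₂.join (z, v'') (q z) (κ₂.cV v'') (q z - 1) (A.w z v'' - (q z - 1)) := by
    rcases hout' with ⟨-, h1⟩ | ⟨h1, -⟩
    · exact h1
    · rw [hG₂] at h1
      exact absurd h1 (Multiset.singleton_ne_zero _)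
  have hσ'G : ∀ v', σ'.G v' = σ.G v' := by
    intro v'
    by_cases hv : v' = v''
    · subst hv
      rw [hσ'eq, hG'']
      simp only [join, Function.update_self, hG₂, hcV₂]
      simp
    · rw [← hκ'G' v' hv, hσ'eq]
      simp [join, hκ₂, lowerG, hv]
  have hlk : ∀ u v', (u, v') ≠ (z, v'') →
      σ'.x (u, v') = κ'.x (u, v') ∧ σ'.y (u, v') = κ'.y (u, v') := by
    intro u v' hne'
    rw [hout'.x_eq, hout'.y_eq, Function.update_of_ne hne', Function.update_of_ne hne']
    exact ⟨rfl, rfl⟩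
  have hxz : σ'.x (z, v'') = q z - 1 := by rw [hout'.x_eq, Function.update_self]
  have hyz : σ'.y (z, v'') = A.w z v'' - (q z - 1) := by rw [hout'.y_eq, Function.update_self]
  refine ⟨σ', ⟨hσ', ?_, fun v' => ?_, fun u v' hu => ?_, fun u v' hu => ?_, fun u t ht => ?_,
    fun u v' hu hlt => ?_⟩, ?_⟩
  · rw [hσ'eq]
    show insert (z, v'') κ'.E = s.E
    rw [hκ'E, Finset.insert_erase hv''s]
  · rw [hσ'G]
    exact hin.zero v'
  · by_cases he : (u, v') = (z, v'')
    · obtain ⟨rfl, rfl⟩ := Prod.mk.inj he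
      have := hin.mono u v' hu
      omega
    · rw [(hlk u v' he).2]
      by_cases hv : v' = v
      · subst hv
        exact hmono u hu
      · rw [(hother u v' hv).2]
        exact hin.mono u v' hu
  · by_cases he : (u, v') = (z, v'')
    · obtain ⟨rfl, rfl⟩ := Prod.mk.inj he
      omega
    · rw [(hlk u v' he).1]
      by_cases hv : v' = v
      · subst hv
        exact hsh.le_x u ((hcol u).2 hu)
      · rw [(hother u v' hv).1]
        exact hin.le_x u v' hu
  · by_cases hu : u = z
    · subst hu
      rw [hout'.F_self] at ht
      have : κ₂.F u = κ'.F u := rfl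
      rw [this, hκ'F] at ht
      simp at ht
    · refine hsh.le_F u t ?_
      rw [hσ'eq] at ht
      simpa [join, hκ₂, lowerG, hu] using ht
  · by_cases he : (u, v') = (z, v'')
    · obtain ⟨rfl, rfl⟩ := Prod.mk.inj he
      exact hsafe''
    · rw [(hlk u v' he).1] at hlt
      by_cases hv : v' = v
      · subst hv
        exact h.safe
      · rw [(hother u v' hv).1] at hlt
        exact hin.safe u v' hu hlt
  · have := hsh.objective
    omega

/-- The player who breaks the ties cannot keep the dynamics away from the core. -/
theorem Stuck.eq_empty (hL : A.Stuck L) : L = ∅ := by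
  by_contra hne
  obtain ⟨s, q, ho⟩ := hL.exists_optimal (Set.nonempty_iff_ne_empty.2 hne)
  have hfr := ho.frame hL
  have hb := ho.balanced
  have hbad := ho.bad_eq_empty hL
  -- a free copy of a node with a positive bound can be lowered
  obtain ⟨u₀, hq₀, hF₀⟩ := ho.exists_free hL
  have htame : A.Tame s q u₀ := fun v hv n =>
    hfr.not_reach hL ho.tau_le n hbad le_rfl hq₀ hF₀ hv
  have hs0 : A.InPlace L s q s := by
    refine ⟨ho.mem, rfl, hb.zero, fun _ _ _ => le_rfl, fun u v huv => ?_, fun u t ht => ?_,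
      fun u v huv hlt => ?_⟩
    · exact (floor_le u).trans (hb.le_x u v huv)
    · exact (floor_le u).trans (hb.le_F u t ht)
    · exact absurd (hb.le_x u v huv) (by omega)
  obtain ⟨v₀, hv₀⟩ := (hL.valid s ho.mem).exists_unlinked hF₀
  have hq1 := hb.le_F u₀ _ (cU_mem hF₀)
  have hlow := hL.lower_free ho.mem hF₀ hv₀ (by omega)
    ((ho.le_add hL hv₀).trans (Nat.add_le_add_right hq1 _))
  have hs1 : A.InPlace L s q (s.lowerF u₀ (s.cU u₀)) := by
    refine ⟨hlow, rfl, hs0.zero, hs0.mono, hs0.le_x, fun u t ht => ?_, hs0.safe⟩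
    rcases mem_lowerF ht with h1 | ⟨rfl, rfl⟩
    · exact hs0.le_F u t h1
    · rw [floor_of_tame htame]
      omega
  have hobj1 := objective_lowerF (cU_mem hF₀) (show 0 < s.cU u₀ by omega)
  obtain ⟨σ, hσ, hmax⟩ := exists_max_of_bddAbove (A.InPlace L s q) Profile.objective
    (2 * (∑ e : U × V, A.w e.1 e.2 : ℕ)) ⟨_, hs1⟩
    fun σ hσ => (hL.valid σ hσ.mem).objective_le hσ.zero
  have hgt := hmax _ hs1
  obtain ⟨hσf, hτ⟩ := hσ.frame hL ho
  by_cases hd : ∀ u, σ.IsDirty q u → (A.viol σ q u).card ≤ (σ.F u).card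
  · obtain ⟨q', h1, h2⟩ := hσf.balanced hL hd
    have := ho.le_objective σ hσ.mem q' h1 (h2.trans hτ)
    omega
  · push Not at hd
    obtain ⟨z, hz, hlt⟩ := hd
    obtain ⟨v, hv⟩ := Finset.card_pos.1 (lt_of_le_of_lt (Nat.zero_le _) hlt)
    obtain ⟨hzv, hw⟩ := mem_viol.1 hv
    rw [hσ.E_eq] at hzv
    have h1 := ho.le_add hL hzv
    have h2 := hσf.p_le_cV hL v
    have htz : A.floor s q z < q z := by
      rcases hz with ⟨t, ht, hlt⟩ | ⟨v', hv', hlt⟩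
      · exact (hσ.le_F z t ht).trans_lt hlt
      · exact (hσ.le_x z v' (hσ.E_eq ▸ hv')).trans_lt hlt
    have htame' := tame_of_floor_lt htz
    have hviol : A.Violation L s q σ z v :=
      ⟨hσ, htame', htame' v ⟨hzv, by omega, rfl⟩, hzv, by omega, by omega, by omega⟩
    obtain ⟨σ', h3, h4⟩ : ∃ σ', A.InPlace L s q σ' ∧ σ.objective < σ'.objective := by
      by_cases hF : σ.F z = 0
      · exact hviol.improve_of_full hL ho hF hz
      · exact hviol.improve_of_free hL ho hF
    have := hmax σ' h3
    omega

end Market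

end ProposalGame

/-! ### States on the grid and their profiles -/

namespace BProblem

open ProposalGame

variable {U V : Type*} {P : BProblem U V}

/-- The aspiration `a` in units of the grid width `ε`. -/
noncomputable def level (ε a : ℚ) : ℕ := ⌊a / ε⌋₊

theorem level_mul {ε : ℚ} (hε : 0 < ε) (n : ℕ) : level ε (n * ε) = n := by
  unfold level
  rw [mul_div_cancel_right₀ _ hε.ne', Nat.floor_natCast]

theorem eq_level_mul {ε a : ℚ} (hε : 0 < ε) (ha : 0 ≤ a) (hk : ∃ k : ℤ, a = k * ε) :
    a = level ε a * ε := by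
  obtain ⟨k, rfl⟩ := hk
  have hk : 0 ≤ k := by
    by_contra! hlt
    have : (k : ℚ) < 0 := by exact_mod_cast hlt
    nlinarith
  lift k to ℕ using hk
  rw [Int.cast_natCast, level_mul hε]

namespace State

/-- `s` is a feasible state on the grid of width `ε`. -/
def Proper (ε : ℚ) (s : P.State) : Prop := s.IsFeasible ∧ s.OnGrid ε

theorem Proper.eq_level {ε : ℚ} (hε : 0 < ε) {s : P.State} (hs : s.Proper ε) (c : P.Copy) :
    s.a c = level ε (s.a c) * ε :=
  eq_level_mul hε (hs.1.2.1 c) (hs.2 c)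

open Classical in
/-- The free copies of the node `u`. -/
noncomputable def freeU (s : P.State) (u : U) : Finset (Fin (P.B (Sum.inl u))) :=
  Finset.univ.filter fun i => s.IsFree ⟨Sum.inl u, i⟩

open Classical in
/-- The free copies of the node `v`. -/
noncomputable def freeV (s : P.State) (v : V) : Finset (Fin (P.B (Sum.inr v))) :=
  Finset.univ.filter fun j => s.IsFree ⟨Sum.inr v, j⟩

theorem mem_freeU {s : P.State} {u : U} {i : Fin (P.B (Sum.inl u))} :
    i ∈ s.freeU u ↔ ∀ w : P.VCopy, (⟨u, i⟩, w) ∉ s.M := by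
  simp only [freeU, Finset.mem_filter, Finset.mem_univ, true_and]
  exact Iff.rfl

theorem mem_freeV {s : P.State} {v : V} {j : Fin (P.B (Sum.inr v))} :
    j ∈ s.freeV v ↔ ∀ w : P.UCopy, (w, ⟨v, j⟩) ∉ s.M := by
  simp only [freeV, Finset.mem_filter, Finset.mem_univ, true_and]
  exact Iff.rfl

/-- `σ` is the profile of the state `s`. -/
structure Rep (ε : ℚ) (s : P.State) (σ : Profile U V) : Prop where
  E_iff : ∀ u v, (u, v) ∈ σ.E ↔ s.Linked u v
  x_eq : ∀ u i v j, (⟨u, i⟩, ⟨v, j⟩) ∈ s.M → σ.x (u, v) = level ε (s.aU u i)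
  y_eq : ∀ u i v j, (⟨u, i⟩, ⟨v, j⟩) ∈ s.M → σ.y (u, v) = level ε (s.aV v j)
  F_eq : ∀ u, σ.F u = (s.freeU u).val.map fun i => level ε (s.aU u i)
  G_eq : ∀ v, σ.G v = (s.freeV v).val.map fun j => level ε (s.aV v j)

theorem exists_rep (ε : ℚ) {s : P.State} (hs : s.IsCopiesMatching) : ∃ σ, s.Rep ε σ := by
  classical
  refine ⟨⟨s.M.image fun e => (e.1.1, e.2.1),
    fun e => if h : ∃ m ∈ s.M, (m.1.1, m.2.1) = e then level ε (s.aU h.choose.1.1 h.choose.1.2)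
      else 0,
    fun e => if h : ∃ m ∈ s.M, (m.1.1, m.2.1) = e then level ε (s.aV h.choose.2.1 h.choose.2.2)
      else 0, _, _⟩, fun u v => ?_, fun u i v j hm => ?_, fun u i v j hm => ?_, fun _ => rfl,
      fun _ => rfl⟩
  · simp only [Finset.mem_image, Linked]
    constructor
    · rintro ⟨⟨⟨u, i⟩, ⟨v, j⟩⟩, hm, he⟩
      obtain ⟨rfl, rfl⟩ := Prod.mk.inj he
      exact ⟨i, j, hm⟩
    · rintro ⟨i, j, hm⟩
      exact ⟨_, hm, rfl⟩
  · have h : ∃ m ∈ s.M, (m.1.1, m.2.1) = (u, v) := ⟨_, hm, rfl⟩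
    have h1 := h.choose_spec
    have h2 := hs.2.2 _ h1.1 _ hm (Prod.mk.inj h1.2).1 (Prod.mk.inj h1.2).2
    simp only [dif_pos h]
    rw [h2]
  · have h : ∃ m ∈ s.M, (m.1.1, m.2.1) = (u, v) := ⟨_, hm, rfl⟩
    have h1 := h.choose_spec
    have h2 := hs.2.2 _ h1.1 _ hm (Prod.mk.inj h1.2).1 (Prod.mk.inj h1.2).2
    simp only [dif_pos h]
    rw [h2]

variable [DecidableEq U] [DecidableEq V]

/-- The pair `m` is removed from the matching. -/
def unlink (s : P.State) (m : P.UCopy × P.VCopy) : P.State where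
  a := s.a
  M := s.M.erase m

/-- The copies `u_i` and `v_j` are matched and get new aspirations. -/
def link (s : P.State) (u : U) (i : Fin (P.B (Sum.inl u))) (v : V) (j : Fin (P.B (Sum.inr v)))
    (xa ya : ℚ) : P.State where
  a := Function.update (Function.update s.a ⟨Sum.inl u, i⟩ xa) ⟨Sum.inr v, j⟩ ya
  M := insert (⟨u, i⟩, ⟨v, j⟩) s.M

theorem unlink_freeU_self {s : P.State} (hs : s.IsCopiesMatching) {u : U}
    {i : Fin (P.B (Sum.inl u))} {w : P.VCopy} (hm : (⟨u, i⟩, w) ∈ s.M) :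
    (s.unlink (⟨u, i⟩, w)).freeU u = insert i (s.freeU u) := by
  ext k
  rw [Finset.mem_insert, mem_freeU, mem_freeU]
  constructor
  · intro h
    by_cases hk : k = i
    · exact Or.inl hk
    · refine Or.inr fun w' hw' => h w' (Finset.mem_erase.2 ⟨fun he => hk ?_, hw'⟩)
      have := (Prod.mk.inj he).1
      simpa using this
  · rintro (rfl | h) w' hw'
    · obtain ⟨h1, h2⟩ := Finset.mem_erase.1 hw'
      exact h1 (hs.1 _ h2 _ hm rfl)
    · exact h w' (Finset.mem_of_mem_erase hw')

theorem unlink_freeV_self {s : P.State} (hs : s.IsCopiesMatching) {v : V}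
    {j : Fin (P.B (Sum.inr v))} {w : P.UCopy} (hm : (w, ⟨v, j⟩) ∈ s.M) :
    (s.unlink (w, ⟨v, j⟩)).freeV v = insert j (s.freeV v) := by
  ext k
  rw [Finset.mem_insert, mem_freeV, mem_freeV]
  constructor
  · intro h
    by_cases hk : k = j
    · exact Or.inl hk
    · refine Or.inr fun w' hw' => h w' (Finset.mem_erase.2 ⟨fun he => hk ?_, hw'⟩)
      have := (Prod.mk.inj he).2
      simpa using this
  · rintro (rfl | h) w' hw'
    · obtain ⟨h1, h2⟩ := Finset.mem_erase.1 hw'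
      exact h1 (hs.2.1 _ h2 _ hm rfl)
    · exact h w' (Finset.mem_of_mem_erase hw')

theorem unlink_freeU_of_ne {s : P.State} {m : P.UCopy × P.VCopy} {u : U} (hu : u ≠ m.1.1) :
    (s.unlink m).freeU u = s.freeU u := by
  ext k
  rw [mem_freeU, mem_freeU]
  refine forall_congr' fun w => not_congr ⟨Finset.mem_of_mem_erase, fun h =>
    Finset.mem_erase.2 ⟨?_, h⟩⟩
  rintro rfl
  exact hu rfl

theorem unlink_freeV_of_ne {s : P.State} {m : P.UCopy × P.VCopy} {v : V} (hv : v ≠ m.2.1) :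
    (s.unlink m).freeV v = s.freeV v := by
  ext k
  rw [mem_freeV, mem_freeV]
  refine forall_congr' fun w => not_congr ⟨Finset.mem_of_mem_erase, fun h =>
    Finset.mem_erase.2 ⟨?_, h⟩⟩
  rintro rfl
  exact hv rfl

theorem Rep.unlink {ε : ℚ} {s : P.State} {σ : Profile U V} (h : s.Rep ε σ)
    (hs : s.IsCopiesMatching) {u : U} {i : Fin (P.B (Sum.inl u))} {v : V}
    {j : Fin (P.B (Sum.inr v))} (hm : (⟨u, i⟩, ⟨v, j⟩) ∈ s.M) :
    (s.unlink (⟨u, i⟩, ⟨v, j⟩)).Rep ε (σ.release (u, v)) := by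
  refine ⟨fun u' v' => ?_, fun u' i' v' j' hm' => h.x_eq u' i' v' j' (Finset.mem_of_mem_erase hm'),
    fun u' i' v' j' hm' => h.y_eq u' i' v' j' (Finset.mem_of_mem_erase hm'), fun u' => ?_,
    fun v' => ?_⟩
  · simp only [Profile.release, Finset.mem_erase, h.E_iff]
    constructor
    · rintro ⟨hne, i', j', hm'⟩
      refine ⟨i', j', Finset.mem_erase.2 ⟨fun he => hne ?_, hm'⟩⟩
      have h1 := congrArg (fun e : P.UCopy × P.VCopy => (e.1.1, e.2.1)) he
      exact h1
    · rintro ⟨i', j', hm'⟩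
      obtain ⟨h1, h2⟩ := Finset.mem_erase.1 hm'
      refine ⟨fun he => h1 ?_, i', j', h2⟩
      obtain ⟨rfl, rfl⟩ := Prod.mk.inj he
      exact hs.2.2 _ h2 _ hm rfl rfl
  · by_cases hu : u' = u
    · subst hu
      have hi : i ∉ s.freeU u' := fun hi => mem_freeU.1 hi _ hm
      simp only [Profile.release, Function.update_self, h.F_eq, unlink_freeU_self hs hm,
        Finset.insert_val_of_notMem hi, Multiset.map_cons, h.x_eq _ _ _ _ hm]
      rfl
    · rw [unlink_freeU_of_ne (by exact hu)]
      simp only [Profile.release, Function.update_of_ne hu, h.F_eq]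
      rfl
  · by_cases hv : v' = v
    · subst hv
      have hj : j ∉ s.freeV v' := fun hj => mem_freeV.1 hj _ hm
      simp only [Profile.release, Function.update_self, h.G_eq, unlink_freeV_self hs hm,
        Finset.insert_val_of_notMem hj, Multiset.map_cons, h.y_eq _ _ _ _ hm]
      rfl
    · rw [unlink_freeV_of_ne (by exact hv)]
      simp only [Profile.release, Function.update_of_ne hv, h.G_eq]
      rfl

section Link

variable {s : P.State} {u : U} {i : Fin (P.B (Sum.inl u))} {v : V} {j : Fin (P.B (Sum.inr v))}
  {xa ya : ℚ}

theorem link_aU_self : (s.link u i v j xa ya).aU u i = xa := by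
  simp [link, aU]

theorem link_aV_self : (s.link u i v j xa ya).aV v j = ya := by
  simp [link, aV]

theorem link_aU_of_ne {u' : U} {k : Fin (P.B (Sum.inl u'))}
    (h : (⟨u', k⟩ : P.UCopy) ≠ ⟨u, i⟩) : (s.link u i v j xa ya).aU u' k = s.aU u' k := by
  have h1 : (⟨Sum.inl u', k⟩ : P.Copy) ≠ ⟨Sum.inl u, i⟩ := by
    intro he
    apply h
    obtain ⟨h2, h3⟩ := Sigma.mk.inj he
    obtain rfl := Sum.inl.inj h2
    rw [eq_of_heq h3]
  simp [link, aU, h1]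

theorem link_aV_of_ne {v' : V} {k : Fin (P.B (Sum.inr v'))}
    (h : (⟨v', k⟩ : P.VCopy) ≠ ⟨v, j⟩) : (s.link u i v j xa ya).aV v' k = s.aV v' k := by
  have h1 : (⟨Sum.inr v', k⟩ : P.Copy) ≠ ⟨Sum.inr v, j⟩ := by
    intro he
    apply h
    obtain ⟨h2, h3⟩ := Sigma.mk.inj he
    obtain rfl := Sum.inr.inj h2
    rw [eq_of_heq h3]
  simp [link, aV, h1]

theorem Proper.link {ε : ℚ} (hs : s.Proper ε) (hi : i ∈ s.freeU u) (hj : j ∈ s.freeV v)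
    (hl : ¬ s.Linked u v) (hx : 0 ≤ xa) (hy : 0 ≤ ya) (hxk : ∃ k : ℤ, xa = k * ε)
    (hyk : ∃ k : ℤ, ya = k * ε) (hsum : xa + ya = P.W u v) :
    (s.link u i v j xa ya).Proper ε := by
  rw [mem_freeU] at hi
  rw [mem_freeV] at hj
  have hcases : ∀ (Q : ℚ → Prop), Q xa → Q ya → (∀ c, Q (s.a c)) →
      ∀ c, Q ((s.link u i v j xa ya).a c) := by
    intro Q h1 h2 h3 c
    simp only [State.link]
    by_cases hc : c = ⟨Sum.inr v, j⟩
    · rw [hc, Function.update_self]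
      exact h2
    · rw [Function.update_of_ne hc]
      by_cases hc' : c = ⟨Sum.inl u, i⟩
      · rw [hc', Function.update_self]
        exact h1
      · rw [Function.update_of_ne hc']
        exact h3 c
  refine ⟨⟨⟨?_, ?_, ?_⟩, hcases (0 ≤ ·) hx hy hs.1.2.1, fun u' i' v' j' hm => ?_⟩,
    hcases (fun a => ∃ k : ℤ, a = k * ε) hxk hyk hs.2⟩
  · intro e he f hf hef
    rcases Finset.mem_insert.1 he with rfl | he <;> rcases Finset.mem_insert.1 hf with rfl | hf
    · rfl
    · refine absurd hf ?_
      obtain ⟨f1, f2⟩ := f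
      obtain rfl : (⟨u, i⟩ : P.UCopy) = f1 := hef
      exact hi f2
    · refine absurd he ?_
      obtain ⟨f1, f2⟩ := e
      obtain rfl : f1 = (⟨u, i⟩ : P.UCopy) := hef
      exact hi f2
    · exact hs.1.1.1 e he f hf hef
  · intro e he f hf hef
    rcases Finset.mem_insert.1 he with rfl | he <;> rcases Finset.mem_insert.1 hf with rfl | hf
    · rfl
    · refine absurd hf ?_
      obtain ⟨f1, f2⟩ := f
      obtain rfl : (⟨v, j⟩ : P.VCopy) = f2 := hef
      exact hj f1
    · refine absurd he ?_
      obtain ⟨f1, f2⟩ := e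
      obtain rfl : f2 = (⟨v, j⟩ : P.VCopy) := hef
      exact hj f1
    · exact hs.1.1.2.1 e he f hf hef
  · intro e he f hf hef hef'
    rcases Finset.mem_insert.1 he with rfl | he₁ <;> rcases Finset.mem_insert.1 hf with rfl | hf₁
    · rfl
    · refine absurd ?_ hl
      obtain ⟨⟨u', i'⟩, ⟨v', j'⟩⟩ := f
      obtain rfl : u = u' := hef
      obtain rfl : v = v' := hef'
      exact ⟨_, _, hf₁⟩
    · refine absurd ?_ hl
      obtain ⟨⟨u', i'⟩, ⟨v', j'⟩⟩ := e
      obtain rfl : u' = u := hef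
      obtain rfl : v' = v := hef'
      exact ⟨_, _, he₁⟩
    · exact hs.1.1.2.2 e he₁ f hf₁ hef hef'
  · rcases Finset.mem_insert.1 hm with he | hm
    · obtain ⟨h1, h2⟩ := Prod.mk.inj he
      obtain ⟨rfl, h1⟩ := Sigma.mk.inj h1
      obtain ⟨rfl, h2⟩ := Sigma.mk.inj h2
      obtain rfl := eq_of_heq h1
      obtain rfl := eq_of_heq h2
      rw [link_aU_self, link_aV_self, hsum]
    · rw [link_aU_of_ne, link_aV_of_ne]
      · exact hs.1.2.2 u' i' v' j' hm
      · intro he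
        rw [he] at hm
        exact hj _ hm
      · intro he
        rw [he] at hm
        exact hi _ hm

theorem Rep.link {ε : ℚ} {σ : Profile U V} (h : s.Rep ε σ) (hi : i ∈ s.freeU u)
    (hj : j ∈ s.freeV v) (hl : ¬ s.Linked u v) :
    (s.link u i v j xa ya).Rep ε (σ.join (u, v) (level ε (s.aU u i)) (level ε (s.aV v j))
      (level ε xa) (level ε ya)) := by
  have hi' := mem_freeU.1 hi
  have hj' := mem_freeV.1 hj
  refine ⟨fun u' v' => ?_, fun u' i' v' j' hm => ?_, fun u' i' v' j' hm => ?_, fun u' => ?_,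
    fun v' => ?_⟩
  · simp only [Profile.join, Finset.mem_insert, h.E_iff]
    constructor
    · rintro (he | ⟨i', j', hm⟩)
      · obtain ⟨rfl, rfl⟩ := Prod.mk.inj he
        exact ⟨i, j, Finset.mem_insert_self _ _⟩
      · exact ⟨i', j', Finset.mem_insert_of_mem hm⟩
    · rintro ⟨i', j', hm⟩
      rcases Finset.mem_insert.1 hm with he | hm
      · exact Or.inl (congrArg (fun e : P.UCopy × P.VCopy => (e.1.1, e.2.1)) he)
      · exact Or.inr ⟨i', j', hm⟩
  · rcases Finset.mem_insert.1 hm with he | hm₁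
    · obtain ⟨h1, h2⟩ := Prod.mk.inj he
      obtain ⟨rfl, h1⟩ := Sigma.mk.inj h1
      obtain ⟨rfl, h2⟩ := Sigma.mk.inj h2
      obtain rfl := eq_of_heq h1
      simp [Profile.join, link_aU_self]
    · have hne : (u', v') ≠ (u, v) := by
        intro he
        obtain ⟨rfl, rfl⟩ := Prod.mk.inj he
        exact hl ⟨_, _, hm₁⟩
      rw [link_aU_of_ne (fun he => hi' _ (he ▸ hm₁)), ← h.x_eq u' i' v' j' hm₁]
      simp [Profile.join, Function.update_of_ne hne]
  · rcases Finset.mem_insert.1 hm with he | hm₁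
    · obtain ⟨h1, h2⟩ := Prod.mk.inj he
      obtain ⟨rfl, h1⟩ := Sigma.mk.inj h1
      obtain ⟨rfl, h2⟩ := Sigma.mk.inj h2
      obtain rfl := eq_of_heq h2
      simp [Profile.join, link_aV_self]
    · have hne : (u', v') ≠ (u, v) := by
        intro he
        obtain ⟨rfl, rfl⟩ := Prod.mk.inj he
        exact hl ⟨_, _, hm₁⟩
      rw [link_aV_of_ne (fun he => hj' _ (he ▸ hm₁)), ← h.y_eq u' i' v' j' hm₁]
      simp [Profile.join, Function.update_of_ne hne]
  · by_cases hu : u' = u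
    · subst hu
      have h1 : (s.link u' i v j xa ya).freeU u' = (s.freeU u').erase i := by
        ext k
        rw [mem_freeU, Finset.mem_erase, mem_freeU]
        constructor
        · intro h
          refine ⟨?_, fun w hw => h w (Finset.mem_insert_of_mem hw)⟩
          rintro rfl
          exact h _ (Finset.mem_insert_self _ _)
        · rintro ⟨h1, h2⟩ w hw
          rcases Finset.mem_insert.1 hw with he | hw
          · have := (Prod.mk.inj he).1
            exact h1 (by simpa using this)
          · exact h2 w hw
      simp only [Profile.join, Function.update_self, h.F_eq, h1, Finset.erase_val]
      rw [← Multiset.map_erase_of_mem (fun k => level ε (s.aU u' k)) _ hi]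
      refine Multiset.map_congr rfl fun k hk => ?_
      rw [link_aU_of_ne]
      intro he
      have h2 : k ∈ (s.freeU u').erase i := hk
      exact (Finset.mem_erase.1 h2).1 (by simpa using he)
    · have h1 : (s.link u i v j xa ya).freeU u' = s.freeU u' := by
        ext k
        rw [mem_freeU, mem_freeU]
        refine forall_congr' fun w => not_congr ⟨fun hw => ?_, Finset.mem_insert_of_mem⟩
        rcases Finset.mem_insert.1 hw with he | hw
        · exact absurd (congrArg (fun e : P.UCopy × P.VCopy => e.1.1) he) hu
        · exact hw
      simp only [Profile.join, Function.update_of_ne hu, h.F_eq, h1]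
      refine Multiset.map_congr rfl fun k _ => ?_
      rw [link_aU_of_ne]
      intro he
      exact hu (congrArg Sigma.fst he)
  · by_cases hv : v' = v
    · subst hv
      have h1 : (s.link u i v' j xa ya).freeV v' = (s.freeV v').erase j := by
        ext k
        rw [mem_freeV, Finset.mem_erase, mem_freeV]
        constructor
        · intro h
          refine ⟨?_, fun w hw => h w (Finset.mem_insert_of_mem hw)⟩
          rintro rfl
          exact h _ (Finset.mem_insert_self _ _)
        · rintro ⟨h1, h2⟩ w hw
          rcases Finset.mem_insert.1 hw with he | hw
          · have := (Prod.mk.inj he).2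
            exact h1 (by simpa using this)
          · exact h2 w hw
      simp only [Profile.join, Function.update_self, h.G_eq, h1, Finset.erase_val]
      rw [← Multiset.map_erase_of_mem (fun k => level ε (s.aV v' k)) _ hj]
      refine Multiset.map_congr rfl fun k hk => ?_
      rw [link_aV_of_ne]
      intro he
      have h2 : k ∈ (s.freeV v').erase j := hk
      exact (Finset.mem_erase.1 h2).1 (by simpa using he)
    · have h1 : (s.link u i v j xa ya).freeV v' = s.freeV v' := by
        ext k
        rw [mem_freeV, mem_freeV]
        refine forall_congr' fun w => not_congr ⟨fun hw => ?_, Finset.mem_insert_of_mem⟩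
        rcases Finset.mem_insert.1 hw with he | hw
        · exact absurd (congrArg (fun e : P.UCopy × P.VCopy => e.2.1) he) hv
        · exact hw
      simp only [Profile.join, Function.update_of_ne hv, h.G_eq, h1]
      refine Multiset.map_congr rfl fun k _ => ?_
      rw [link_aV_of_ne]
      intro he
      exact hv (congrArg Sigma.fst he)

end Link

end State

end BProblem

/-! ### The dynamics as a game against the tie-breaking player -/

namespace BProblem

open ProposalGame

variable {U V : Type*} {P : BProblem U V} [DecidableEq U] [DecidableEq V]

theorem level_mono {ε a b : ℚ} (hε : 0 < ε) (h : a ≤ b) : level ε a ≤ level ε b :=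
  Nat.floor_le_floor (div_le_div_of_nonneg_right h hε.le)

/-- The weights in units of the grid width, and the capacities. -/
noncomputable def market [Fintype U] [Fintype V] (P : BProblem U V) (hP : P.CapacityBound) (ε : ℚ) :
    Market U V where
  w u v := level ε (P.W u v)
  bU u := P.B (Sum.inl u)
  bV v := P.B (Sum.inr v)
  bU_pos _ := P.B_pos _
  bV_pos _ := P.B_pos _
  bU_le := hP.1
  bV_le := hP.2

namespace State

variable {ε : ℚ} {s s' : P.State} {σ : Profile U V}

/-- The copy `x` dissolves its match, if any. -/
def detachU (s : P.State) (x : P.UCopy) : P.State where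
  a := s.a
  M := s.M.filter fun e => e.1 ≠ x

/-- The copy `y` dissolves its match, if any. -/
def detachV (s : P.State) (y : P.VCopy) : P.State where
  a := s.a
  M := s.M.filter fun e => e.2 ≠ y

theorem Proper.of_subset (hs : s.Proper ε) (ha : s'.a = s.a) (hM : s'.M ⊆ s.M) : s'.Proper ε := by
  refine ⟨⟨⟨fun e he f hf => hs.1.1.1 e (hM he) f (hM hf),
    fun e he f hf => hs.1.1.2.1 e (hM he) f (hM hf),
    fun e he f hf => hs.1.1.2.2 e (hM he) f (hM hf)⟩, ?_, fun u i v j h => ?_⟩, ?_⟩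
  · rw [ha]
    exact hs.1.2.1
  · unfold aU aV
    rw [ha]
    exact hs.1.2.2 u i v j (hM h)
  · unfold OnGrid
    rw [ha]
    exact hs.2

theorem Proper.detachU (hs : s.Proper ε) (x : P.UCopy) : (s.detachU x).Proper ε :=
  hs.of_subset rfl (Finset.filter_subset _ _)

theorem Proper.detachV (hs : s.Proper ε) (y : P.VCopy) : (s.detachV y).Proper ε :=
  hs.of_subset rfl (Finset.filter_subset _ _)

theorem detachU_of_free {u : U} {i : Fin (P.B (Sum.inl u))} (h : i ∈ s.freeU u) :
    s.detachU ⟨u, i⟩ = s := by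
  ext1
  · rfl
  · refine Finset.filter_true_of_mem fun e he hx => ?_
    obtain ⟨e1, e2⟩ := e
    obtain rfl : e1 = ⟨u, i⟩ := hx
    exact mem_freeU.1 h _ he

theorem detachV_of_free {v : V} {j : Fin (P.B (Sum.inr v))} (h : j ∈ s.freeV v) :
    s.detachV ⟨v, j⟩ = s := by
  ext1
  · rfl
  · refine Finset.filter_true_of_mem fun e he hx => ?_
    obtain ⟨e1, e2⟩ := e
    obtain rfl : e2 = ⟨v, j⟩ := hx
    exact mem_freeV.1 h _ he

theorem detachU_eq_unlink (hs : s.IsCopiesMatching) {x : P.UCopy} {y : P.VCopy}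
    (h : (x, y) ∈ s.M) : s.detachU x = s.unlink (x, y) := by
  ext1
  · rfl
  · ext e
    simp only [detachU, unlink, Finset.mem_filter, Finset.mem_erase]
    constructor
    · rintro ⟨h1, h2⟩
      exact ⟨fun he => h2 (by rw [he]), h1⟩
    · rintro ⟨h1, h2⟩
      exact ⟨h2, fun he => h1 (hs.1 e h2 _ h he)⟩

theorem detachV_eq_unlink (hs : s.IsCopiesMatching) {x : P.UCopy} {y : P.VCopy}
    (h : (x, y) ∈ s.M) : s.detachV y = s.unlink (x, y) := by
  ext1
  · rfl
  · ext e
    simp only [detachV, unlink, Finset.mem_filter, Finset.mem_erase]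
    constructor
    · rintro ⟨h1, h2⟩
      exact ⟨fun he => h2 (by rw [he]), h1⟩
    · rintro ⟨h1, h2⟩
      exact ⟨h2, fun he => h1 (hs.2.1 e h2 _ h he)⟩

theorem accept_eq_link (s : P.State) (u : U) (v : V) (b : Bool) (i : Fin (P.B (Sum.inl u)))
    (j : Fin (P.B (Sum.inr v))) : s.accept ⟨u, v, b⟩ i j =
      ((s.detachU ⟨u, i⟩).detachV ⟨v, j⟩).link u i v j
        (if b then P.W u v - s.aV v j else s.aU u i)
        (if b then s.aV v j else P.W u v - s.aU u i) := by
  have hne : (⟨Sum.inl u, i⟩ : P.Copy) ≠ ⟨Sum.inr v, j⟩ := by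
    intro h
    exact Sum.inl_ne_inr (Sigma.mk.inj h).1
  ext1
  · cases b
    · simp only [accept, link, detachU, detachV, Bool.false_eq_true, if_false]
      rw [show s.aU u i = s.a ⟨Sum.inl u, i⟩ from rfl, Function.update_eq_self]
    · simp only [accept, link, detachU, detachV, if_true]
      rw [Function.update_comm hne, show s.aV v j = s.a ⟨Sum.inr v, j⟩ from rfl,
        Function.update_eq_self]
  · simp only [accept, rematch, link, detachU, detachV, Finset.filter_filter]

theorem detach_not_linked {u : U} {v : V} (x : P.UCopy) (y : P.VCopy) (h : ¬ s.Linked u v) :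
    ¬ ((s.detachU x).detachV y).Linked u v := by
  rintro ⟨i, j, hm⟩
  exact h ⟨i, j, (Finset.mem_filter.1 (Finset.mem_filter.1 hm).1).1⟩

theorem detach_freeU (u : U) (i : Fin (P.B (Sum.inl u))) (y : P.VCopy) :
    i ∈ ((s.detachU ⟨u, i⟩).detachV y).freeU u :=
  mem_freeU.2 fun _ hw => (Finset.mem_filter.1 (Finset.mem_filter.1 hw).1).2 rfl

theorem detach_freeV (x : P.UCopy) (v : V) (j : Fin (P.B (Sum.inr v))) :
    j ∈ ((s.detachU x).detachV ⟨v, j⟩).freeV v :=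
  mem_freeV.2 fun _ hw => (Finset.mem_filter.1 hw).2 rfl

/-- A copy that is considered has the considered aspiration. -/
theorem IsConsidered.cU_eq (hε : 0 < ε) (h : s.Rep ε σ) {u : U} {i : Fin (P.B (Sum.inl u))}
    (hi : s.IsConsidered (Sum.inl u) i) : σ.cU u = level ε (s.aU u i) := by
  by_cases hf : ∃ k, s.IsFree ⟨Sum.inl u, k⟩
  · obtain ⟨h1, h2⟩ := hi.1 hf
    refine Profile.cU_eq ?_ fun t ht => ?_
    · rw [h.F_eq, Multiset.mem_map]
      exact ⟨i, mem_freeU.2 h1, rfl⟩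
    · rw [h.F_eq, Multiset.mem_map] at ht
      obtain ⟨k, hk, rfl⟩ := ht
      exact level_mono hε (h2 k (mem_freeU.1 hk))
  · have hF : σ.F u = 0 := by
      rw [h.F_eq, Multiset.eq_zero_iff_forall_notMem]
      intro t ht
      obtain ⟨k, hk, -⟩ := Multiset.mem_map.1 ht
      exact hf ⟨k, mem_freeU.1 hk⟩
    have hmin := hi.2 hf
    have hnf : ¬ s.IsFree ⟨Sum.inl u, i⟩ := fun h => hf ⟨i, h⟩
    obtain ⟨⟨v, j⟩, hm⟩ : ∃ w, (⟨u, i⟩, w) ∈ s.M := by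
      by_contra! hno
      exact hnf hno
    have hx := h.x_eq u i v j hm
    have hE := (h.E_iff u v).2 ⟨i, j, hm⟩
    refine le_antisymm (hx ▸ Profile.cU_le_link hF hE) ?_
    have hne : {a | ∃ v, (u, v) ∈ σ.E ∧ σ.x (u, v) = a}.Nonempty := ⟨_, v, hE, rfl⟩
    have hc := considered_mem_set hne
    obtain ⟨v', hv', he⟩ : ∃ v', (u, v') ∈ σ.E ∧ σ.x (u, v') = σ.cU u := by
      unfold Profile.cU
      rw [hF]
      exact hc
    obtain ⟨i', j', hm'⟩ := (h.E_iff u v').1 hv'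
    rw [← he, h.x_eq u i' v' j' hm']
    exact level_mono hε (hmin i')

theorem IsConsidered.cV_eq (hε : 0 < ε) (h : s.Rep ε σ) {v : V} {j : Fin (P.B (Sum.inr v))}
    (hj : s.IsConsidered (Sum.inr v) j) : σ.cV v = level ε (s.aV v j) := by
  by_cases hf : ∃ k, s.IsFree ⟨Sum.inr v, k⟩
  · obtain ⟨h1, h2⟩ := hj.1 hf
    refine Profile.cV_eq ?_ fun t ht => ?_
    · rw [h.G_eq, Multiset.mem_map]
      exact ⟨j, mem_freeV.2 h1, rfl⟩
    · rw [h.G_eq, Multiset.mem_map] at ht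
      obtain ⟨k, hk, rfl⟩ := ht
      exact level_mono hε (h2 k (mem_freeV.1 hk))
  · have hG : σ.G v = 0 := by
      rw [h.G_eq, Multiset.eq_zero_iff_forall_notMem]
      intro t ht
      obtain ⟨k, hk, -⟩ := Multiset.mem_map.1 ht
      exact hf ⟨k, mem_freeV.1 hk⟩
    have hmin := hj.2 hf
    have hnf : ¬ s.IsFree ⟨Sum.inr v, j⟩ := fun h => hf ⟨j, h⟩
    obtain ⟨⟨u, i⟩, hm⟩ : ∃ w, (w, ⟨v, j⟩) ∈ s.M := by
      by_contra! hno
      exact hnf hno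
    have hy := h.y_eq u i v j hm
    have hE := (h.E_iff u v).2 ⟨i, j, hm⟩
    refine le_antisymm (hy ▸ Profile.cV_le_link hG hE) ?_
    have hne : {a | ∃ u, (u, v) ∈ σ.E ∧ σ.y (u, v) = a}.Nonempty := ⟨_, u, hE, rfl⟩
    have hc := considered_mem_set hne
    obtain ⟨u', hu', he⟩ : ∃ u', (u', v) ∈ σ.E ∧ σ.y (u', v) = σ.cV v := by
      unfold Profile.cV
      rw [hG]
      exact hc
    obtain ⟨i', j', hm'⟩ := (h.E_iff u' v).1 hu'
    rw [← he, h.y_eq u' i' v j' hm']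
    exact level_mono hε (hmin j')

theorem freeV_detachU {u : U} {i : Fin (P.B (Sum.inl u))} {v : V} (hl : ¬ s.Linked u v)
    (k : Fin (P.B (Sum.inr v))) :
    (s.detachU ⟨u, i⟩).IsFree ⟨Sum.inr v, k⟩ ↔ s.IsFree ⟨Sum.inr v, k⟩ := by
  refine forall_congr' fun w => not_congr ⟨fun h => (Finset.mem_filter.1 h).1, fun h =>
    Finset.mem_filter.2 ⟨h, ?_⟩⟩
  rintro rfl
  exact hl ⟨_, _, h⟩

theorem IsConsidered.detachU {u : U} {i : Fin (P.B (Sum.inl u))} {v : V} (hl : ¬ s.Linked u v)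
    {j : Fin (P.B (Sum.inr v))} (hj : s.IsConsidered (Sum.inr v) j) :
    (s.detachU ⟨u, i⟩).IsConsidered (Sum.inr v) j := by
  unfold IsConsidered
  simp only [freeV_detachU hl]
  exact hj

variable [Fintype U] [Fintype V]

variable {hP : P.CapacityBound}

theorem level_ne_zero (hε : 0 < ε) (hW : ∀ u v, ∃ k : ℤ, P.W u v = k * ε) {u : U} {v : V}
    (h : P.W u v ≠ 0) : level ε (P.W u v) ≠ 0 := by
  intro h0
  have := eq_level_mul hε (P.W_nonneg u v) (hW u v)
  rw [h0] at this
  simp at this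
  exact h this

theorem IsConsidered.relU (hε : 0 < ε) (hW : ∀ u v, ∃ k : ℤ, P.W u v = k * ε) (hs : s.Proper ε)
    (h : s.Rep ε σ) {u : U} {i : Fin (P.B (Sum.inl u))} (hi : s.IsConsidered (Sum.inl u) i)
    (hz : ∀ w : P.VCopy, (⟨u, i⟩, w) ∈ s.M → P.W u w.1 ≠ 0) :
    ∃ σ₁, (P.market hP ε).RelU σ u (σ.cU u) σ₁ ∧ (s.detachU ⟨u, i⟩).Rep ε σ₁ := by
  by_cases hf : i ∈ s.freeU u
  · refine ⟨σ, Or.inl ⟨?_, rfl⟩, ?_⟩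
    · rw [h.F_eq]
      intro h0
      have h1 := Multiset.mem_map_of_mem (fun k => level ε (s.aU u k)) (show i ∈ (s.freeU u).val from hf)
      rw [h0] at h1
      simp at h1
    · rwa [detachU_of_free hf]
  · have hnf : ¬ ∃ k, s.IsFree ⟨Sum.inl u, k⟩ := fun hk => hf (mem_freeU.2 (hi.1 hk).1)
    obtain ⟨⟨v, j⟩, hm⟩ : ∃ w, (⟨u, i⟩, w) ∈ s.M := by
      by_contra! hno
      exact hf (mem_freeU.2 hno)
    refine ⟨σ.release (u, v), Or.inr ⟨?_, v, (h.E_iff u v).2 ⟨i, j, hm⟩, ?_,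
      level_ne_zero hε hW (hz _ hm), rfl⟩, ?_⟩
    · rw [h.F_eq, Multiset.eq_zero_iff_forall_notMem]
      intro t ht
      obtain ⟨k, hk, -⟩ := Multiset.mem_map.1 ht
      exact hnf ⟨k, mem_freeU.1 hk⟩
    · rw [h.x_eq u i v j hm, hi.cU_eq hε h]
    · rw [detachU_eq_unlink hs.1.1 hm]
      exact h.unlink hs.1.1 hm

theorem IsConsidered.relV (hε : 0 < ε) (hW : ∀ u v, ∃ k : ℤ, P.W u v = k * ε) (hs : s.Proper ε)
    (h : s.Rep ε σ) {v : V} {j : Fin (P.B (Sum.inr v))} (hj : s.IsConsidered (Sum.inr v) j)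
    (hz : ∀ w : P.UCopy, (w, ⟨v, j⟩) ∈ s.M → P.W w.1 v ≠ 0) :
    ∃ σ₁, (P.market hP ε).RelV σ v (σ.cV v) σ₁ ∧ (s.detachV ⟨v, j⟩).Rep ε σ₁ := by
  by_cases hf : j ∈ s.freeV v
  · refine ⟨σ, Or.inl ⟨?_, rfl⟩, ?_⟩
    · rw [h.G_eq]
      intro h0
      have h1 := Multiset.mem_map_of_mem (fun k => level ε (s.aV v k)) (show j ∈ (s.freeV v).val from hf)
      rw [h0] at h1
      simp at h1
    · rwa [detachV_of_free hf]
  · have hnf : ¬ ∃ k, s.IsFree ⟨Sum.inr v, k⟩ := fun hk => hf (mem_freeV.2 (hj.1 hk).1)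
    obtain ⟨⟨u, i⟩, hm⟩ : ∃ w, (w, ⟨v, j⟩) ∈ s.M := by
      by_contra! hno
      exact hf (mem_freeV.2 hno)
    refine ⟨σ.release (u, v), Or.inr ⟨?_, u, (h.E_iff u v).2 ⟨i, j, hm⟩, ?_,
      level_ne_zero hε hW (hz _ hm), rfl⟩, ?_⟩
    · rw [h.G_eq, Multiset.eq_zero_iff_forall_notMem]
      intro t ht
      obtain ⟨k, hk, -⟩ := Multiset.mem_map.1 ht
      exact hnf ⟨k, mem_freeV.1 hk⟩
    · rw [h.y_eq u i v j hm, hj.cV_eq hε h]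
    · rw [detachV_eq_unlink hs.1.1 hm]
      exact h.unlink hs.1.1 hm

/-- A sum of levels is compared with a weight in the same way as the aspirations. -/
theorem Proper.add_lt_iff (hε : 0 < ε) (hW : ∀ u v, ∃ k : ℤ, P.W u v = k * ε) (hs : s.Proper ε)
    {u : U} {v : V} (i : Fin (P.B (Sum.inl u))) (j : Fin (P.B (Sum.inr v))) :
    s.aU u i + s.aV v j < P.W u v ↔
      level ε (s.aU u i) + level ε (s.aV v j) < level ε (P.W u v) := by
  have h1 : s.aU u i = level ε (s.aU u i) * ε := hs.eq_level hε _
  have h2 : s.aV v j = level ε (s.aV v j) * ε := hs.eq_level hε _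
  have h3 := eq_level_mul hε (P.W_nonneg u v) (hW u v)
  generalize level ε (s.aU u i) = p at *
  generalize level ε (s.aV v j) = q at *
  generalize level ε (P.W u v) = r at *
  rw [h1, h2, h3, ← add_mul, mul_lt_mul_iff_left₀ hε]
  exact_mod_cast Iff.rfl

theorem level_sub (hε : 0 < ε) {a b : ℚ} (ha : 0 ≤ a) (hak : ∃ k : ℤ, a = k * ε) (hb : 0 ≤ b)
    (hbk : ∃ k : ℤ, b = k * ε) (hab : a ≤ b) : level ε (b - a) = level ε b - level ε a := by
  have h1 := eq_level_mul hε ha hak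
  have h2 := eq_level_mul hε hb hbk
  have h3 := level_mono hε hab
  have h4 : b - a = (level ε b - level ε a : ℕ) * ε := by
    rw [Nat.cast_sub h3, sub_mul, ← h1, ← h2]
  rw [h4, level_mul hε]

end State

end BProblem

/-! ### From every proper state some proposals force the core -/

namespace BProblem

open ProposalGame

variable {U V : Type*} {P : BProblem U V} [DecidableEq U] [DecidableEq V]

namespace State

variable {ε : ℚ} {s s' : P.State} {σ : Profile U V} {π : Proposal U V}

theorem lower_a_self (c : P.Copy) : (s.lower ε c).a c = s.a c - ε := by
  simp [lower]

theorem lower_a_of_ne {c c' : P.Copy} (h : c' ≠ c) : (s.lower ε c).a c' = s.a c' := by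
  simp [lower, h]

theorem le_of_pos_of_grid (hε : 0 < ε) {a : ℚ} (ha : 0 < a) (hk : ∃ k : ℤ, a = k * ε) : ε ≤ a := by
  obtain ⟨k, rfl⟩ := hk
  have h1 : (0 : ℚ) < k := pos_of_mul_pos_left ha hε.le
  have h2 : (1 : ℤ) ≤ k := by exact_mod_cast h1
  have h3 : (1 : ℚ) ≤ k := by exact_mod_cast h2
  nlinarith

theorem Proper.lower (hε : 0 < ε) (hs : s.Proper ε) {c : P.Copy} (hc : s.IsFreePos c) :
    (s.lower ε c).Proper ε := by
  refine ⟨⟨hs.1.1, fun c' => ?_, fun u i v j hm => ?_⟩, fun c' => ?_⟩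
  · by_cases h : c' = c
    · rw [h, lower_a_self]
      linarith [le_of_pos_of_grid hε hc.2 (hs.2 c)]
    · rw [lower_a_of_ne h]
      exact hs.1.2.1 c'
  · have h1 : (⟨Sum.inl u, i⟩ : P.Copy) ≠ c := by
      rintro rfl
      exact hc.1 _ hm
    have h2 : (⟨Sum.inr v, j⟩ : P.Copy) ≠ c := by
      rintro rfl
      exact hc.1 _ hm
    unfold aU aV
    rw [lower_a_of_ne h1, lower_a_of_ne h2]
    exact hs.1.2.2 u i v j hm
  · by_cases h : c' = c
    · obtain ⟨k, hk⟩ := hs.2 c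
      refine ⟨k - 1, ?_⟩
      rw [h, lower_a_self, hk]
      push_cast
      ring
    · rw [lower_a_of_ne h]
      exact hs.2 c'

/-- The dynamics keeps the state feasible and on the grid. -/
theorem Step.proper (hε : 0 < ε) (hW : ∀ u v, ∃ k : ℤ, P.W u v = k * ε) (hs : s.Proper ε)
    (h : Step ε s π s') : s'.Proper ε := by
  obtain ⟨u, v, b⟩ := π
  cases h with
  | skip => exact hs
  | stay => exact hs
  | decrease _ _ _ _ _ _ m hm => exact hs.lower hε hm.1
  | succeed h i j _ _ hlt =>
    have h1 : 0 ≤ s.aU u i := hs.1.2.1 _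
    have h2 : 0 ≤ s.aV v j := hs.1.2.1 _
    obtain ⟨p, hp⟩ : ∃ k : ℤ, s.aU u i = k * ε := hs.2 _
    obtain ⟨q, hq⟩ : ∃ k : ℤ, s.aV v j = k * ε := hs.2 _
    obtain ⟨r, hr⟩ := hW u v
    simp only at hlt
    rw [accept_eq_link]
    refine ((hs.detachU _).detachV _).link (detach_freeU _ _ _) (detach_freeV _ _ _)
      (detach_not_linked _ _ h) ?_ ?_ ?_ ?_ ?_
    · cases b <;> simp <;> linarith
    · cases b <;> simp <;> linarith
    · cases b
      · exact ⟨p, by simpa using hp⟩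
      · refine ⟨r - q, ?_⟩
        push_cast
        change P.W u v - s.aV v j = _
        rw [hr, hq]
        ring
    · cases b
      · refine ⟨r - p, ?_⟩
        push_cast
        rw [hr, hp]
        ring
      · exact ⟨q, by simpa using hq⟩
    · cases b <;> simp

theorem Step.le_of_le {K : ℚ} (hε : 0 < ε) (hK : ∀ u v, P.W u v ≤ K) (hs : s.Proper ε)
    (h : Step ε s π s') (hsK : ∀ c, s.a c ≤ K) (c : P.Copy) : s'.a c ≤ K := by
  cases h with
  | skip => exact hsK c
  | stay => exact hsK c
  | decrease _ _ _ _ _ _ m hm =>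
    by_cases h : c = ⟨π.proposer, m⟩
    · rw [h, lower_a_self]
      linarith [hsK ⟨π.proposer, m⟩]
    · rw [lower_a_of_ne h]
      exact hsK c
  | succeed h i j _ _ hlt =>
    have h1 : 0 ≤ s.aU π.u i := hs.1.2.1 _
    have h2 : 0 ≤ s.aV π.v j := hs.1.2.1 _
    have h3 := hK π.u π.v
    unfold accept
    simp only
    split_ifs
    · by_cases hc : c = ⟨Sum.inl π.u, i⟩
      · rw [hc, Function.update_self]
        linarith
      · rw [Function.update_of_ne hc]
        exact hsK c
    · by_cases hc : c = ⟨Sum.inr π.v, j⟩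
      · rw [hc, Function.update_self]
        linarith
      · rw [Function.update_of_ne hc]
        exact hsK c

theorem finite_step (ε : ℚ) (s : P.State) (π : Proposal U V) : {s' | Step ε s π s'}.Finite := by
  refine Set.Finite.subset (((Set.finite_singleton s).union (Set.finite_range
    fun ij : Fin (P.B (Sum.inl π.u)) × Fin (P.B (Sum.inr π.v)) => s.accept π ij.1 ij.2)).union
    (Set.finite_range fun m : Fin (P.B π.proposer) => s.lower ε ⟨π.proposer, m⟩)) ?_
  intro s' h
  cases h with
  | skip => exact Or.inl (Or.inl rfl)
  | stay => exact Or.inl (Or.inl rfl)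
  | decrease _ _ _ _ _ _ m hm => exact Or.inr ⟨m, rfl⟩
  | succeed h i j _ _ hlt => exact Or.inl (Or.inr ⟨(i, j), rfl⟩)

/-- Suitable proposals lead from `s` to the core in at most `n` iterations, however the ties are
broken. Each proposal may depend on the way the earlier ties were broken. -/
def Forced (ε : ℚ) : ℕ → P.State → Prop
  | 0, s => s.IsCopiesCore
  | n + 1, s => s.IsCopiesCore ∨ ∃ π, ∀ s', Step ε s π s' → Forced ε n s'

theorem Forced.succ {n : ℕ} (h : Forced ε n s) : Forced ε (n + 1) s := by
  induction n generalizing s with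
  | zero => exact Or.inl h
  | succ n ih =>
    rcases h with h | ⟨π, h⟩
    · exact Or.inl h
    · exact Or.inr ⟨π, fun s' hs' => ih (h s' hs')⟩

theorem Forced.mono {m n : ℕ} (h : Forced ε m s) (hmn : m ≤ n) : Forced ε n s := by
  induction n, hmn using Nat.le_induction with
  | base => exact h
  | succ n _ ih => exact ih.succ

/-- If no number of iterations suffices, then the ties can be broken so that this remains so; for
there are only finitely many ways to break the ties of one iteration. -/
theorem exists_step_not_forced (h : ∀ n, ¬ Forced ε n s) (π : Proposal U V) :
    ∃ s', Step ε s π s' ∧ ∀ n, ¬ Forced ε n s' := by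
  by_contra! hno
  choose! f hf using hno
  refine h ((finite_step ε s π).toFinset.sup f + 1) (Or.inr ⟨π, fun s' hs' => (hf s' hs').mono ?_⟩)
  exact Finset.le_sup (f := f) ((finite_step ε s π).mem_toFinset.2 hs')

/-- The number of links of weight zero. -/
def zeroLinks (s : P.State) : ℕ := (s.M.filter fun e => P.W e.1.1 e.2.1 = 0).card

/-- No iteration creates a link of weight zero. -/
theorem Step.zeroLinks_subset (hs : s.Proper ε) (h : Step ε s π s') :
    (s'.M.filter fun e => P.W e.1.1 e.2.1 = 0) ⊆ s.M.filter fun e => P.W e.1.1 e.2.1 = 0 := by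
  cases h with
  | skip => exact subset_rfl
  | stay => exact subset_rfl
  | decrease _ _ _ _ _ _ m hm => exact subset_rfl
  | succeed h i j _ _ hlt =>
    intro e he
    obtain ⟨h1, h2⟩ := Finset.mem_filter.1 he
    rcases Finset.mem_insert.1 h1 with rfl | h1
    · have h3 : 0 ≤ s.aU π.u i := hs.1.2.1 _
      have h4 : 0 ≤ s.aV π.v j := hs.1.2.1 _
      simp only at h2
      linarith
    · exact Finset.mem_filter.2 ⟨(Finset.mem_filter.1 h1).1, h2⟩

theorem Step.zeroLinks_le (hs : s.Proper ε) (h : Step ε s π s') : s'.zeroLinks ≤ s.zeroLinks :=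
  Finset.card_le_card (h.zeroLinks_subset hs)

section Rep

variable [Fintype U] [Fintype V] {hP : P.CapacityBound}

theorem Rep.card_filter_fst (h : s.Rep ε σ) (hs : s.IsCopiesMatching) (u : U) :
    (σ.F u).card + (σ.E.filter fun e => e.1 = u).card = P.B (Sum.inl u) := by
  have h1 : (σ.F u).card = (s.freeU u).card := by
    rw [h.F_eq, Multiset.card_map]
    rfl
  have hw : ∀ i ∈ (s.freeU u)ᶜ, ∃ w : P.VCopy, (⟨u, i⟩, w) ∈ s.M := by
    intro i hi
    by_contra! hno
    exact Finset.mem_compl.1 hi (mem_freeU.2 hno)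
  choose f hf using hw
  have h2 : ((s.freeU u)ᶜ).card = (σ.E.filter fun e => e.1 = u).card := by
    refine Finset.card_bij (fun i hi => (u, (f i hi).1)) (fun i hi => ?_)
      (fun i hi i' hi' he => ?_) fun e he => ?_
    · exact Finset.mem_filter.2 ⟨(h.E_iff _ _).2 ⟨i, (f i hi).2, hf i hi⟩, rfl⟩
    · have h3 := hs.2.2 _ (hf i hi) _ (hf i' hi') rfl (Prod.mk.inj he).2
      have h4 := (Prod.mk.inj h3).1
      simpa using h4
    · obtain ⟨u', v⟩ := e
      obtain ⟨hE, hu⟩ := Finset.mem_filter.1 he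
      simp only at hu
      subst hu
      obtain ⟨i, j, hm⟩ := (h.E_iff _ _).1 hE
      have hi : i ∈ (s.freeU u')ᶜ := Finset.mem_compl.2 fun hi => mem_freeU.1 hi _ hm
      refine ⟨i, hi, ?_⟩
      have h3 := (Prod.mk.inj (hs.1 _ (hf i hi) _ hm rfl)).2
      rw [h3]
  rw [h1, ← h2, Finset.card_add_card_compl, Fintype.card_fin]

theorem Rep.card_filter_snd (h : s.Rep ε σ) (hs : s.IsCopiesMatching) (v : V) :
    (σ.G v).card + (σ.E.filter fun e => e.2 = v).card = P.B (Sum.inr v) := by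
  have h1 : (σ.G v).card = (s.freeV v).card := by
    rw [h.G_eq, Multiset.card_map]
    rfl
  have hw : ∀ j ∈ (s.freeV v)ᶜ, ∃ w : P.UCopy, (w, ⟨v, j⟩) ∈ s.M := by
    intro j hj
    by_contra! hno
    exact Finset.mem_compl.1 hj (mem_freeV.2 hno)
  choose f hf using hw
  have h2 : ((s.freeV v)ᶜ).card = (σ.E.filter fun e => e.2 = v).card := by
    refine Finset.card_bij (fun j hj => ((f j hj).1, v)) (fun j hj => ?_)
      (fun j hj j' hj' he => ?_) fun e he => ?_
    · exact Finset.mem_filter.2 ⟨(h.E_iff _ _).2 ⟨(f j hj).2, j, hf j hj⟩, rfl⟩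
    · have h3 := hs.2.2 _ (hf j hj) _ (hf j' hj') (Prod.mk.inj he).1 rfl
      have h4 := (Prod.mk.inj h3).2
      simpa using h4
    · obtain ⟨u, v'⟩ := e
      obtain ⟨hE, hv⟩ := Finset.mem_filter.1 he
      simp only at hv
      subst hv
      obtain ⟨i, j, hm⟩ := (h.E_iff _ _).1 hE
      have hj : j ∈ (s.freeV v')ᶜ := Finset.mem_compl.2 fun hj => mem_freeV.1 hj _ hm
      refine ⟨j, hj, ?_⟩
      have h3 := (Prod.mk.inj (hs.2.1 _ (hf j hj) _ hm rfl)).1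
      rw [h3]
  rw [h1, ← h2, Finset.card_add_card_compl, Fintype.card_fin]

theorem Rep.valid (hε : 0 < ε) (h : s.Rep ε σ) (hs : s.Proper ε) : (P.market hP ε).Valid σ := by
  refine ⟨fun u v huv => ?_, h.card_filter_fst hs.1.1, h.card_filter_snd hs.1.1⟩
  obtain ⟨i, j, hm⟩ := (h.E_iff u v).1 huv
  rw [h.x_eq u i v j hm, h.y_eq u i v j hm]
  have h1 : s.aU u i = level ε (s.aU u i) * ε := hs.eq_level hε _
  have h2 : s.aV v j = level ε (s.aV v j) * ε := hs.eq_level hε _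
  have h3 := hs.1.2.2 u i v j hm
  change _ = level ε (P.W u v)
  rw [← h3]
  generalize level ε (s.aU u i) = p at *
  generalize level ε (s.aV v j) = q at *
  rw [h1, h2, ← add_mul, ← Nat.cast_add, level_mul hε]

theorem Rep.isCopiesCore (hε : 0 < ε) (hW : ∀ u v, ∃ k : ℤ, P.W u v = k * ε) (h : s.Rep ε σ)
    (hs : s.Proper ε) (hc : (P.market hP ε).Core σ) : s.IsCopiesCore := by
  obtain ⟨hc1, hc2, hc3⟩ := hc
  refine ⟨hs.1.1, hs.1.2.2, fun u v huv i j => ?_, fun c hf => ?_⟩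
  · by_contra! hlt
    rw [hs.add_lt_iff hε hW] at hlt
    have h1 : level ε (P.W u v) ≤ σ.cU u + σ.cV v := hc1 u v fun he => huv ((h.E_iff u v).1 he)
    have h2 : σ.cU u ≤ level ε (s.aU u i) := by
      by_cases hF : σ.F u = 0
      · have hi : i ∉ s.freeU u := by
          intro hi
          rw [h.F_eq, Multiset.map_eq_zero, Finset.val_eq_zero] at hF
          rw [hF] at hi
          exact absurd hi (Finset.notMem_empty i)
        rw [mem_freeU] at hi
        push Not at hi
        obtain ⟨⟨v', j'⟩, hm⟩ := hi
        rw [← h.x_eq u i v' j' hm]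
        exact Profile.cU_le_link hF ((h.E_iff _ _).2 ⟨_, _, hm⟩)
      · rw [hc2 u _ (Profile.cU_mem hF)]
        exact Nat.zero_le _
    have h3 : σ.cV v ≤ level ε (s.aV v j) := by
      by_cases hG : σ.G v = 0
      · have hj : j ∉ s.freeV v := by
          intro hj
          rw [h.G_eq, Multiset.map_eq_zero, Finset.val_eq_zero] at hG
          rw [hG] at hj
          exact absurd hj (Finset.notMem_empty j)
        rw [mem_freeV] at hj
        push Not at hj
        obtain ⟨⟨u', i'⟩, hm⟩ := hj
        rw [← h.y_eq u' i' v j hm]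
        exact Profile.cV_le_link hG ((h.E_iff _ _).2 ⟨_, _, hm⟩)
      · rw [hc3 v _ (Profile.cV_mem hG)]
        exact Nat.zero_le _
    omega
  · rw [hs.eq_level hε c]
    obtain ⟨u | v, i⟩ := c
    · rw [show level ε (s.a ⟨Sum.inl u, i⟩) = 0 from hc2 u _ ?_, Nat.cast_zero, zero_mul]
      rw [h.F_eq, Multiset.mem_map]
      exact ⟨i, mem_freeU.2 hf, rfl⟩
    · rw [show level ε (s.a ⟨Sum.inr v, i⟩) = 0 from hc3 v _ ?_, Nat.cast_zero, zero_mul]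
      rw [h.G_eq, Multiset.mem_map]
      exact ⟨i, mem_freeV.2 hf, rfl⟩

end Rep

theorem level_sub_grid (hε : 0 < ε) {a : ℚ} (ha : 0 < a) (hk : ∃ k : ℤ, a = k * ε) :
    level ε (a - ε) = level ε a - 1 := by
  have h1 := level_sub hε hε.le ⟨1, by simp⟩ ha.le hk (le_of_pos_of_grid hε ha hk)
  rw [h1]
  congr 1
  simpa using level_mul hε 1

theorem Rep.lowerU (hε : 0 < ε) (h : s.Rep ε σ) (hs : s.Proper ε) {u : U}
    {m : Fin (P.B (Sum.inl u))} (hm : s.IsFreePos ⟨Sum.inl u, m⟩) :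
    (s.lower ε ⟨Sum.inl u, m⟩).Rep ε (σ.lowerF u (level ε (s.aU u m))) := by
  have hU : ∀ u' i, (⟨u', i⟩ : P.UCopy) ≠ ⟨u, m⟩ →
      (s.lower ε ⟨Sum.inl u, m⟩).aU u' i = s.aU u' i := by
    intro u' i hne
    refine lower_a_of_ne fun he => hne ?_
    obtain ⟨h2, h3⟩ := Sigma.mk.inj he
    obtain rfl := Sum.inl.inj h2
    rw [eq_of_heq h3]
  refine ⟨h.E_iff, fun u' i v j hij => ?_, fun u' i v j hij => ?_, fun u' => ?_, fun v => ?_⟩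
  · rw [hU u' i, ← h.x_eq u' i v j hij]
    · rfl
    · intro he
      exact hm.1 ⟨v, j⟩ (he ▸ hij)
  · refine (h.y_eq u' i v j hij).trans ?_
    unfold aV
    rw [lower_a_of_ne (by simp)]
  · have hfree : (s.lower ε ⟨Sum.inl u, m⟩).freeU u' = s.freeU u' := rfl
    rw [hfree]
    by_cases hu : u' = u
    · subst hu
      have hmf : m ∈ s.freeU u' := mem_freeU.2 hm.1
      have h1 : (s.lower ε ⟨Sum.inl u', m⟩).aU u' m = s.aU u' m - ε := lower_a_self _
      have h2 : (s.freeU u').val = m ::ₘ ((s.freeU u').erase m).val := by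
        rw [Finset.erase_val]
        exact (Multiset.cons_erase hmf).symm
      simp only [Profile.lowerF, Function.update_self, h.F_eq]
      rw [h2, Multiset.map_cons, Multiset.map_cons, Multiset.erase_cons_head, h1,
        level_sub_grid hε (show 0 < s.aU u' m from hm.2) (hs.2 _)]
      congr 1
      refine Multiset.map_congr rfl fun k hk => ?_
      rw [hU u' k]
      intro he
      have h3 : k ∈ (s.freeU u').erase m := hk
      exact (Finset.mem_erase.1 h3).1 (by simpa using he)
    · simp only [Profile.lowerF, Function.update_of_ne hu, h.F_eq]
      refine Multiset.map_congr rfl fun k _ => ?_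
      rw [hU u' k]
      intro he
      exact hu (congrArg Sigma.fst he)
  · refine (h.G_eq v).trans (Multiset.map_congr rfl fun k _ => ?_)
    unfold aV
    rw [lower_a_of_ne (by simp)]

theorem Rep.lowerV (hε : 0 < ε) (h : s.Rep ε σ) (hs : s.Proper ε) {v : V}
    {m : Fin (P.B (Sum.inr v))} (hm : s.IsFreePos ⟨Sum.inr v, m⟩) :
    (s.lower ε ⟨Sum.inr v, m⟩).Rep ε (σ.lowerG v (level ε (s.aV v m))) := by
  have hV : ∀ v' i, (⟨v', i⟩ : P.VCopy) ≠ ⟨v, m⟩ →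
      (s.lower ε ⟨Sum.inr v, m⟩).aV v' i = s.aV v' i := by
    intro v' i hne
    refine lower_a_of_ne fun he => hne ?_
    obtain ⟨h2, h3⟩ := Sigma.mk.inj he
    obtain rfl := Sum.inr.inj h2
    rw [eq_of_heq h3]
  refine ⟨h.E_iff, fun u i v' j hij => ?_, fun u i v' j hij => ?_, fun u => ?_, fun v' => ?_⟩
  · refine (h.x_eq u i v' j hij).trans ?_
    unfold aU
    rw [lower_a_of_ne (by simp)]
  · rw [hV v' j, ← h.y_eq u i v' j hij]
    · rfl
    · intro he
      exact hm.1 ⟨u, i⟩ (he ▸ hij)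
  · refine (h.F_eq u).trans (Multiset.map_congr rfl fun k _ => ?_)
    unfold aU
    rw [lower_a_of_ne (by simp)]
  · have hfree : (s.lower ε ⟨Sum.inr v, m⟩).freeV v' = s.freeV v' := rfl
    rw [hfree]
    by_cases hv : v' = v
    · subst hv
      have hmf : m ∈ s.freeV v' := mem_freeV.2 hm.1
      have h1 : (s.lower ε ⟨Sum.inr v', m⟩).aV v' m = s.aV v' m - ε := lower_a_self _
      have h2 : (s.freeV v').val = m ::ₘ ((s.freeV v').erase m).val := by
        rw [Finset.erase_val]
        exact (Multiset.cons_erase hmf).symm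
      simp only [Profile.lowerG, Function.update_self, h.G_eq]
      rw [h2, Multiset.map_cons, Multiset.map_cons, Multiset.erase_cons_head, h1,
        level_sub_grid hε (show 0 < s.aV v' m from hm.2) (hs.2 _)]
      congr 1
      refine Multiset.map_congr rfl fun k hk => ?_
      rw [hV v' k]
      intro he
      have h3 : k ∈ (s.freeV v').erase m := hk
      exact (Finset.mem_erase.1 h3).1 (by simpa using he)
    · simp only [Profile.lowerG, Function.update_of_ne hv, h.G_eq]
      refine Multiset.map_congr rfl fun k _ => ?_
      rw [hV v' k]
      intro he
      exact hv (congrArg Sigma.fst he)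

end State

end BProblem

namespace BProblem

open ProposalGame

variable {U V : Type*} {P : BProblem U V} [DecidableEq U] [DecidableEq V] [Fintype U] [Fintype V]

namespace State

variable {ε : ℚ} {s s' : P.State} {σ : Profile U V} {π : Proposal U V} {hP : P.CapacityBound}

/-- The game follows a successful proposal: the profile of the new state arises by dissolving
links of the two nodes, where they have no free copy, and joining the two considered copies. -/
theorem Rep.accept (hε : 0 < ε) (hW : ∀ u v, ∃ k : ℤ, P.W u v = k * ε) (hs : s.Proper ε)
    (h : s.Rep ε σ) {u : U} {v : V} (hl : ¬ s.Linked u v) {i : Fin (P.B (Sum.inl u))}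
    {j : Fin (P.B (Sum.inr v))} (hi : s.IsConsidered (Sum.inl u) i)
    (hj : s.IsConsidered (Sum.inr v) j) (b : Bool)
    (hz : s.zeroLinks ≤ (s.accept ⟨u, v, b⟩ i j).zeroLinks)
    (hlt : s.aU u i + s.aV v j < P.W u v) :
    ∃ σ₁ σ₂, (P.market hP ε).RelU σ u (σ.cU u) σ₁ ∧ (P.market hP ε).RelV σ₁ v (σ.cV v) σ₂ ∧
      (s.accept ⟨u, v, b⟩ i j).Rep ε (σ₂.join (u, v) (σ.cU u) (σ.cV v)
        (if b then (P.market hP ε).w u v - σ.cV v else σ.cU u)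
        (if b then σ.cV v else (P.market hP ε).w u v - σ.cU u)) := by
  have hstep : Step ε s ⟨u, v, b⟩ (s.accept ⟨u, v, b⟩ i j) :=
    Step.succeed (π := ⟨u, v, b⟩) hl i j hi hj hlt
  -- As the number of zero links does not decrease, no zero link is dissolved.
  have heq := Finset.eq_of_subset_of_card_le (hstep.zeroLinks_subset hs) hz
  have hkeep : ∀ e ∈ s.M, P.W e.1.1 e.2.1 = 0 → e.1 ≠ ⟨u, i⟩ ∧ e.2 ≠ ⟨v, j⟩ := by
    intro e he h0
    have h1 : e ∈ (s.accept ⟨u, v, b⟩ i j).M.filter fun e => P.W e.1.1 e.2.1 = 0 := by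
      rw [heq]
      exact Finset.mem_filter.2 ⟨he, h0⟩
    rcases Finset.mem_insert.1 (Finset.mem_filter.1 h1).1 with rfl | h2
    · exact absurd ⟨_, _, he⟩ hl
    · exact (Finset.mem_filter.1 h2).2
  obtain ⟨σ₁, h1, h1r⟩ := hi.relU (hP := hP) hε hW hs h fun w hw h0 =>
    (hkeep (⟨u, i⟩, w) hw h0).1 rfl
  have hj' := hj.detachU (i := i) hl
  obtain ⟨σ₂, h2, h2r⟩ := hj'.relV (hP := hP) hε hW (hs.detachU _) h1r
    fun w hw h0 => (hkeep (w, ⟨v, j⟩) (Finset.mem_filter.1 hw).1 h0).2 rfl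
  have hcU := hi.cU_eq hε h
  have hcV := hj.cV_eq hε h
  have hcV' : σ₁.cV v = level ε (s.aV v j) := hj'.cV_eq hε h1r
  have ha : 0 ≤ s.aU u i := hs.1.2.1 _
  have hb : 0 ≤ s.aV v j := hs.1.2.1 _
  refine ⟨σ₁, σ₂, h1, by rwa [hcV, ← hcV'], ?_⟩
  rw [accept_eq_link]
  have h3 := h2r.link (xa := if b then P.W u v - s.aV v j else s.aU u i)
    (ya := if b then s.aV v j else P.W u v - s.aU u i) (detach_freeU u i _) (detach_freeV _ v j)
    (detach_not_linked _ _ hl)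
  have h4 : level ε (P.W u v - s.aV v j) = level ε (P.W u v) - level ε (s.aV v j) :=
    level_sub hε hb (hs.2 _) (P.W_nonneg _ _) (hW u v) (by linarith)
  have h5 : level ε (P.W u v - s.aU u i) = level ε (P.W u v) - level ε (s.aU u i) :=
    level_sub hε ha (hs.2 _) (P.W_nonneg _ _) (hW u v) (by linarith)
  rw [hcU, hcV]
  change State.Rep ε _ (σ₂.join (u, v) _ _ (if b then level ε (P.W u v) - _ else _)
    (if b then _ else level ε (P.W u v) - _))
  cases b
  · simp only [Bool.false_eq_true, if_false, h5] at h3 ⊢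
    exact h3
  · simp only [if_true, h4] at h3 ⊢
    exact h3

/-- A proper state from which no number of iterations suffices to force the core, with the least
number of zero links among all such states. -/
structure Trap (ε : ℚ) (s : P.State) : Prop where
  proper : s.Proper ε
  not_forced : ∀ n, ¬ Forced ε n s
  min : ∀ s' : P.State, s'.Proper ε → (∀ n, ¬ Forced ε n s') → s.zeroLinks ≤ s'.zeroLinks

theorem Trap.exists_step (hε : 0 < ε) (hW : ∀ u v, ∃ k : ℤ, P.W u v = k * ε) (h : s.Trap ε)
    (π : Proposal U V) : ∃ s', Step ε s π s' ∧ s'.Trap ε := by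
  obtain ⟨s', h1, h2⟩ := exists_step_not_forced h.not_forced π
  exact ⟨s', h1, h1.proper hε hW h.proper, h2,
    fun t ht ht' => (h1.zeroLinks_le h.proper).trans (h.min t ht ht')⟩

theorem Rep.considered_lt_iff (hε : 0 < ε) (hW : ∀ u v, ∃ k : ℤ, P.W u v = k * ε)
    (hs : s.Proper ε) (h : s.Rep ε σ) {u : U} {v : V} {i : Fin (P.B (Sum.inl u))}
    {j : Fin (P.B (Sum.inr v))} (hi : s.IsConsidered (Sum.inl u) i)
    (hj : s.IsConsidered (Sum.inr v) j) :
    s.aU u i + s.aV v j < P.W u v ↔ σ.cU u + σ.cV v < (P.market hP ε).w u v := by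
  rw [hs.add_lt_iff hε hW, hi.cU_eq hε h, hj.cV_eq hε h]
  exact Iff.rfl

theorem Rep.pos_of_mem_F (hε : 0 < ε) (h : s.Rep ε σ) {u : U} {t : ℕ} (ht : t ∈ σ.F u)
    (h0 : 0 < t) : ∃ k, s.IsFreePos ⟨Sum.inl u, k⟩ ∧ level ε (s.aU u k) = t := by
  rw [h.F_eq, Multiset.mem_map] at ht
  obtain ⟨k, hk, rfl⟩ := ht
  refine ⟨k, ⟨mem_freeU.1 hk, ?_⟩, rfl⟩
  by_contra! hle
  have : level ε (s.aU u k) = 0 := Nat.floor_of_nonpos (div_nonpos_of_nonpos_of_nonneg hle hε.le)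
  omega

theorem Rep.pos_of_mem_G (hε : 0 < ε) (h : s.Rep ε σ) {v : V} {t : ℕ} (ht : t ∈ σ.G v)
    (h0 : 0 < t) : ∃ k, s.IsFreePos ⟨Sum.inr v, k⟩ ∧ level ε (s.aV v k) = t := by
  rw [h.G_eq, Multiset.mem_map] at ht
  obtain ⟨k, hk, rfl⟩ := ht
  refine ⟨k, ⟨mem_freeV.1 hk, ?_⟩, rfl⟩
  by_contra! hle
  have : level ε (s.aV v k) = 0 := Nat.floor_of_nonpos (div_nonpos_of_nonpos_of_nonneg hle hε.le)
  omega

theorem level_pos (hε : 0 < ε) {a : ℚ} (ha : 0 < a) (hk : ∃ k : ℤ, a = k * ε) : 0 < level ε a := by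
  rw [Nat.pos_iff_ne_zero]
  intro h0
  have := eq_level_mul hε ha.le hk
  rw [h0, Nat.cast_zero, zero_mul] at this
  exact ha.ne' this

/-- The profiles of the traps form a stuck set of the game. -/
theorem stuck_trap (hP : P.CapacityBound) (hε : 0 < ε)
    (hW : ∀ u v, ∃ k : ℤ, P.W u v = k * ε) :
    (P.market hP ε).Stuck {σ | ∃ s : P.State, s.Trap ε ∧ s.Rep ε σ} where
  valid := by
    rintro σ ⟨s, hs, h⟩
    exact h.valid hε hs.proper
  notCore := by
    rintro σ ⟨s, hs, h⟩ hc
    exact hs.not_forced 0 (h.isCopiesCore hε hW hs.proper hc)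
  acceptU := by
    rintro σ ⟨s, hs, h⟩ u v huv hlt
    have hl : ¬ s.Linked u v := fun hl => huv ((h.E_iff u v).2 hl)
    obtain ⟨s', h1, h2⟩ := hs.exists_step hε hW ⟨u, v, true⟩
    cases h1 with
    | skip h3 => exact absurd h3 hl
    | decrease _ i j hi hj hle =>
      exact absurd ((h.considered_lt_iff hε hW hs.proper hi hj).2 hlt) (not_lt.2 hle)
    | stay _ i j hi hj hle =>
      exact absurd ((h.considered_lt_iff hε hW hs.proper hi hj).2 hlt) (not_lt.2 hle)
    | succeed _ i j hi hj hlt' =>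
      obtain ⟨σ₁, σ₂, h3, h4, h5⟩ := h.accept (hP := hP) hε hW hs.proper hl hi hj true
        (hs.min _ h2.proper h2.not_forced) hlt'
      exact ⟨σ₁, σ₂, h3, h4, _, h2, h5⟩
  acceptV := by
    rintro σ ⟨s, hs, h⟩ u v huv hlt
    have hl : ¬ s.Linked u v := fun hl => huv ((h.E_iff u v).2 hl)
    obtain ⟨s', h1, h2⟩ := hs.exists_step hε hW ⟨u, v, false⟩
    cases h1 with
    | skip h3 => exact absurd h3 hl
    | decrease _ i j hi hj hle =>
      exact absurd ((h.considered_lt_iff hε hW hs.proper hi hj).2 hlt) (not_lt.2 hle)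
    | stay _ i j hi hj hle =>
      exact absurd ((h.considered_lt_iff hε hW hs.proper hi hj).2 hlt) (not_lt.2 hle)
    | succeed _ i j hi hj hlt' =>
      obtain ⟨σ₁, σ₂, h3, h4, h5⟩ := h.accept (hP := hP) hε hW hs.proper hl hi hj false
        (hs.min _ h2.proper h2.not_forced) hlt'
      exact ⟨σ₁, σ₂, h3, h4, _, h2, h5⟩
  lowerU := by
    rintro σ ⟨s, hs, h⟩ u v huv hle t ht h0 hmin
    have hl : ¬ s.Linked u v := fun hl => huv ((h.E_iff u v).2 hl)
    obtain ⟨k, hk, rfl⟩ := h.pos_of_mem_F hε ht h0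
    obtain ⟨s', h1, h2⟩ := hs.exists_step hε hW ⟨u, v, true⟩
    cases h1 with
    | skip h3 => exact absurd h3 hl
    | succeed _ i j hi hj hlt =>
      exact absurd ((h.considered_lt_iff hε hW hs.proper hi hj).1 hlt) (not_lt.2 hle)
    | stay _ i j hi hj _ hno => exact absurd hk (hno k)
    | decrease _ i j hi hj _ m hm =>
      change Fin (P.B (Sum.inl u)) at m
      have hm' : s.IsMinFreePos (Sum.inl u) m := hm
      have h3 : level ε (s.aU u m) = level ε (s.aU u k) := by
        refine le_antisymm (level_mono hε (hm'.2 k hk)) (hmin _ ?_ ?_)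
        · rw [h.F_eq, Multiset.mem_map]
          exact ⟨m, mem_freeU.2 hm'.1.1, rfl⟩
        · exact level_pos hε hm'.1.2 (hs.proper.2 _)
      exact ⟨_, h2, h3 ▸ h.lowerU hε hs.proper hm'.1⟩
  lowerV := by
    rintro σ ⟨s, hs, h⟩ u v huv hle t ht h0 hmin
    have hl : ¬ s.Linked u v := fun hl => huv ((h.E_iff u v).2 hl)
    obtain ⟨k, hk, rfl⟩ := h.pos_of_mem_G hε ht h0
    obtain ⟨s', h1, h2⟩ := hs.exists_step hε hW ⟨u, v, false⟩
    cases h1 with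
    | skip h3 => exact absurd h3 hl
    | succeed _ i j hi hj hlt =>
      exact absurd ((h.considered_lt_iff hε hW hs.proper hi hj).1 hlt) (not_lt.2 hle)
    | stay _ i j hi hj _ hno => exact absurd hk (hno k)
    | decrease _ i j hi hj _ m hm =>
      change Fin (P.B (Sum.inr v)) at m
      have hm' : s.IsMinFreePos (Sum.inr v) m := hm
      have h3 : level ε (s.aV v m) = level ε (s.aV v k) := by
        refine le_antisymm (level_mono hε (hm'.2 k hk)) (hmin _ ?_ ?_)
        · rw [h.G_eq, Multiset.mem_map]
          exact ⟨m, mem_freeV.2 hm'.1.1, rfl⟩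
        · exact level_pos hε hm'.1.2 (hs.proper.2 _)
      exact ⟨_, h2, h3 ▸ h.lowerV hε hs.proper hm'.1⟩

theorem exists_forced (hP : P.CapacityBound) (hε : 0 < ε)
    (hW : ∀ u v, ∃ k : ℤ, P.W u v = k * ε) (hs : s.Proper ε) : ∃ n, Forced ε n s := by
  by_contra! hno
  let S : Set P.State := {s | s.Proper ε ∧ ∀ n, ¬ Forced ε n s}
  have hS : S.Nonempty := ⟨s, hs, hno⟩
  obtain ⟨h1, h2⟩ := Function.argminOn_mem zeroLinks S hS
  have htrap : (Function.argminOn zeroLinks S hS).Trap ε :=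
    ⟨h1, h2, fun t ht ht' => Function.argminOn_le zeroLinks S ⟨ht, ht'⟩⟩
  obtain ⟨σ, hσ⟩ := exists_rep ε h1.1.1
  have h3 : σ ∈ ({σ | ∃ s : P.State, s.Trap ε ∧ s.Rep ε σ} : Set (Profile U V)) := ⟨_, htrap, hσ⟩
  rw [(stuck_trap hP hε hW).eq_empty] at h3
  exact h3

/-- There are finitely many proper states with bounded aspirations. -/
theorem finite_proper (hε : 0 < ε) (K : ℚ) :
    {s : P.State | s.Proper ε ∧ ∀ c, s.a c ≤ K}.Finite := by
  have h1 : (Set.univ.pi fun _ : P.Copy =>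
      (fun n : ℕ => (n : ℚ) * ε) '' Set.Iic (level ε K)).Finite :=
    Set.Finite.pi fun _ => (Set.finite_Iic _).image _
  refine Set.Finite.of_finite_image (f := fun s : P.State => (s.a, s.M))
    ((h1.prod (Set.finite_univ (α := Finset (P.UCopy × P.VCopy)))).subset ?_) ?_
  · rintro _ ⟨s, ⟨hs, hK⟩, rfl⟩
    exact ⟨fun c _ => ⟨_, level_mono hε (hK c), (hs.eq_level hε c).symm⟩, Set.mem_univ _⟩
  · intro s _ t _ h
    exact State.ext (Prod.mk.inj h).1 (Prod.mk.inj h).2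

theorem exists_forced_uniform (hP : P.CapacityBound) (hε : 0 < ε)
    (hW : ∀ u v, ∃ k : ℤ, P.W u v = k * ε) (K : ℚ) :
    ∃ n, ∀ s : P.State, s.Proper ε → (∀ c, s.a c ≤ K) → Forced ε n s := by
  have h : ∀ s : P.State, ∃ n, s.Proper ε → Forced ε n s := by
    intro s
    by_cases hs : s.Proper ε
    · obtain ⟨n, hn⟩ := exists_forced hP hε hW hs
      exact ⟨n, fun _ => hn⟩
    · exact ⟨0, fun h => absurd h hs⟩
  choose f hf using h
  refine ⟨(finite_proper hε K).toFinset.sup f, fun s hs hK => (hf s hs).mono ?_⟩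
  exact Finset.le_sup (f := f) ((finite_proper hε K).mem_toFinset.2 ⟨hs, hK⟩)

/-! ### The absorbing states -/

theorem IsCopiesCore.eq_of_step (hc : s.IsCopiesCore) (h : Step ε s π s') : s' = s := by
  cases h with
  | skip => rfl
  | stay => rfl
  | succeed hl i j _ _ hlt => exact absurd (hc.2.2.1 _ _ hl i j) (not_le.2 hlt)
  | decrease _ _ _ _ _ _ m hm => exact absurd (hc.2.2.2 _ hm.1.1) hm.1.2.ne'

theorem exists_isConsidered (s : P.State) (g : U ⊕ V) : ∃ k, s.IsConsidered g k := by
  classical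
  by_cases hf : ∃ k, s.IsFree ⟨g, k⟩
  · obtain ⟨k₀, h0⟩ := hf
    obtain ⟨k, hk, hmin⟩ := Finset.exists_min_image
      (Finset.univ.filter fun k => s.IsFree ⟨g, k⟩) (fun k => s.a ⟨g, k⟩)
      ⟨k₀, Finset.mem_filter.2 ⟨Finset.mem_univ _, h0⟩⟩
    exact ⟨k, fun _ => ⟨(Finset.mem_filter.1 hk).2, fun k' hk' => hmin k'
      (Finset.mem_filter.2 ⟨Finset.mem_univ _, hk'⟩)⟩, fun hno => absurd ⟨k₀, h0⟩ hno⟩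
  · obtain ⟨k, -, hmin⟩ := Finset.exists_min_image Finset.univ (fun k => s.a ⟨g, k⟩)
      ⟨⟨0, P.B_pos g⟩, Finset.mem_univ _⟩
    exact ⟨k, fun h => absurd h hf, fun _ k' => hmin k' (Finset.mem_univ _)⟩

theorem exists_isMinFreePos {g : U ⊕ V} (h : ∃ k, s.IsFreePos ⟨g, k⟩) :
    ∃ k, s.IsMinFreePos g k := by
  classical
  obtain ⟨k₀, h0⟩ := h
  obtain ⟨k, hk, hmin⟩ := Finset.exists_min_image
    (Finset.univ.filter fun k => s.IsFreePos ⟨g, k⟩) (fun k => s.a ⟨g, k⟩)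
    ⟨k₀, Finset.mem_filter.2 ⟨Finset.mem_univ _, h0⟩⟩
  exact ⟨k, (Finset.mem_filter.1 hk).2, fun k' hk' => hmin k'
    (Finset.mem_filter.2 ⟨Finset.mem_univ _, hk'⟩)⟩

theorem IsAbsorbing.le_of_isConsidered (h : s.IsAbsorbing ε) {u : U} {v : V}
    (hl : ¬ s.Linked u v) {i : Fin (P.B (Sum.inl u))} {j : Fin (P.B (Sum.inr v))}
    (hi : s.IsConsidered (Sum.inl u) i) (hj : s.IsConsidered (Sum.inr v) j) :
    P.W u v ≤ s.aU u i + s.aV v j := by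
  by_contra! hlt
  have h1 := h ⟨u, v, true⟩ _ (.succeed hl i j hi hj hlt)
  refine hl ⟨i, j, ?_⟩
  rw [← h1]
  exact Finset.mem_insert_self _ _

theorem IsAbsorbing.not_isFreePos (hε : 0 < ε) (h : s.IsAbsorbing ε) (π : Proposal U V)
    (hl : ¬ s.Linked π.u π.v) (k : Fin (P.B π.proposer)) : ¬ s.IsFreePos ⟨π.proposer, k⟩ := by
  intro hk
  obtain ⟨i, hi⟩ := s.exists_isConsidered (Sum.inl π.u)
  obtain ⟨j, hj⟩ := s.exists_isConsidered (Sum.inr π.v)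
  obtain ⟨m, hm⟩ := exists_isMinFreePos ⟨k, hk⟩
  have h1 := h π _ (.decrease hl i j hi hj (h.le_of_isConsidered hl hi hj) m hm)
  have h2 := lower_a_self (ε := ε) (s := s) ⟨π.proposer, m⟩
  rw [h1] at h2
  linarith

/-- By the capacity bound, a node with a free copy has a node to which it is not linked. So a free
copy of positive aspiration is lowered at some proposal. -/
theorem IsAbsorbing.isCopiesCore (hP : P.CapacityBound) (hε : 0 < ε)
    (hs : s.Proper ε) (h : s.IsAbsorbing ε) : s.IsCopiesCore := by
  obtain ⟨σ, hσ⟩ := exists_rep ε hs.1.1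
  have hv := hσ.valid (hP := hP) hε hs
  have hfree : s.ZeroGainFree := by
    rintro ⟨u | v, k⟩ hk
    · have hF : σ.F u ≠ 0 := by
        rw [hσ.F_eq, Ne, Multiset.map_eq_zero, Finset.val_eq_zero]
        exact Finset.ne_empty_of_mem (mem_freeU.2 hk)
      obtain ⟨v, hE⟩ := hv.exists_unlinked hF
      by_contra hne
      exact h.not_isFreePos hε ⟨u, v, true⟩ (fun hl => hE ((hσ.E_iff _ _).2 hl)) k
        ⟨hk, lt_of_le_of_ne (hs.1.2.1 _) (Ne.symm hne)⟩
    · have hG : σ.G v ≠ 0 := by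
        rw [hσ.G_eq, Ne, Multiset.map_eq_zero, Finset.val_eq_zero]
        exact Finset.ne_empty_of_mem (mem_freeV.2 hk)
      obtain ⟨u, hE⟩ := hv.exists_unlinked' hG
      by_contra hne
      exact h.not_isFreePos hε ⟨u, v, false⟩ (fun hl => hE ((hσ.E_iff _ _).2 hl)) k
        ⟨hk, lt_of_le_of_ne (hs.1.2.1 _) (Ne.symm hne)⟩
  refine ⟨hs.1.1, hs.1.2.2, fun u v hl i j => ?_, hfree⟩
  have hle : ∀ g k k', s.IsConsidered g k → s.a ⟨g, k⟩ ≤ s.a ⟨g, k'⟩ := by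
    intro g k k' hk
    by_cases hf : ∃ k', s.IsFree ⟨g, k'⟩
    · rw [hfree _ (hk.1 hf).1]
      exact hs.1.2.1 _
    · exact hk.2 hf k'
  obtain ⟨i', hi⟩ := s.exists_isConsidered (Sum.inl u)
  obtain ⟨j', hj⟩ := s.exists_isConsidered (Sum.inr v)
  exact (h.le_of_isConsidered hl hi hj).trans (add_le_add (hle _ _ i hi) (hle _ _ j hj))

end State

end BProblem

/-! ### The reduction of a copies-core solution -/

namespace BProblem

open ProposalGame

variable {U V : Type*} {P : BProblem U V} [DecidableEq U] [DecidableEq V] [Fintype U] [Fintype V]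

/-- If some points of `S` get distinct values of `a` and all others a common lower bound of `a`,
then the sum is at most the sum of `a`. -/
theorem sum_ite_le {α κ : Type*} [Fintype κ] [DecidableEq κ] {a : κ → ℚ} {m : ℚ} (hm : 0 ≤ m)
    (hle : ∀ k, m ≤ a k) {S : Finset α} (hS : S.card ≤ Fintype.card κ) {L : α → Prop}
    [DecidablePred L] {f : α → κ} (hf : Set.InjOn f {x | x ∈ S ∧ L x}) :
    ∑ x ∈ S, (if L x then a (f x) else m) ≤ ∑ k, a k := by
  have hinj : Set.InjOn f (S.filter L) := fun x hx y hy h =>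
    hf (Finset.mem_filter.1 hx) (Finset.mem_filter.1 hy) h
  have h1 : ∑ x ∈ S.filter L, a (f x) = ∑ k ∈ (S.filter L).image f, a k :=
    (Finset.sum_image hinj).symm
  have h2 : ((S.filter fun x => ¬ L x).card : ℚ) ≤ (((S.filter L).image f)ᶜ).card := by
    have h3 := Finset.card_filter_add_card_filter_not (s := S) L
    have h4 := Finset.card_add_card_compl ((S.filter L).image f)
    rw [Finset.card_image_of_injOn hinj] at h4
    exact_mod_cast (by omega)
  have h5 : (((S.filter L).image f)ᶜ).card * m ≤ ∑ k ∈ ((S.filter L).image f)ᶜ, a k := by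
    rw [← nsmul_eq_mul]
    exact Finset.card_nsmul_le_sum _ _ _ fun k _ => hle k
  rw [Finset.sum_ite, h1, Finset.sum_const, nsmul_eq_mul,
    ← Finset.sum_add_sum_compl ((S.filter L).image f)]
  have h6 := mul_le_mul_of_nonneg_right h2 hm
  linarith

theorem sum_eq_sum_filter {N : Finset (U × V)} {SU : Finset U} {SV : Finset V}
    (hN : N ⊆ SU ×ˢ SV) (g : U × V → ℚ) :
    ∑ e ∈ N, g e = ∑ u ∈ SU, ∑ v ∈ SV.filter fun v => (u, v) ∈ N, g (u, v) := by
  have h1 : N = (SU ×ˢ SV).filter (· ∈ N) := by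
    ext e
    rw [Finset.mem_filter]
    exact ⟨fun h => ⟨hN h, h⟩, fun h => h.2⟩
  conv_lhs => rw [h1]
  rw [Finset.sum_filter, Finset.sum_product]
  refine Finset.sum_congr rfl fun u _ => ?_
  rw [Finset.sum_filter]

namespace State

variable {ε : ℚ} {s : P.State}

/-- The least aspiration of the copies of a node. -/
theorem exists_min_aspiration (s : P.State) (g : U ⊕ V) :
    ∃ k, ∀ k', s.a ⟨g, k⟩ ≤ s.a ⟨g, k'⟩ := by
  obtain ⟨k, -, hk⟩ := Finset.exists_min_image Finset.univ (fun k => s.a ⟨g, k⟩)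
    ⟨⟨0, P.B_pos g⟩, Finset.mem_univ _⟩
  exact ⟨k, fun k' => hk k' (Finset.mem_univ _)⟩

/-- A copies-core solution gives every coalition at least the weight of each of its
`B`-matchings. A matched pair that is linked is charged to the aspirations on the link, and any
other pair to the least aspirations of its nodes. -/
theorem IsCopiesCore.weight_le (hs : s.IsFeasible) (hc : s.IsCopiesCore) {SU : Finset U}
    {SV : Finset V} {N : Finset (U × V)} (hN : N ⊆ SU ×ˢ SV) (hB : P.IsBMatching N) :
    P.weight N ≤ ∑ u ∈ SU, ∑ k, s.a ⟨Sum.inl u, k⟩ + ∑ v ∈ SV, ∑ k, s.a ⟨Sum.inr v, k⟩ := by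
  classical
  choose mU hmU using fun u : U => s.exists_min_aspiration (Sum.inl u)
  choose mV hmV using fun v : V => s.exists_min_aspiration (Sum.inr v)
  have hlink : ∀ u v, ∃ ij : Fin (P.B (Sum.inl u)) × Fin (P.B (Sum.inr v)), s.Linked u v →
      (⟨u, ij.1⟩, ⟨v, ij.2⟩) ∈ s.M := by
    intro u v
    by_cases h : s.Linked u v
    · obtain ⟨i, j, hm⟩ := h
      exact ⟨(i, j), fun _ => hm⟩
    · exact ⟨(mU u, mV v), fun h' => absurd h' h⟩
  choose f hf using hlink
  have hp : ∀ u v, P.W u v ≤ (if s.Linked u v then s.a ⟨Sum.inl u, (f u v).1⟩ else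
      s.a ⟨Sum.inl u, mU u⟩) + (if s.Linked u v then s.a ⟨Sum.inr v, (f u v).2⟩ else
      s.a ⟨Sum.inr v, mV v⟩) := by
    intro u v
    split_ifs with h
    · exact (hs.2.2 _ _ _ _ (hf u v h)).ge
    · exact hc.2.2.1 u v h _ _
  have h1 : P.weight N ≤ _ := Finset.sum_le_sum fun e _ => hp e.1 e.2
  rw [Finset.sum_add_distrib] at h1
  refine h1.trans (add_le_add ?_ ?_)
  · rw [sum_eq_sum_filter hN]
    refine Finset.sum_le_sum fun u _ => sum_ite_le (a := fun k => s.a ⟨Sum.inl u, k⟩)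
      (L := fun v => s.Linked u v) (f := fun v => (f u v).1) (hs.2.1 _) (hmU u) ?_ ?_
    · rw [Fintype.card_fin]
      refine le_trans ?_ (hB.1 u)
      rw [← Finset.card_image_of_injective _ (Prod.mk_right_injective u)]
      refine Finset.card_le_card fun e he => ?_
      obtain ⟨v, hv, rfl⟩ := Finset.mem_image.1 he
      exact Finset.mem_filter.2 ⟨(Finset.mem_filter.1 hv).2, rfl⟩
    · rintro v ⟨-, hv⟩ v' ⟨-, hv'⟩ h
      simp only at h
      have h2 := hs.1.1 _ (hf u v hv) _ (hf u v' hv') (by rw [h])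
      exact congrArg (fun e : P.UCopy × P.VCopy => e.2.1) h2
  · have hN' : (N.image Prod.swap) ⊆ SV ×ˢ SU := by
      intro e he
      obtain ⟨d, hd, rfl⟩ := Finset.mem_image.1 he
      have h3 := Finset.mem_product.1 (hN hd)
      exact Finset.mem_product.2 ⟨h3.2, h3.1⟩
    have h2 := sum_eq_sum_filter hN' fun e => if s.Linked e.2 e.1 then
      s.a ⟨Sum.inr e.1, (f e.2 e.1).2⟩ else s.a ⟨Sum.inr e.1, mV e.1⟩
    rw [Finset.sum_image Prod.swap_injective.injOn] at h2
    refine h2.le.trans ?_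
    refine Finset.sum_le_sum fun v _ => sum_ite_le (a := fun k => s.a ⟨Sum.inr v, k⟩)
      (L := fun u => s.Linked u v) (f := fun u => (f u v).2) (hs.2.1 _) (hmV v) ?_ ?_
    · rw [Fintype.card_fin]
      refine le_trans ?_ (hB.2 v)
      rw [← Finset.card_image_of_injective _ (Prod.mk_left_injective v)]
      refine Finset.card_le_card fun e he => ?_
      obtain ⟨u, hu, rfl⟩ := Finset.mem_image.1 he
      obtain ⟨d, hd, hd'⟩ := Finset.mem_image.1 (Finset.mem_filter.1 hu).2
      have h3 : d = (u, v) := by rw [← Prod.swap_swap d, hd']; rfl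
      exact Finset.mem_filter.2 ⟨h3 ▸ hd, rfl⟩
    · rintro u ⟨-, hu⟩ u' ⟨-, hu'⟩ h
      simp only at h
      have h2 := hs.1.2.1 _ (hf u v hu) _ (hf u' v hu') (by rw [h])
      exact congrArg (fun e : P.UCopy × P.VCopy => e.1.1) h2

/-- In a copies-core solution the weight of the matching is distributed completely, since the free
copies have aspiration zero. -/
theorem IsCopiesCore.weight_reduce (hs : s.IsFeasible) (hc : s.IsCopiesCore) :
    P.weight s.reduce.2 = ∑ u, ∑ k, s.a ⟨Sum.inl u, k⟩ + ∑ v, ∑ k, s.a ⟨Sum.inr v, k⟩ := by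
  have h1 : P.weight s.reduce.2 = ∑ e ∈ s.M, P.W e.1.1 e.2.1 := by
    unfold weight reduce
    refine Finset.sum_image fun e he d hd h => ?_
    exact hs.1.2.2 e he d hd (Prod.mk.inj h).1 (Prod.mk.inj h).2
  have h2 : ∑ e ∈ s.M, P.W e.1.1 e.2.1 =
      ∑ e ∈ s.M, s.aU e.1.1 e.1.2 + ∑ e ∈ s.M, s.aV e.2.1 e.2.2 := by
    rw [← Finset.sum_add_distrib]
    exact Finset.sum_congr rfl fun e he => (hs.2.2 _ _ _ _ he).symm
  have h3 : ∑ e ∈ s.M, s.aU e.1.1 e.1.2 = ∑ u, ∑ k, s.a ⟨Sum.inl u, k⟩ := by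
    rw [← Fintype.sum_sigma' fun u k => s.a ⟨Sum.inl u, k⟩]
    rw [← Finset.sum_subset (Finset.subset_univ (s.M.image Prod.fst)),
      Finset.sum_image fun e he d hd h => hs.1.1 e he d hd h]
    · rfl
    · rintro ⟨u, i⟩ - hn
      exact hc.2.2.2 ⟨Sum.inl u, i⟩ fun w hw => hn (Finset.mem_image.2 ⟨_, hw, rfl⟩)
  have h4 : ∑ e ∈ s.M, s.aV e.2.1 e.2.2 = ∑ v, ∑ k, s.a ⟨Sum.inr v, k⟩ := by
    rw [← Fintype.sum_sigma' fun v k => s.a ⟨Sum.inr v, k⟩]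
    rw [← Finset.sum_subset (Finset.subset_univ (s.M.image Prod.snd)),
      Finset.sum_image fun e he d hd h => hs.1.2.1 e he d hd h]
    · rfl
    · rintro ⟨v, i⟩ - hn
      exact hc.2.2.2 ⟨Sum.inr v, i⟩ fun w hw => hn (Finset.mem_image.2 ⟨_, hw, rfl⟩)
  rw [h1, h2, h3, h4]

theorem IsCopiesMatching.isBMatching_reduce (hs : s.IsCopiesMatching) :
    P.IsBMatching s.reduce.2 := by
  obtain ⟨σ, hσ⟩ := exists_rep 1 hs
  have hE : s.reduce.2 = σ.E := by
    ext ⟨u, v⟩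
    rw [hσ.E_iff]
    simp only [reduce, Finset.mem_image]
    constructor
    · rintro ⟨⟨⟨u', i⟩, ⟨v', j⟩⟩, hm, he⟩
      obtain ⟨rfl, rfl⟩ := Prod.mk.inj he
      exact ⟨i, j, hm⟩
    · rintro ⟨i, j, hm⟩
      exact ⟨_, hm, rfl⟩
  rw [hE]
  exact ⟨fun u => (hσ.card_filter_fst hs u) ▸ Nat.le_add_left _ _,
    fun v => (hσ.card_filter_snd hs v) ▸ Nat.le_add_left _ _⟩

theorem IsCopiesCore.isNodesCore (hs : s.IsFeasible) (hc : s.IsCopiesCore) :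
    P.IsNodesCore s.reduce := by
  classical
  have hB := hs.1.isBMatching_reduce
  have hle : ∀ (SU : Finset U) (SV : Finset V), P.maxValue SU SV ≤
      ∑ u ∈ SU, ∑ k, s.a ⟨Sum.inl u, k⟩ + ∑ v ∈ SV, ∑ k, s.a ⟨Sum.inr v, k⟩ := by
    intro SU SV
    refine Finset.sup'_le _ _ fun N hN => ?_
    obtain ⟨h1, h2⟩ := Finset.mem_filter.1 hN
    exact hc.weight_le hs (Finset.mem_powerset.1 h1) h2
  have hw := hc.weight_reduce hs
  have hmax : P.weight s.reduce.2 = P.maxValue Finset.univ Finset.univ := by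
    refine le_antisymm ?_ (hw ▸ hle _ _)
    refine Finset.le_sup' P.weight (Finset.mem_filter.2 ⟨Finset.mem_powerset.2 ?_, hB⟩)
    exact fun e _ => Finset.mem_product.2 ⟨Finset.mem_univ _, Finset.mem_univ _⟩
  refine ⟨⟨hle, ?_⟩, hB, hmax⟩
  rw [← hmax, hw, Fintype.sum_sum_type]
  rfl

end State

end BProblem

/-! ### Convergence with probability one -/

namespace BProblem

open State
open scoped ENNReal

variable {U V : Type*} [Fintype U] [Fintype V]

instance finite_proposal : Finite (Proposal U V) :=
  Finite.of_injective (fun π : Proposal U V => (π.u, π.v, π.byU)) fun π π' h => by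
    obtain ⟨h1, h2⟩ := Prod.mk.inj h
    obtain ⟨h2, h3⟩ := Prod.mk.inj h2
    exact Proposal.ext h1 h2 h3

variable [Nonempty U] [Nonempty V]

theorem proposalLaw_ne_zero (π : Proposal U V) : proposalLaw U V π ≠ 0 := by
  rw [← PMF.mem_support_iff, proposalLaw, PMF.mem_support_bind_iff]
  obtain ⟨u, v, b⟩ := π
  cases b
  · refine ⟨Sum.inr v, by simp, ?_⟩
    simp only [PMF.mem_support_map_iff]
    exact ⟨u, by simp, rfl⟩
  · refine ⟨Sum.inl u, by simp, ?_⟩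
    simp only [PMF.mem_support_map_iff]
    exact ⟨v, by simp, rfl⟩

theorem exists_le_proposalLaw (U V : Type*) [Fintype U] [Fintype V] [Nonempty U] [Nonempty V] :
    ∃ c : ℝ≥0∞, c ≠ 0 ∧ ∀ π : Proposal U V, c ≤ proposalLaw U V π := by
  have : Nonempty (Proposal U V) := ⟨⟨Classical.arbitrary U, Classical.arbitrary V, true⟩⟩
  obtain ⟨π, hπ⟩ := Finite.exists_min fun π : Proposal U V => proposalLaw U V π
  exact ⟨_, proposalLaw_ne_zero π, hπ⟩

variable [DecidableEq U] [DecidableEq V] {P : BProblem U V} {ε : ℚ} {Ω : Type*}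
  {mΩ : MeasurableSpace Ω} {μ : Measure Ω} {ℱ : Filtration ℕ mΩ} {X : ℕ → Ω → P.State}
  {π : ℕ → Ω → Proposal U V}

namespace IsProposalsDynamics

theorem ae_proper (hε : 0 < ε) (hW : ∀ u v, ∃ k : ℤ, P.W u v = k * ε)
    (D : P.IsProposalsDynamics ε μ ℱ X π) (h0 : ∀ᵐ ω ∂μ, (X 0 ω).Proper ε) :
    ∀ᵐ ω ∂μ, ∀ n, (X n ω).Proper ε := by
  filter_upwards [h0, ae_all_iff.2 D.step] with ω h hstep n
  induction n with
  | zero => exact h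
  | succ n ih => exact (hstep n).proper hε hW ih

theorem ae_eq_of_core (D : P.IsProposalsDynamics ε μ ℱ X π) :
    ∀ᵐ ω ∂μ, ∀ m, (X m ω).IsCopiesCore → ∀ n, m ≤ n → X n ω = X m ω := by
  filter_upwards [ae_all_iff.2 D.step] with ω hstep m hc n hmn
  induction n, hmn using Nat.le_induction with
  | base => rfl
  | succ n _ ih =>
    have h1 := hstep n
    rw [ih] at h1
    exact hc.eq_of_step h1

theorem measurableSet_state (D : P.IsProposalsDynamics ε μ ℱ X π) (n : ℕ) (S : Set P.State) :
    MeasurableSet[ℱ n] {ω | X n ω ∈ S} :=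
  D.measurable_state n (t := S) trivial

/-- Whatever the history, the next proposal has a given value with probability at least `c`. -/
theorem mul_le_of_eq (D : P.IsProposalsDynamics ε μ ℱ X π) {c : ℝ≥0∞}
    (hc : ∀ π : Proposal U V, c ≤ proposalLaw U V π) {t : ℕ} {A : Set Ω}
    (hA : MeasurableSet[ℱ t] A) (p : Proposal U V) : c * μ A ≤ μ ({ω | π t ω = p} ∩ A) := by
  have : MeasurableSingletonClass (Proposal U V) := ⟨fun _ => trivial⟩
  have h1 := (Indep_iff _ _ μ).1 (D.indep t) {ω | π t ω = p} A ⟨{p}, trivial, rfl⟩ hA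
  have h2 : μ {ω | π t ω = p} = proposalLaw U V p := by
    rw [← PMF.toMeasure_apply_singleton _ p (MeasurableSet.singleton p), ← D.law t,
      Measure.map_apply ((D.measurable_proposal t).mono (ℱ.le _) le_rfl)
        (MeasurableSet.singleton p)]
    rfl
  rw [h1, h2]
  exact mul_le_mul_left (hc p) _

/-- If on an event of the history the core can be forced in `n` iterations, then it is reached
with conditional probability at least `c ^ n`: at each time the forcing proposal, which depends on
the current state only, is made with conditional probability at least `c`. -/
theorem pow_mul_le_of_forced (D : P.IsProposalsDynamics ε μ ℱ X π) {c : ℝ≥0∞}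
    (hc : ∀ π : Proposal U V, c ≤ proposalLaw U V π) (n : ℕ) {t : ℕ} {A : Set Ω}
    (hA : MeasurableSet[ℱ t] A) (hF : ∀ᵐ ω ∂μ, ω ∈ A → Forced ε n (X t ω)) :
    c ^ n * μ A ≤ μ (A ∩ {ω | (X (t + n) ω).IsCopiesCore}) := by
  classical
  induction n generalizing t A with
  | zero =>
    rw [pow_zero, one_mul]
    refine measure_mono_ae ?_
    filter_upwards [hF] with ω h hω
    exact ⟨hω, h hω⟩
  | succ n ih =>
    have hchoice : ∀ s : P.State, ∃ p : Proposal U V, Forced ε (n + 1) s →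
        ∀ s', Step ε s p s' → Forced ε n s' := by
      intro s
      by_cases hs : Forced ε (n + 1) s
      · rcases hs with hs | ⟨p, hp⟩
        · refine ⟨⟨Classical.arbitrary U, Classical.arbitrary V, true⟩, fun _ s' h => ?_⟩
          rw [hs.eq_of_step h]
          exact Forced.mono (m := 0) hs (Nat.zero_le n)
        · exact ⟨p, fun _ => hp⟩
      · exact ⟨⟨Classical.arbitrary U, Classical.arbitrary V, true⟩, fun h => absurd h hs⟩
    choose f hf using hchoice
    have : Fintype (Proposal U V) := Fintype.ofFinite _
    have hAp : ∀ p, MeasurableSet[ℱ t] (A ∩ {ω | f (X t ω) = p}) := fun p =>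
      hA.inter (D.measurableSet_state t {s | f s = p})
    have hBp : ∀ p, MeasurableSet[ℱ (t + 1)]
        ({ω | π t ω = p} ∩ (A ∩ {ω | f (X t ω) = p})) := fun p =>
      (D.measurable_proposal t (t := {p}) trivial).inter
        (ℱ.mono (Nat.le_succ t) _ (hAp p))
    set B := ⋃ p, ({ω | π t ω = p} ∩ (A ∩ {ω | f (X t ω) = p})) with hB
    have hBm : MeasurableSet[ℱ (t + 1)] B := MeasurableSet.iUnion hBp
    have h1 : c * μ A ≤ μ B := by
      have hAu : A = ⋃ p, (A ∩ {ω | f (X t ω) = p}) := by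
        ext ω
        simp
      have h2 : μ B = ∑ p, μ ({ω | π t ω = p} ∩ (A ∩ {ω | f (X t ω) = p})) := by
        rw [hB, measure_iUnion, tsum_fintype]
        · intro p q hpq
          refine Set.disjoint_left.2 fun ω h3 h4 => hpq ?_
          exact h3.1.symm.trans h4.1
        · exact fun p => ℱ.le _ _ (hBp p)
      calc c * μ A ≤ c * ∑ p, μ (A ∩ {ω | f (X t ω) = p}) := by
            refine mul_le_mul_right ?_ _
            conv_lhs => rw [hAu]
            exact measure_iUnion_fintype_le _ _
        _ = ∑ p, c * μ (A ∩ {ω | f (X t ω) = p}) := Finset.mul_sum _ _ _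
        _ ≤ μ B := by
            rw [h2]
            exact Finset.sum_le_sum fun p _ => D.mul_le_of_eq hc (hAp p) p
    have h2 : ∀ᵐ ω ∂μ, ω ∈ B → Forced ε n (X (t + 1) ω) := by
      filter_upwards [hF, D.step t] with ω hω hstep hωB
      obtain ⟨p, h3, h4, h5⟩ := Set.mem_iUnion.1 hωB
      refine hf _ (hω h4) _ ?_
      rw [show f (X t ω) = p from h5, ← (show π t ω = p from h3)]
      exact hstep
    have h3 := ih hBm h2
    calc c ^ (n + 1) * μ A = c ^ n * (c * μ A) := by rw [pow_succ, mul_assoc]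
      _ ≤ c ^ n * μ B := mul_le_mul_right h1 _
      _ ≤ _ := h3
      _ ≤ _ := by
        refine measure_mono fun ω hω => ?_
        obtain ⟨h4, h5⟩ := hω
        obtain ⟨p, -, h6, -⟩ := Set.mem_iUnion.1 h4
        refine ⟨h6, ?_⟩
        rwa [Set.mem_ofPred_eq, show t + (n + 1) = t + 1 + n by ring]

/-- On the event that the initial aspirations are at most `K`, the core is reached almost surely:
while it is not reached, every block of `N` iterations reaches it with conditional probability at
least `c ^ N`, and these disjoint events have total probability at most one. -/
theorem ae_exists_core_of_le (hP : P.CapacityBound) (hε : 0 < ε)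
    (hW : ∀ u v, ∃ k : ℤ, P.W u v = k * ε) [IsProbabilityMeasure μ]
    (D : P.IsProposalsDynamics ε μ ℱ X π) (h0 : ∀ᵐ ω ∂μ, (X 0 ω).Proper ε) (K : ℚ) :
    ∀ᵐ ω ∂μ, (∀ c, (X 0 ω).a c ≤ K) → ∃ n, (X n ω).IsCopiesCore := by
  obtain ⟨c, hc0, hc⟩ := exists_le_proposalLaw U V
  set K' := max K (∑ u, ∑ v, P.W u v)
  have hK' : ∀ u v, P.W u v ≤ K' := fun u v => by
    refine le_trans ?_ (le_max_right _ _)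
    refine le_trans (Finset.single_le_sum (fun v _ => P.W_nonneg u v) (Finset.mem_univ v)) ?_
    exact Finset.single_le_sum (f := fun u => ∑ v, P.W u v)
      (fun u _ => Finset.sum_nonneg fun v _ => P.W_nonneg u v) (Finset.mem_univ u)
  obtain ⟨N, hN⟩ := exists_forced_uniform hP hε hW K'
  have hbd : ∀ᵐ ω ∂μ, (∀ c, (X 0 ω).a c ≤ K) → ∀ n c, (X n ω).a c ≤ K' := by
    filter_upwards [D.ae_proper hε hW h0, ae_all_iff.2 D.step] with ω hp hstep hK n
    induction n with
    | zero => exact fun c => (hK c).trans (le_max_left _ _)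
    | succ n ih => exact (hstep n).le_of_le hε hK' (hp n) ih
  let B : ℕ → Set Ω := fun j =>
    {ω | X 0 ω ∈ {s : P.State | ∀ c, s.a c ≤ K}} ∩
      {ω | X (j * N) ω ∈ {s : P.State | ¬ s.IsCopiesCore}}
  have hB : ∀ j, MeasurableSet[ℱ (j * N)] (B j) := fun j =>
    (ℱ.mono (Nat.zero_le _) _ (D.measurableSet_state 0 _)).inter (D.measurableSet_state _ _)
  have hstep : ∀ j, c ^ N * μ (B j) + μ (B (j + 1)) ≤ μ (B j) := by
    intro j
    have h1 := D.pow_mul_le_of_forced hc N (hB j) (by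
      filter_upwards [D.ae_proper hε hW h0, hbd] with ω hp hb hω
      exact hN _ (hp _) (hb hω.1 _))
    have hmeas : MeasurableSet {ω | (X (j * N + N) ω).IsCopiesCore} :=
      ℱ.le _ _ (D.measurableSet_state _ {s | s.IsCopiesCore})
    have h2 : μ (B (j + 1)) ≤ μ (B j \ {ω | (X (j * N + N) ω).IsCopiesCore}) := by
      refine measure_mono_ae ?_
      filter_upwards [D.ae_eq_of_core] with ω hω hωB
      have h3 : ¬ (X (j * N + N) ω).IsCopiesCore := by
        have h4 := hωB.2
        rwa [Set.mem_ofPred_eq, Set.mem_ofPred_eq, show (j + 1) * N = j * N + N by ring] at h4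
      refine ⟨⟨hωB.1, fun h4 => h3 ?_⟩, h3⟩
      rw [hω _ h4 _ (Nat.le_add_right _ _)]
      exact h4
    calc c ^ N * μ (B j) + μ (B (j + 1)) ≤ _ := add_le_add h1 h2
      _ = μ (B j) := measure_inter_add_sdiff _ hmeas
  set Binf := ⋂ j, B j
  have hsum : ∀ j : ℕ, j * (c ^ N * μ Binf) + μ (B j) ≤ 1 := by
    intro j
    induction j with
    | zero => simpa using prob_le_one
    | succ j ih =>
      refine le_trans ?_ ih
      have h1 : c ^ N * μ Binf ≤ c ^ N * μ (B j) :=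
        mul_le_mul_right (measure_mono (Set.iInter_subset _ _)) _
      calc _ = j * (c ^ N * μ Binf) + (c ^ N * μ Binf + μ (B (j + 1))) := by
            push_cast
            ring
        _ ≤ j * (c ^ N * μ Binf) + (c ^ N * μ (B j) + μ (B (j + 1))) := by gcongr
        _ ≤ _ := by
            gcongr
            exact hstep j
  have hzero : μ Binf = 0 := by
    by_contra hne
    obtain ⟨j, hj⟩ := ENNReal.exists_nat_mul_gt (a := c ^ N * μ Binf) (b := 1)
      (mul_ne_zero (pow_ne_zero _ hc0) hne) ENNReal.one_ne_top
    exact absurd ((le_self_add).trans (hsum j)) (not_le.2 hj)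
  filter_upwards [measure_eq_zero_iff_ae_notMem.1 hzero] with ω hω hK
  by_contra! hno
  exact hω (Set.mem_iInter.2 fun j => ⟨hK, hno _⟩)

end IsProposalsDynamics

end BProblem

theorem theorem2 {U V : Type*} [Fintype U] [Fintype V] [Nonempty U] [Nonempty V] [DecidableEq U]
    [DecidableEq V] (P : BProblem U V) (hP : P.CapacityBound) (ε : ℚ) (hε : 0 < ε)
    (hW : ∀ u v, ∃ k : ℤ, P.W u v = k * ε) :
    (∀ {Ω : Type*} {mΩ : MeasurableSpace Ω} (μ : Measure Ω) [IsProbabilityMeasure μ]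
        (ℱ : Filtration ℕ mΩ) (X : ℕ → Ω → P.State) (π : ℕ → Ω → Proposal U V),
        P.IsProposalsDynamics ε μ ℱ X π →
        (∀ᵐ ω ∂μ, (X 0 ω).IsFeasible ∧ (X 0 ω).OnGrid ε) →
        ∀ᵐ ω ∂μ, ∃ s : P.State, s.IsFeasible ∧ s.IsCopiesCore ∧ P.IsNodesCore s.reduce ∧
          ∃ N, ∀ n, N ≤ n → X n ω = s) ∧
    (∀ K : ℚ, ∃ (T : ℕ) (δ : ℝ), 0 < δ ∧
      ∀ {Ω : Type*} {mΩ : MeasurableSpace Ω} (μ : Measure Ω) [IsProbabilityMeasure μ]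
        (ℱ : Filtration ℕ mΩ) (X : ℕ → Ω → P.State) (π : ℕ → Ω → Proposal U V),
        P.IsProposalsDynamics ε μ ℱ X π →
        (∀ᵐ ω ∂μ, (X 0 ω).IsFeasible ∧ (X 0 ω).OnGrid ε ∧ ∀ c, (X 0 ω).a c ≤ K) →
        δ ≤ μ.real {ω | (X T ω).IsCopiesCore}) ∧
    (∀ s : P.State, s.IsFeasible → s.OnGrid ε → (s.IsAbsorbing ε ↔ s.IsCopiesCore)) := by
  refine ⟨?_, fun K => ?_, fun s hs hg => ?_⟩
  · intro Ω mΩ μ _ ℱ X π D h0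
    filter_upwards [D.ae_proper hε hW h0, D.ae_eq_of_core,
      ae_all_iff.2 fun K : ℕ => D.ae_exists_core_of_le hP hε hW h0 K] with ω hp heq hcore
    obtain ⟨K, hK⟩ : ∃ K : ℕ, ∀ c, (X 0 ω).a c ≤ K := by
      obtain ⟨K, hK⟩ := exists_nat_ge (∑ c, (X 0 ω).a c)
      exact ⟨K, fun c => le_trans (Finset.single_le_sum (fun c _ => (hp 0).1.2.1 c)
        (Finset.mem_univ c)) hK⟩
    obtain ⟨n, hn⟩ := hcore K hK
    exact ⟨X n ω, (hp n).1, hn, hn.isNodesCore (hp n).1, n, heq n hn⟩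
  · obtain ⟨c, hc0, hc⟩ := BProblem.exists_le_proposalLaw U V
    obtain ⟨N, hN⟩ := BProblem.State.exists_forced_uniform hP hε hW K
    have hc1 : c ≤ 1 :=
      (hc ⟨Classical.arbitrary U, Classical.arbitrary V, true⟩).trans (PMF.coe_le_one _ _)
    have htop : c ^ N ≠ ⊤ := ENNReal.pow_ne_top (ne_top_of_le_ne_top ENNReal.one_ne_top hc1)
    refine ⟨N, (c ^ N).toReal, ENNReal.toReal_pos (pow_ne_zero _ hc0) htop, ?_⟩
    intro Ω mΩ μ _ ℱ X π D h0
    have h1 := D.pow_mul_le_of_forced hc N (t := 0) (A := Set.univ) MeasurableSet.univ (by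
      filter_upwards [h0] with ω hω _
      exact hN _ ⟨hω.1, hω.2.1⟩ hω.2.2)
    rw [measure_univ, mul_one, Set.univ_inter, zero_add] at h1
    exact ENNReal.toReal_mono (measure_ne_top _ _) h1
  · exact ⟨fun h => h.isCopiesCore hP hε ⟨hs, hg⟩, fun hc π s' h => hc.eq_of_step h⟩
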